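/- A quantum circuit on $N$ qubits has depth $d$ if it is a product $M_d\cdots M_1$ of layers, each layer being a product of gates that act on pairwise disjoint sets of qubits; its size is its number of gates plus its number of qubits $N$. For $f\colon\{0,1\}^n\to\{0,1\}$ let $U_f\colon|x\rangle|b\rangle\mapsto|x\rangle|b\oplus f(x)\rangle$, let $\mathrm{Th}_{\ge k}(x)=1$ iff the Hamming weight $|x|$ is at least $k$, and let $\mathrm{Fanout}_n\colon|b\rangle|x_1,\dots,x_n\rangle\mapsto|b\rangle|x_1\oplus b,\dots,x_n\oplus b\rangle$. Consider the gate sets - $\mathsf{QTC}$: all single- and two-qubit gates and all $U_{\mathrm{Th}_{\ge k}}$ ($k\ge0$, any number of inputs); - $\mathsf{QNC}_{\mathrm{wf}}$: all single- and two-qubit gates and all $\mathrm{Fanout}_n$ ($n\ge1$); - $\mathsf{QAC}_{\mathrm{wf}}$: all single-qubit gates, all generalized Toffoli gates $U_{\mathrm{AND}_n}$ ($n\ge1$) and all $\mathrm{Fanout}_n$ ($n\ge1$). A circuit $C$ on $n+a+1$ qubits decides $f\colon\{0,1\}^n\to\{0,1\}$ with error $\epsilon$ if for every $x\in\{0,1\}^n$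 the last qubit of $C|x\rangle|0^a\rangle|0\rangle$ measures to $f(x)$ with probability at least $1-\epsilon$. For each of the three gate sets, $\mathsf{EQTC}^0,\mathsf{EQNC}^0_{\mathrm{wf}},\mathsf{EQAC}^0_{\mathrm{wf}}$ (respectively $\mathsf{BQTC}^0,\mathsf{BQNC}^0_{\mathrm{wf}},\mathsf{BQAC}^0_{\mathrm{wf}}$) is the class of languages $L\subseteq\{0,1\}^*$ for which there are a constant $d$, a polynomial $p$ and, for every $n$, a circuit over that gate set of depth at most $d$ and size at most $p(n)$ that decides the indicator function of $L\cap\{0,1\}^n$ with error $0$ (respectively $1/3$). An $(n+m)$-qubit state is an $n$-qubit nekomata if, up to reordering its qubits, it equals $\frac1{\sqrt2}|0^n\rangle|\phi_0\rangle+\frac1{\sqrt2}|1^n\rangle|\phi_1\rangle$ for some normalized $m$-qubit states $|\phi_0\rangle,|\phi_1\rangle$. **Theorem.** 1. There are a constant $d$ and a polynomial $p$ such that for every $n$ there are $m,a\ge0$, an $n$-qubit nekomata $|\psi\rangle$ on $n+m$ qubits, and a $\mathsf{QTC}$ circuit $C$ of depth at most $d$ and size at most $p(n)$ that prepares it exactly: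 $C|0^{n+m}\rangle|0^a\rangle=|\psi\rangle|0^a\rangle$. 2. $\mathsf{BQTC}^0=\mathsf{BQNC}^0_{\mathrm{wf}}=\mathsf{BQAC}^0_{\mathrm{wf}}$ and $\mathsf{EQTC}^0=\mathsf{EQNC}^0_{\mathrm{wf}}=\mathsf{EQAC}^0_{\mathrm{wf}}$. 3. The parity language $\{x\in\{0,1\}^*:|x|\text{ is odd}\}$ belongs to $\mathsf{EQTC}^0$. -/

import Mathlib

namespace QC

/-! ### Bit strings, states, gates -/

/-- Bit strings of length `n`; these label the computational basis of `n` qubits. -/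
abbrev Bits (n : ℕ) : Type := Fin n → Bool

/-- The Hamming weight `|x|`. -/
def weight {n : ℕ} (x : Bits n) : ℕ := (Finset.univ.filter fun i => x i = true).card

/-- Vectors of `n`-qubit amplitudes. -/
abbrev State (n : ℕ) : Type := Bits n → ℂ

/-- `ψ` is a unit vector, i.e. a quantum state. -/
def IsNormalized {n : ℕ} (ψ : State n) : Prop := ∑ x, ‖ψ x‖ ^ 2 = 1

/-- The computational basis state `|x⟩`. -/
def ket {n : ℕ} (x : Bits n) : State n := Pi.single x 1

/-- The all-`b` string `bⁿ`. -/
def constBits (n : ℕ) (b : Bool) : Bits n := fun _ => b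

/-- The tensor product `|ψ⟩|φ⟩`. -/
def tensor {n m : ℕ} (ψ : State n) (φ : State m) : State (n + m) :=
  fun y => ψ (fun i => y (Fin.castAdd m i)) * φ (fun j => y (Fin.natAdd n j))

/-- The matrix with `|x⟩ ↦ |σ x⟩`. -/
def permMatrix {k : ℕ} (σ : Equiv.Perm (Bits k)) : Matrix (Bits k) (Bits k) ℂ :=
  fun y x => if y = σ x then 1 else 0

theorem permMatrix_mem {k : ℕ} (σ : Equiv.Perm (Bits k)) :
    permMatrix σ ∈ Matrix.unitaryGroup (Bits k) ℂ := by
  rw [Matrix.mem_unitaryGroup_iff']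
  ext x y
  simp [Matrix.mul_apply, Matrix.star_apply, permMatrix, Matrix.one_apply, eq_comm]

/-- A quantum gate: its number of qubits together with a unitary on them. -/
abbrev Gate : Type := Σ k : ℕ, Matrix.unitaryGroup (Bits k) ℂ

/-- The gate `|x⟩ ↦ |σ x⟩` of a permutation of the basis. -/
def permGate {k : ℕ} (σ : Equiv.Perm (Bits k)) : Gate :=
  ⟨k, ⟨permMatrix σ, permMatrix_mem σ⟩⟩

/-- `(b, x₁, …, xₙ) ↦ (b, x₁ ⊕ b, …, xₙ ⊕ b)`. -/
def fanoutMap (n : ℕ) (y : Bits (n + 1)) : Bits (n + 1) :=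
  Fin.cons (y 0) (fun i : Fin n => xor (y i.succ) (y 0))

theorem fanoutMap_involutive (n : ℕ) : Function.Involutive (fanoutMap n) := by
  intro y
  funext i
  refine Fin.cases ?_ (fun j => ?_) i <;> simp [fanoutMap]

/-- The fanout gate on `n + 1` qubits. -/
def fanoutGate (n : ℕ) : Gate := permGate (fanoutMap_involutive n).toPerm

/-- `(x₁, …, xₙ, b) ↦ (x₁, …, xₙ, b ⊕ f x)`. -/
def oracleMap {n : ℕ} (f : Bits n → Bool) (y : Bits (n + 1)) : Bits (n + 1) :=
  Fin.snoc (Fin.init y : Bits n) (xor (y (Fin.last n)) (f (Fin.init y)))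

theorem oracleMap_involutive {n : ℕ} (f : Bits n → Bool) :
    Function.Involutive (oracleMap f) := by
  intro y
  funext i
  refine Fin.lastCases ?_ (fun j => ?_) i <;> simp [oracleMap, Fin.init]

/-- The gate `U_f : |x⟩|b⟩ ↦ |x⟩|b ⊕ f x⟩` on `n + 1` qubits. -/
def oracleGate {n : ℕ} (f : Bits n → Bool) : Gate := permGate (oracleMap_involutive f).toPerm

/-- The threshold function of weight `k` on `n` bits. -/
def threshold (n k : ℕ) (x : Bits n) : Bool := decide (k ≤ weight x)

/-- The conjunction of `n` bits. -/
def andFun (n : ℕ) (x : Bits n) : Bool := decide (∀ i, x i = true)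

/-! ### Gate sets -/

/-- All single-qubit gates. -/
def oneQubit : Set Gate := {g | g.1 = 1}

/-- All two-qubit gates. -/
def twoQubit : Set Gate := {g | g.1 = 2}

/-- All fanout gates. -/
def fanoutGates : Set Gate := {g | ∃ n : ℕ, 1 ≤ n ∧ g = fanoutGate n}

/-- All quantum threshold gates, of every input length and every weight. -/
def thresholdGates : Set Gate := {g | ∃ n k : ℕ, g = oracleGate (threshold n k)}

/-- All generalized Toffoli gates. -/
def toffoliGates : Set Gate := {g | ∃ n : ℕ, 1 ≤ n ∧ g = oracleGate (andFun n)}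

/-- `QTC` circuits: single- and two-qubit gates and quantum threshold gates. -/
def QTC : Set Gate := oneQubit ∪ twoQubit ∪ thresholdGates

/-- `QNC_wf` circuits: single- and two-qubit gates and fanout gates. -/
def QNCwf : Set Gate := oneQubit ∪ twoQubit ∪ fanoutGates

/-- `QAC_wf` circuits: single-qubit gates, generalized Toffoli gates and fanout gates. -/
def QACwf : Set Gate := oneQubit ∪ toffoliGates ∪ fanoutGates

/-! ### Circuits -/

/-- A gate together with the (distinct) qubits, out of `N`, on which it acts. -/
structure PlacedGate (N : ℕ) where
  gate : Gate
  wires : Fin gate.1 ↪ Fin N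

/-- The action on all `N` qubits: the gate on its own qubits, the identity on the others. -/
def PlacedGate.matrix {N : ℕ} (g : PlacedGate N) : Matrix (Bits N) (Bits N) ℂ :=
  fun y x =>
    if ∀ i, (∀ j, g.wires j ≠ i) → y i = x i then
      g.gate.2.1 (fun j => y (g.wires j)) (fun j => x (g.wires j))
    else 0

/-- A layer: gates operating on pairwise disjoint sets of qubits. -/
structure Layer (N : ℕ) where
  gates : List (PlacedGate N)
  disjoint : gates.Pairwise fun g h => Disjoint (Set.range g.wires) (Set.range h.wires)

/-- The product of the gates of a layer (they commute, so the order is immaterial). -/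
def Layer.matrix {N : ℕ} (l : Layer N) : Matrix (Bits N) (Bits N) ℂ :=
  (l.gates.map PlacedGate.matrix).prod

/-- A circuit on `N` qubits: the list of its layers, the one applied first at the head. -/
structure Circuit (N : ℕ) where
  layers : List (Layer N)

namespace Circuit

variable {N : ℕ}

/-- The product `M_d ⋯ M_1` of the layers `[M_1, …, M_d]`. -/
def matrix (C : Circuit N) : Matrix (Bits N) (Bits N) ℂ :=
  (C.layers.reverse.map Layer.matrix).prod

/-- The number of layers. -/
def depth (C : Circuit N) : ℕ := C.layers.length

/-- The number of gates plus the number of qubits. -/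
def size (C : Circuit N) : ℕ := (C.layers.map fun l => l.gates.length).sum + N

/-- Every gate of the circuit belongs to `S`. -/
def HasGateSet (C : Circuit N) (S : Set Gate) : Prop :=
  ∀ l ∈ C.layers, ∀ g ∈ l.gates, g.gate ∈ S

/-- The final state when the circuit is run on the basis state `|x⟩`. -/
def run (C : Circuit N) (x : Bits N) : State N := C.matrix.mulVec (ket x)

end Circuit

/-- The probability that measuring the last qubit of `ψ` in the computational basis gives `b`. -/
noncomputable def probLast {N : ℕ} (ψ : State (N + 1)) (b : Bool) : ℝ :=
  ∑ y, if y (Fin.last N) = b then ‖ψ y‖ ^ 2 else 0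

/-- The bit string `x 0ᵃ 0`. -/
def inputBits {n : ℕ} (x : Bits n) (a : ℕ) : Bits (n + a + 1) :=
  Fin.snoc (Fin.append x (constBits a false) : Bits (n + a)) false

/-- `C` decides `f` with `a` ancillas and error `ε`: for every `x`, the last qubit of
`C |x⟩|0ᵃ⟩|0⟩` measures to `f x` with probability at least `1 - ε`. -/
def Decides {n a : ℕ} (C : Circuit (n + a + 1)) (f : Bits n → Bool) (ε : ℝ) : Prop :=
  ∀ x : Bits n, 1 - ε ≤ probLast (C.run (inputBits x a)) (f x)

open Classical in
/-- The indicator function of a language on inputs of length `n`. -/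
noncomputable def slice (L : Language Bool) (n : ℕ) (x : Bits n) : Bool :=
  decide (List.ofFn x ∈ L)

/-- The languages decided with error `ε` by (non-uniform families of) constant-depth
polynomial-size circuits over the gate set `S`. -/
def constDepthPolySize (S : Set Gate) (ε : ℝ) : Set (Language Bool) :=
  {L | ∃ (d : ℕ) (p : Polynomial ℕ), ∀ n : ℕ, ∃ (a : ℕ) (C : Circuit (n + a + 1)),
    C.HasGateSet S ∧ C.depth ≤ d ∧ C.size ≤ p.eval n ∧ Decides C (slice L n) ε}

/-! ### The classes -/

/-- Bounded error `QTC⁰`. -/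
def BQTC0 : Set (Language Bool) := constDepthPolySize QTC (1 / 3)

/-- Exact `QTC⁰`. -/
def EQTC0 : Set (Language Bool) := constDepthPolySize QTC 0

/-- Bounded error `QNC⁰_wf`. -/
def BQNCwf0 : Set (Language Bool) := constDepthPolySize QNCwf (1 / 3)

/-- Exact `QNC⁰_wf`. -/
def EQNCwf0 : Set (Language Bool) := constDepthPolySize QNCwf 0

/-- Bounded error `QAC⁰_wf`. -/
def BQACwf0 : Set (Language Bool) := constDepthPolySize QACwf (1 / 3)

/-- Exact `QAC⁰_wf`. -/
def EQACwf0 : Set (Language Bool) := constDepthPolySize QACwf 0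

/-- The words with an odd number of ones. -/
def parity : Language Bool := {w | Odd (w.count true)}

/-! ### State preparation -/

/-- `C` prepares `ψ` with `a` ancillas: `C |0ⁿ⟩|0ᵃ⟩ = |ψ⟩|0ᵃ⟩`. -/
def Prepares {n a : ℕ} (C : Circuit (n + a)) (ψ : State n) : Prop :=
  C.run (constBits (n + a) false) = tensor ψ (ket (constBits a false))

/-- The `(n+m)`-qubit state `ψ` is an `n`-qubit nekomata: after reordering the qubits, it is
`(|0ⁿ⟩|φ₀⟩ + |1ⁿ⟩|φ₁⟩) / √2` for some `m`-qubit states `φ₀`, `φ₁`. -/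
def IsNekomata {n m : ℕ} (ψ : State (n + m)) : Prop :=
  IsNormalized ψ ∧ ∃ (σ : Equiv.Perm (Fin (n + m))) (φ₀ φ₁ : State m),
    IsNormalized φ₀ ∧ IsNormalized φ₁ ∧
    (fun y : Bits (n + m) => ψ (fun i => y (σ i))) =
      ((1 / √2 : ℝ) : ℂ) • tensor (ket (constBits n false)) φ₀ +
      ((1 / √2 : ℝ) : ℂ) • tensor (ket (constBits n true)) φ₁

end QC

namespace QC

open Matrix

set_option linter.unusedSectionVars false

/-! ### Operators on labelled qubits -/

/-! All simulations are exact and return their ancillas clean: `Impl` asks for a circuit that sends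
|x⟩|0⟩ to (M|x⟩)|0⟩. This notion is closed under products, adjoints, placement on more qubits and
parallel composition. Hence gatewise simulation in constant depth and polynomial size gives an
inclusion of classes for every error (`constDepthPolySize_subset`), and the equalities follow from a
cycle of three simulations: QTC by QNC_wf, QNC_wf by QAC_wf, QAC_wf by QTC.

Fanout from thresholds (`impl_QAC_of_QTC`). Flipping the sign of the strings of weight about n/2
between two layers of Hadamard gates sends |0ⁿ⟩ to a state whose amplitude at |1ⁿ⟩ is at least of
order 1/n. A control qubit and a rotated qubit tune the amplitudes so that a single Grover step
gives exactly a state supported on 0ⁿ and 1ⁿ with a small prescribed weight on 1ⁿ (`Impl.catRow`).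
Take m = (n+1)² such rows, each zero with probability 2^(-1/m). All rows are zero with probability
1/2; otherwise some row is all ones, so the ORs of the columns are all 0 or all 1. Writing them on
fresh qubits gives a nekomata (`Impl.nekomata`). Controlled signs between the input and these qubits
multiply the 1ⁿ branch by (-1)^|x|, so the state is fixed for even |x| and becomes orthogonal for
odd |x|. A reflection about the state turns this into a phase (`Impl.test`), and the parity phase is
fanout up to Hadamard gates.

Thresholds from fanout (`impl_QTC_of_QNC`). Fanout copies basis strings, so commuting diagonal
operators run in parallel (`Impl.prod_diagonal`). The event |x| = j is again detected by
`Impl.test`: L ≈ log n qubits in uniform superposition are rotated by 2π(|x| - j)/2^(l+1), which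
fixes the state if |x| = j and otherwise turns some qubit to an orthogonal state. The reflection
acts on only L + 1 qubits, so it can be written as a product of phases depending on the parities of
all 2^(L+1) = O(n) subsets (`Impl.ptPhase_QNC`). A threshold phase is the product of the phases for
|x| = j over j ≥ k.

Two-qubit gates from CNOT (`impl_QNC_of_QAC`). A 4 × 4 unitary is reduced column by column to a
product of five multiplexed one-qubit gates (`muxProd_of_unitary`), each of which is a diagonal gate
between one-qubit gates.

Parity is Hadamard-conjugate to fanout, hence exact in QNC_wf, and the inclusions carry it to QTC.
-/

/-- Operators on qubits labelled by `ι`. -/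
abbrev Op (ι : Type) : Type := Matrix (ι → Bool) (ι → Bool) ℂ

/-- The 0/1 matrix `|x⟩ ↦ |f x⟩`. -/
def funM {X Y : Type} [DecidableEq Y] (f : X → Y) : Matrix Y X ℂ :=
  fun y x => if y = f x then 1 else 0

theorem mul_funM_apply {X Y Z : Type} [DecidableEq Y] [Fintype Y] (A : Matrix Z Y ℂ) (f : X → Y)
    (z : Z) (x : X) : (A * funM f) z x = A z (f x) := by
  simp [Matrix.mul_apply, funM]

section funM

variable {X Y Z : Type} [DecidableEq X] [DecidableEq Y] [DecidableEq Z]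
  [Fintype X] [Fintype Y] [Fintype Z]

theorem funM_mul_funM (g : Y → Z) (f : X → Y) : funM g * funM f = funM (g ∘ f) := by
  ext z x
  rw [mul_funM_apply]; rfl

theorem diagonal_mul_funM (d : Y → ℂ) (f : X → Y) :
    diagonal d * funM f = funM f * diagonal (d ∘ f) := by
  ext y x
  rw [mul_funM_apply, Matrix.mul_diagonal, diagonal_apply]
  by_cases h : y = f x <;> simp [funM, h]

theorem funM_id : funM (id : X → X) = 1 := by
  ext y x
  simp [funM, Matrix.one_apply]

theorem funM_mul_apply {σ : X → X} (h : Function.Involutive σ) (A : Matrix X Z ℂ) (y : X) (z : Z) :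
    (funM σ * A) y z = A (σ y) z := by
  rw [Matrix.mul_apply, Finset.sum_eq_single (σ y)]
  · simp [funM, h y]
  · intro b _ hb
    have : y ≠ σ b := fun e => hb (by rw [e, h b])
    simp [funM, this]
  · simp

end funM

/-! ### Acting on some of the qubits -/

section lift

variable {ι κ ρ : Type}

open Classical in
/-- `M` applied to the qubits `w j`, and the identity elsewhere. -/
noncomputable def lift (w : κ ↪ ι) (M : Op κ) : Op ι :=
  fun y x => if ∀ i, (∀ j, w j ≠ i) → y i = x i then M (y ∘ w) (x ∘ w) else 0

theorem extend_comp (w : κ ↪ ι) (u : κ → Bool) (x : ι → Bool) :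
    Function.extend w u x ∘ w = u := by
  funext j; simp [w.injective.extend_apply]

theorem extend_off (w : κ ↪ ι) (u : κ → Bool) (x : ι → Bool) (i : ι) (h : ∀ j, w j ≠ i) :
    Function.extend w u x i = x i :=
  Function.extend_apply' _ _ _ (by rintro ⟨j, hj⟩; exact h j hj)

theorem extend_injective (w : κ ↪ ι) (x : ι → Bool) :
    Function.Injective fun u : κ → Bool => Function.extend w u x := by
  intro u v h
  rw [← extend_comp w u x, ← extend_comp w v x]
  exact congrArg (· ∘ w) h

theorem eq_extend_of_off (w : κ ↪ ι) (z x : ι → Bool)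
    (h : ∀ i, (∀ j, w j ≠ i) → z i = x i) : Function.extend w (z ∘ w) x = z := by
  funext i
  by_cases hi : ∃ j, w j = i
  · obtain ⟨j, rfl⟩ := hi
    simp [w.injective.extend_apply]
  · have : ∀ j, w j ≠ i := fun j hj => hi ⟨j, hj⟩
    rw [extend_off w _ _ _ this, h i this]

variable [Fintype ι] [Fintype κ] [Fintype ρ] [DecidableEq ι] [DecidableEq κ] [DecidableEq ρ]

-- The strings agreeing with `x` off the image of `w` are exactly the overwritings of `x` along `w`.
-- This collapses sums over all qubits to sums over the qubits acted upon.
open Classical in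
theorem sum_off (w : κ ↪ ι) (x : ι → Bool) (F : (ι → Bool) → ℂ) :
    ∑ z, (if ∀ i, (∀ j, w j ≠ i) → z i = x i then F z else 0) =
      ∑ u : κ → Bool, F (Function.extend w u x) := by
  symm
  refine Fintype.sum_of_injective _ (extend_injective w x) _ _ ?_ ?_
  · intro z hz
    rw [if_neg]
    intro h
    exact hz ⟨z ∘ w, eq_extend_of_off w z x h⟩
  · intro u
    rw [if_pos]
    intro i hi
    exact extend_off w u x i hi

theorem lift_mul (w : κ ↪ ι) (A B : Op κ) : lift w (A * B) = lift w A * lift w B := by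
  classical
  ext y x
  rw [Matrix.mul_apply]
  by_cases h : ∀ i, (∀ j, w j ≠ i) → y i = x i
  · have e : ∀ z, lift w A y z * lift w B z x =
        if ∀ i, (∀ j, w j ≠ i) → z i = x i then A (y ∘ w) (z ∘ w) * B (z ∘ w) (x ∘ w) else 0 := by
      intro z
      by_cases hz : ∀ i, (∀ j, w j ≠ i) → z i = x i
      · have : ∀ i, (∀ j, w j ≠ i) → y i = z i := fun i hi => by rw [h i hi, hz i hi]
        simp only [lift, if_pos hz, if_pos this]
      · simp only [lift, if_neg hz, mul_zero]
    simp only [e, sum_off w x (fun z => A (y ∘ w) (z ∘ w) * B (z ∘ w) (x ∘ w)), extend_comp]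
    rw [lift, if_pos h, Matrix.mul_apply]
  · rw [lift, if_neg h, Finset.sum_eq_zero]
    intro z _
    by_cases hz : ∀ i, (∀ j, w j ≠ i) → z i = x i
    · have : ¬ ∀ i, (∀ j, w j ≠ i) → y i = z i := fun h' => h fun i hi => by rw [h' i hi, hz i hi]
      simp only [lift, if_neg this, zero_mul]
    · simp only [lift, if_neg hz, mul_zero]

theorem lift_one (w : κ ↪ ι) : lift w (1 : Op κ) = 1 := by
  ext y x
  by_cases hyx : y = x
  · subst hyx; simp [lift]
  · rw [Matrix.one_apply_ne hyx, lift]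
    split_ifs with h
    · rw [Matrix.one_apply_ne]
      intro e
      exact hyx (by rw [← eq_extend_of_off w y x h, e, eq_extend_of_off w x x fun _ _ => rfl])
    · rfl

theorem lift_conjTranspose (w : κ ↪ ι) (A : Op κ) : lift w Aᴴ = (lift w A)ᴴ := by
  ext y x
  rw [Matrix.conjTranspose_apply]
  by_cases h : ∀ i, (∀ j, w j ≠ i) → y i = x i
  · have h' : ∀ i, (∀ j, w j ≠ i) → x i = y i := fun i hi => (h i hi).symm
    simp only [lift, if_pos h, if_pos h', Matrix.conjTranspose_apply]
  · have h' : ¬ ∀ i, (∀ j, w j ≠ i) → x i = y i := fun h' => h fun i hi => (h' i hi).symm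
    simp only [lift, if_neg h, if_neg h', star_zero]

theorem lift_lift (w : κ ↪ ι) (v : ρ ↪ κ) (A : Op ρ) : lift w (lift v A) = lift (v.trans w) A := by
  ext y x
  by_cases h : ∀ i, (∀ j, v.trans w j ≠ i) → y i = x i
  · have h1 : ∀ i, (∀ j, w j ≠ i) → y i = x i := fun i hi => h i fun j => hi (v j)
    have h2 : ∀ i, (∀ j, v j ≠ i) → (y ∘ w) i = (x ∘ w) i := fun i hi =>
      h (w i) fun j hj => hi j (w.injective hj)
    simp only [lift, if_pos h, if_pos h1, if_pos h2]
    rfl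
  · simp only [lift, if_neg h]
    split_ifs with h1 h2
    · exfalso
      refine h fun i hi => ?_
      by_cases hw : ∃ j, w j = i
      · obtain ⟨j, rfl⟩ := hw
        exact h2 j fun k hk => hi k (congrArg w hk)
      · exact h1 i fun j hj => hw ⟨j, hj⟩
    · rfl
    · rfl

theorem lift_equiv_apply (e : κ ≃ ι) (A : Op κ) (y x : ι → Bool) :
    lift e.toEmbedding A y x = A (y ∘ e) (x ∘ e) := by
  rw [lift, if_pos]
  · rfl
  · intro i hi
    exact absurd (e.apply_symm_apply i) (hi _)

theorem lift_diagonal (w : κ ↪ ι) (d : (κ → Bool) → ℂ) :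
    lift w (diagonal d) = diagonal fun x => d (x ∘ w) := by
  ext y x
  by_cases hyx : y = x
  · subst hyx; simp [lift]
  · rw [diagonal_apply_ne _ hyx, lift]
    split_ifs with h
    · rw [diagonal_apply_ne]
      intro e
      exact hyx (by rw [← eq_extend_of_off w y x h, e, eq_extend_of_off w x x fun _ _ => rfl])
    · rfl

theorem lift_funM (w : κ ↪ ι) (f : (κ → Bool) → κ → Bool) :
    lift w (funM f) = funM fun x => Function.extend w (f (x ∘ w)) x := by
  ext y x
  simp only [lift, funM]
  by_cases h : ∀ i, (∀ j, w j ≠ i) → y i = x i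
  · rw [if_pos h]
    congr 1
    refine propext ⟨fun e => ?_, fun e => ?_⟩
    · rw [← e, eq_extend_of_off w y x h]
    · rw [e, extend_comp]
  · rw [if_neg h, if_neg]
    rintro rfl
    exact h fun i hi => extend_off w _ _ i hi

theorem lift_mulVec (w : κ ↪ ι) (A : Op κ) (φ : (ι → Bool) → ℂ) (y : ι → Bool) :
    (lift w A *ᵥ φ) y = ∑ u, A (y ∘ w) u * φ (Function.extend w u y) := by
  classical
  have e : ∀ z, lift w A y z * φ z =
      if ∀ i, (∀ j, w j ≠ i) → z i = y i then A (y ∘ w) (z ∘ w) * φ z else 0 := by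
    intro z
    by_cases hz : ∀ i, (∀ j, w j ≠ i) → z i = y i
    · have : ∀ i, (∀ j, w j ≠ i) → y i = z i := fun i hi => (hz i hi).symm
      simp only [lift, if_pos hz, if_pos this]
    · have : ¬ ∀ i, (∀ j, w j ≠ i) → y i = z i := fun h => hz fun i hi => (h i hi).symm
      simp only [lift, if_neg hz, if_neg this, zero_mul]
  simp only [Matrix.mulVec, dotProduct, e, sum_off w y (fun z => A (y ∘ w) (z ∘ w) * φ z),
    extend_comp]

theorem lift_mem_unitary (w : κ ↪ ι) {A : Op κ} (h : Aᴴ * A = 1) : (lift w A)ᴴ * lift w A = 1 := by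
  rw [← lift_conjTranspose, ← lift_mul, h, lift_one]

end lift

/-! ### Operators in parallel -/

section tens

variable {K : Type} {κ : K → Type} [Fintype K] [DecidableEq K]
  [∀ k, Fintype (κ k)] [∀ k, DecidableEq (κ k)]

/-- The operators `M k` side by side. -/
noncomputable def tens (M : ∀ k, Op (κ k)) : Op (Σ k, κ k) :=
  fun y x => ∏ k, M k (fun j => y ⟨k, j⟩) (fun j => x ⟨k, j⟩)

theorem sum_prod_sigma (F : ∀ k, (κ k → Bool) → ℂ) :
    ∑ z : (Σ k, κ k) → Bool, ∏ k, F k (fun j => z ⟨k, j⟩) = ∏ k, ∑ u, F k u := by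
  rw [Finset.prod_univ_sum, Fintype.piFinset_univ]
  exact Fintype.sum_equiv (Equiv.piCurry fun _ _ => Bool) _ _ fun z => rfl

theorem tens_mul (A B : ∀ k, Op (κ k)) : tens (fun k => A k * B k) = tens A * tens B := by
  ext y x
  simp only [tens, Matrix.mul_apply, ← Finset.prod_mul_distrib]
  exact (sum_prod_sigma (fun k u => A k (fun j => y ⟨k, j⟩) u * B k u (fun j => x ⟨k, j⟩))).symm

theorem tens_diagonal (d : ∀ k, (κ k → Bool) → ℂ) :
    tens (fun k => diagonal (d k)) = diagonal fun x => ∏ k, d k (fun j => x ⟨k, j⟩) := by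
  ext y x
  by_cases h : y = x
  · subst h; simp [tens]
  · rw [diagonal_apply_ne _ h, tens]
    have : ∃ k, ∃ j, y ⟨k, j⟩ ≠ x ⟨k, j⟩ := by
      by_contra hc
      push Not at hc
      exact h (funext fun ⟨k, j⟩ => hc k j)
    obtain ⟨k, j, hk⟩ := this
    refine Finset.prod_eq_zero (Finset.mem_univ k) (diagonal_apply_ne _ fun e => hk (congrFun e j))

theorem tens_one : tens (fun k => (1 : Op (κ k))) = 1 := by
  have := tens_diagonal (κ := κ) fun _ _ => 1
  simpa using this

theorem tens_conjTranspose (A : ∀ k, Op (κ k)) : tens (fun k => (A k)ᴴ) = (tens A)ᴴ := by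
  ext y x
  simp [tens, Matrix.conjTranspose_apply]

theorem tens_funM (f : ∀ k, (κ k → Bool) → κ k → Bool) :
    tens (fun k => funM (f k)) = funM fun x => fun i => f i.1 (fun j => x ⟨i.1, j⟩) i.2 := by
  ext y x
  simp only [tens, funM, Finset.prod_ite_zero, Finset.prod_const_one]
  congr 1
  refine propext ⟨fun h => funext fun ⟨k, j⟩ => congrFun (h k (Finset.mem_univ k)) j,
    fun h k _ => funext fun j => by rw [h]⟩

end tens

/-- The one-qubit operators `u i` on the qubits `i`. -/
noncomputable def loc {ι : Type} [Fintype ι] (u : ι → Matrix Bool Bool ℂ) : Op ι :=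
  fun y x => ∏ i, u i (y i) (x i)

section loc

variable {ι : Type} [Fintype ι] [DecidableEq ι]

theorem loc_mul (u v : ι → Matrix Bool Bool ℂ) : loc u * loc v = loc fun i => u i * v i := by
  ext y x
  simp only [loc, Matrix.mul_apply, ← Finset.prod_mul_distrib]
  rw [Finset.prod_univ_sum, Fintype.piFinset_univ]

theorem loc_one : loc (fun _ : ι => (1 : Matrix Bool Bool ℂ)) = 1 := by
  ext y x
  simp only [loc, Matrix.one_apply, Finset.prod_ite_zero, Finset.prod_const_one, funext_iff,
    Finset.mem_univ, true_imp_iff]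

theorem loc_eq_lift_tens (u : ι → Matrix Bool Bool ℂ) :
    loc u = lift (Equiv.sigmaUnique ι fun _ => Fin 1).toEmbedding
      (tens fun i => (fun y x => u i (y 0) (x 0) : Op (Fin 1))) := by
  ext y x
  rw [lift_equiv_apply]
  rfl

end loc

/-! ### Clean ancillas -/

/-- Extend a labelling by zeros. -/
def pad {ι : Type} (α : Type) (x : ι → Bool) : ι ⊕ α → Bool := Sum.elim x fun _ => false

/-- The isometry adding clean ancillas `α`. -/
def padM (ι α : Type) [Fintype ι] [Fintype α] [DecidableEq ι] [DecidableEq α] :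
    Matrix (ι ⊕ α → Bool) (ι → Bool) ℂ := funM (pad α)

section pad

variable {ι κ α β : Type} [Fintype ι] [Fintype κ] [Fintype α] [Fintype β]
  [DecidableEq ι] [DecidableEq κ] [DecidableEq α] [DecidableEq β]

theorem pad_inl (x : ι → Bool) : pad α x ∘ Sum.inl = x := rfl

theorem eq_pad_iff (y : ι ⊕ α → Bool) (x : ι → Bool) :
    y = pad α x ↔ y ∘ Sum.inl = x ∧ y ∘ Sum.inr = fun _ => false := by
  constructor
  · rintro rfl; exact ⟨rfl, rfl⟩
  · rintro ⟨rfl, h⟩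
    funext i
    rcases i with i | i
    · rfl
    · exact congrFun h i

theorem pad_injective : Function.Injective (pad α : (ι → Bool) → _) := fun x y h => by
  rw [← pad_inl (α := α) x, h, pad_inl]

theorem mul_padM_apply {X : Type} (M : Matrix X (ι ⊕ α → Bool) ℂ) (y : X) (x : ι → Bool) :
    (M * padM ι α) y x = M y (pad α x) := mul_funM_apply _ _ _ _

theorem padM_mul_apply {X : Type} (M : Matrix (ι → Bool) X ℂ) (y : ι ⊕ α → Bool) (x : X) :
    (padM ι α * M) y x = if y ∘ Sum.inr = (fun _ => false) then M (y ∘ Sum.inl) x else 0 := by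
  rw [Matrix.mul_apply]
  by_cases h : y ∘ Sum.inr = fun _ => false
  · rw [if_pos h, Finset.sum_eq_single (y ∘ Sum.inl)]
    · rw [padM, funM, if_pos ((eq_pad_iff _ _).2 ⟨rfl, h⟩), one_mul]
    · intro z _ hz
      rw [padM, funM, if_neg, zero_mul]
      intro e
      exact hz ((eq_pad_iff _ _).1 e).1.symm
    · simp
  · rw [if_neg h, Finset.sum_eq_zero]
    intro z _
    rw [padM, funM, if_neg, zero_mul]
    intro e
    exact h ((eq_pad_iff _ _).1 e).2

theorem padM_isometry :
    (padM ι α)ᴴ * padM ι α = 1 := by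
  ext y x
  rw [mul_padM_apply, Matrix.conjTranspose_apply, padM, funM, Matrix.one_apply]
  by_cases h : y = x
  · simp [h]
  · rw [if_neg h, if_neg fun e => h (pad_injective e).symm, star_zero]

/-- The relation "`M'` with clean ancillas acts as `M`" survives placement on a larger register with
further idle ancillas, since the padding of `x` restricts to the padding of its restriction.
Sequential composition of implementations rests on this. -/
theorem lift_pad (w : κ ↪ ι) (g : α ↪ β) (M : Op κ) (M' : Op (κ ⊕ α))
    (h : M' * padM κ α = padM κ α * M) :
    lift (w.sumMap g) M' * padM ι β = padM ι β * lift w M := by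
  have h' : ∀ y x, M' y (pad α x) =
      if y ∘ Sum.inr = (fun _ => false) then M (y ∘ Sum.inl) x else 0 := fun y x => by
    rw [← padM_mul_apply, ← h, mul_padM_apply]
  ext y x
  rw [mul_padM_apply, padM_mul_apply, lift]
  have e : pad β x ∘ w.sumMap g = pad α (x ∘ w) := by
    funext i; rcases i with i | i <;> rfl
  rw [e, h']
  by_cases hy : y ∘ Sum.inr = fun _ => false
  · have h1 : (y ∘ w.sumMap g) ∘ Sum.inr = fun _ => false := funext fun i => congrFun hy (g i)
    rw [if_pos h1, if_pos hy, lift]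
    congr 1
    refine propext ⟨fun H i hi => ?_, fun H i hi => ?_⟩
    · refine H (Sum.inl i) ?_
      rintro (j | j) hj
      · exact hi j (Sum.inl.inj hj)
      · cases hj
    · rcases i with i | i
      · exact H i fun j hj => hi (Sum.inl j) (congrArg Sum.inl hj)
      · exact congrFun hy i
  · rw [if_neg hy]
    split_ifs with H h1
    · exfalso
      refine hy (funext fun i => ?_)
      by_cases hi : ∃ j, g j = i
      · obtain ⟨j, rfl⟩ := hi
        exact congrFun h1 j
      · refine H (Sum.inr i) ?_
        rintro (j | j) hj
        · cases hj
        · exact hi ⟨j, Sum.inr.inj hj⟩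
    · rfl
    · rfl

end pad

theorem lift_refl {ι : Type} [Fintype ι] [DecidableEq ι] (A : Op ι) : lift (Function.Embedding.refl ι) A = A := by
  ext y x
  exact lift_equiv_apply (Equiv.refl ι) A y x

/-! ### Layers and circuits on labelled qubits -/

/-- A layer of at most `s` gates from `S`. -/
def IsLayer (S : Set Gate) {ι : Type} (s : ℕ) (M : Op ι) : Prop :=
  ∃ (G : Type) (_ : Fintype G) (g : G → Gate) (W : (Σ i, Fin (g i).1) ↪ ι),
    (∀ i, g i ∈ S) ∧ Fintype.card G ≤ s ∧ M = lift W (tens fun i => (g i).2.1)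

/-- A circuit over `S` of depth `d` with at most `s` gates. -/
def IsCirc (S : Set Gate) {ι : Type} [Fintype ι] [DecidableEq ι] : ℕ → ℕ → Op ι → Prop
  | 0, _, M => M = 1
  | d + 1, s, M => ∃ (s₁ s₂ : ℕ) (A B : Op ι),
      s₁ + s₂ ≤ s ∧ IsLayer S s₁ A ∧ IsCirc S d s₂ B ∧ M = A * B

/-- `S` is closed under inverses. -/
def AdjClosed (S : Set Gate) : Prop :=
  ∀ (k : ℕ) (U : Matrix.unitaryGroup (Bits k) ℂ), (⟨k, U⟩ : Gate) ∈ S → (⟨k, star U⟩ : Gate) ∈ S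

section

variable {S : Set Gate} {ι κ : Type} [Fintype ι] [DecidableEq ι] [Fintype κ] [DecidableEq κ]

theorem IsLayer.one : IsLayer S 0 (1 : Op ι) := by
  refine ⟨Empty, inferInstance, fun i => i.elim, ⟨fun i => i.1.elim, fun i => i.1.elim⟩,
    fun i => i.elim, by simp, ?_⟩
  ext y x
  simp only [lift, tens, Finset.univ_eq_empty, Finset.prod_empty, Matrix.one_apply, funext_iff]
  congr 1
  refine propext ⟨fun h i _ => h i, fun h i => h i fun j => j.1.elim⟩

theorem IsLayer.lift {s : ℕ} {M : Op κ} (h : IsLayer S s M) (w : κ ↪ ι) :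
    IsLayer S s (lift w M) := by
  classical
  obtain ⟨G, _, g, W, hg, hs, rfl⟩ := h
  exact ⟨G, inferInstance, g, W.trans w, hg, hs, lift_lift _ _ _⟩

theorem IsLayer.adj (hS : AdjClosed S) {s : ℕ} {M : Op ι} (h : IsLayer S s M) :
    IsLayer S s Mᴴ := by
  classical
  obtain ⟨G, i, g, W, hg, h, rfl⟩ := h
  refine ⟨G, i, fun i => ⟨(g i).1, star (g i).2⟩, W, fun i => hS _ _ (hg i), h, ?_⟩
  rw [← lift_conjTranspose, ← tens_conjTranspose]
  rfl

theorem IsLayer.unitary {s : ℕ} {M : Op ι} (h : IsLayer S s M) : Mᴴ * M = 1 := by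
  classical
  obtain ⟨G, i, g, W, hg, h, rfl⟩ := h
  refine lift_mem_unitary W ?_
  rw [← tens_conjTranspose, ← tens_mul, ← tens_one]
  congr 1
  funext i
  exact Matrix.UnitaryGroup.star_mul_self (g i).2

theorem IsLayer.par {K : Type} [Fintype K] [DecidableEq K] {κ : K → Type}
    {s : K → ℕ} {M : ∀ k, Op (κ k)} (h : ∀ k, IsLayer S (s k) (M k)) :
    IsLayer S (∑ k, s k) (tens M) := by
  choose G hG g W hg hs hM using h
  refine ⟨Σ k, G k, inferInstance, fun i => g i.1 i.2,
    ⟨fun i => ⟨i.1.1, W i.1.1 ⟨i.1.2, i.2⟩⟩, ?_⟩, fun i => hg _ _, ?_, ?_⟩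
  · rintro ⟨⟨k, i⟩, j⟩ ⟨⟨k', i'⟩, j'⟩ e
    obtain rfl : k = k' := congrArg Sigma.fst e
    have := (W k).injective (eq_of_heq (Sigma.mk.inj e).2)
    obtain rfl : i = i' := congrArg Sigma.fst this
    obtain rfl : j = j' := eq_of_heq (Sigma.mk.inj this).2
    rfl
  · rw [Fintype.card_sigma]
    exact Finset.sum_le_sum fun k _ => hs k
  · classical
    ext y x
    simp only [tens, hM, QC.lift, Finset.prod_ite_zero, Fintype.prod_sigma]
    by_cases H : ∀ i ∈ Finset.univ, ∀ (i_2 : κ i), (∀ j, (W i) j ≠ i_2) → y ⟨i, i_2⟩ = x ⟨i, i_2⟩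
    · rw [if_pos H, if_pos]
      · rfl
      · rintro ⟨k, i⟩ hi
        exact H k (Finset.mem_univ k) i fun ⟨i', j⟩ hj => hi ⟨⟨k, i'⟩, j⟩ (by
          change (⟨k, W k ⟨i', j⟩⟩ : Σ k, κ k) = _
          rw [hj])
    · rw [if_neg H, if_neg]
      intro h
      refine H fun k _ i hi => h ⟨k, i⟩ ?_
      rintro ⟨⟨k', i'⟩, j⟩ e
      obtain rfl : k' = k := congrArg Sigma.fst e
      exact hi _ (eq_of_heq (Sigma.mk.inj e).2)

theorem IsCirc.mono {d s s' : ℕ} {M : Op ι} (h : IsCirc S d s M) (hs : s ≤ s') :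
    IsCirc S d s' M := by
  cases d with
  | zero => exact h
  | succ d =>
    obtain ⟨s₁, s₂, A, B, h, r⟩ := h
    exact ⟨s₁, s₂, A, B, h.trans hs, r⟩

theorem IsCirc.one (d : ℕ) : IsCirc S d 0 (1 : Op ι) := by
  induction d with
  | zero => rfl
  | succ d ih => exact ⟨0, 0, 1, 1, le_rfl, IsLayer.one, ih, (mul_one _).symm⟩

theorem IsLayer.isCirc {s : ℕ} {M : Op ι} (h : IsLayer S s M) : IsCirc S 1 s M :=
  ⟨s, 0, M, 1, le_rfl, h, rfl, (mul_one _).symm⟩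

theorem IsCirc.mul {d e s t : ℕ} {M N : Op ι} (hM : IsCirc S d s M) (hN : IsCirc S e t N) :
    IsCirc S (d + e) (s + t) (M * N) := by
  induction d generalizing s M with
  | zero =>
    obtain rfl : M = 1 := hM
    rw [one_mul, Nat.zero_add]
    exact hN.mono (Nat.le_add_left _ _)
  | succ d ih =>
    obtain ⟨s₁, s₂, A, B, h, hA, hB, rfl⟩ := hM
    rw [Nat.add_right_comm]
    exact ⟨s₁, s₂ + t, A, B * N, by omega, hA, ih hB, Matrix.mul_assoc _ _ _⟩

theorem IsCirc.lift {d s : ℕ} {M : Op κ} (h : IsCirc S d s M) (w : κ ↪ ι) :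
    IsCirc S d s (lift w M) := by
  induction d generalizing s M with
  | zero =>
    obtain rfl : M = 1 := h
    exact lift_one w
  | succ d ih =>
    obtain ⟨s₁, s₂, A, B, h, hA, hB, rfl⟩ := h
    exact ⟨s₁, s₂, _, _, h, hA.lift w, ih hB, lift_mul _ _ _⟩

theorem IsCirc.adj (hS : AdjClosed S) {d s : ℕ} {M : Op ι} (h : IsCirc S d s M) :
    IsCirc S d s Mᴴ := by
  induction d generalizing s M with
  | zero =>
    obtain rfl : M = 1 := h
    exact Matrix.conjTranspose_one
  | succ d ih =>
    obtain ⟨s₁, s₂, A, B, h, hA, hB, rfl⟩ := h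
    rw [Matrix.conjTranspose_mul]
    exact ((ih hB).mul (hA.adj hS).isCirc).mono (by omega)

theorem IsCirc.unitary {d s : ℕ} {M : Op ι} (h : IsCirc S d s M) : Mᴴ * M = 1 := by
  induction d generalizing s M with
  | zero =>
    obtain rfl : M = 1 := h
    simp
  | succ d ih =>
    obtain ⟨s₁, s₂, A, B, h, hA, hB, rfl⟩ := h
    rw [Matrix.conjTranspose_mul, Matrix.mul_assoc, ← Matrix.mul_assoc Aᴴ, hA.unitary,
      Matrix.one_mul, ih hB]

theorem IsCirc.par {K : Type} [Fintype K] [DecidableEq K] {κ : K → Type}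
    [∀ k, Fintype (κ k)] [∀ k, DecidableEq (κ k)] {d : ℕ}
    {s : K → ℕ} {M : ∀ k, Op (κ k)} (h : ∀ k, IsCirc S d (s k) (M k)) :
    IsCirc S d (∑ k, s k) (tens M) := by
  induction d generalizing s M with
  | zero =>
    obtain rfl : M = fun k => 1 := funext h
    exact tens_one
  | succ d ih =>
    choose s₁ s₂ A B h hA hB hM using h
    obtain rfl : M = fun k => A k * B k := funext hM
    refine ⟨_, _, _, _, ?_, IsLayer.par hA, ih hB, tens_mul _ _⟩
    rw [← Finset.sum_add_distrib]
    exact Finset.sum_le_sum fun k _ => h k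

end

/-! ### Implementation with clean ancillas -/

/-- `M` is implemented over `S` by a circuit of depth `d` with clean ancillas; the number of gates
and ancillas is at most `s`. -/
def Impl (S : Set Gate) {ι : Type} [Fintype ι] [DecidableEq ι] (d s : ℕ) (M : Op ι) : Prop :=
  ∃ (α : Type) (_ : Fintype α) (_ : DecidableEq α) (t : ℕ) (M' : Op (ι ⊕ α)),
    IsCirc S d t M' ∧ Fintype.card α + t ≤ s ∧ M' * padM ι α = padM ι α * M

section

variable {S : Set Gate} {ι κ : Type} [Fintype ι] [DecidableEq ι] [Fintype κ] [DecidableEq κ]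

theorem Impl.mono {d s d' s' : ℕ} {M : Op ι} (h : Impl S d s M) (hd : d ≤ d') (hs : s ≤ s') :
    Impl S d' s' M := by
  obtain ⟨α, _, _, t, M', hM, ht, e⟩ := h
  refine ⟨α, inferInstance, inferInstance, t, M', ?_, ht.trans hs, e⟩
  have := (IsCirc.one (S := S) (ι := ι ⊕ α) (d' - d)).mul hM
  rwa [one_mul, Nat.zero_add, Nat.sub_add_cancel hd] at this

theorem IsCirc.impl {d s : ℕ} {M : Op ι} (h : IsCirc S d s M) : Impl S d s M := by
  refine ⟨Empty, inferInstance, inferInstance, s, _, h.lift Function.Embedding.inl, by simp, ?_⟩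
  ext y x
  rw [mul_padM_apply, padM_mul_apply, QC.lift, if_pos (funext fun i => i.elim), if_pos]
  · rfl
  · rintro (i | i) hi
    · exact absurd rfl (hi i)
    · exact i.elim

theorem Impl.one : Impl S 0 0 (1 : Op ι) := IsCirc.impl (IsCirc.one 0)

/-- The two factors get separate ancillas `α` and `β`, each idle while the other factor runs; the
ancilla counts simply add. -/
theorem Impl.mul {d e s t : ℕ} {M N : Op ι} (hM : Impl S d s M) (hN : Impl S e t N) :
    Impl S (d + e) (s + t) (M * N) := by
  obtain ⟨α, _, _, s', M', hM, hs, eM⟩ := hM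
  obtain ⟨β, _, _, t', N', hN, ht, eN⟩ := hN
  refine ⟨α ⊕ β, inferInstance, inferInstance, s' + t', _,
    (hM.lift ((Function.Embedding.refl ι).sumMap Function.Embedding.inl)).mul
      (hN.lift ((Function.Embedding.refl ι).sumMap Function.Embedding.inr)), ?_, ?_⟩
  · rw [Fintype.card_sum]; omega
  · rw [Matrix.mul_assoc, lift_pad _ _ _ _ eN, ← Matrix.mul_assoc, lift_pad _ _ _ _ eM,
      Matrix.mul_assoc, ← lift_mul]
    congr 1
    exact lift_refl _

/-- Padding is an isometry and `M'` is unitary, so `padM ι α * M` preserves inner products, and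
therefore so does `M`. -/
theorem Impl.unitary {d s : ℕ} {M : Op ι} (h : Impl S d s M) : Mᴴ * M = 1 := by
  obtain ⟨α, _, _, s', M', hM, hs, eM⟩ := h
  have h1 : (padM ι α * M)ᴴ * (padM ι α * M) = Mᴴ * M := by
    rw [Matrix.conjTranspose_mul, Matrix.mul_assoc, ← Matrix.mul_assoc _ (padM ι α) M,
      padM_isometry, Matrix.one_mul]
  rw [← h1, ← eM, Matrix.conjTranspose_mul, Matrix.mul_assoc, ← Matrix.mul_assoc _ M', hM.unitary,
    Matrix.one_mul, padM_isometry]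

/-- Insert `M * Mᴴ = 1` after the padding: `M'ᴴ` then cancels the `M'` obtained from the
intertwining relation. The reversed circuit therefore also returns its ancillas clean. -/
theorem Impl.adj (hS : AdjClosed S) {d s : ℕ} {M : Op ι} (h : Impl S d s M) : Impl S d s Mᴴ := by
  have hu := h.unitary
  obtain ⟨α, _, _, s', M', hM, hs, eM⟩ := h
  refine ⟨α, inferInstance, inferInstance, s', _, hM.adj hS, hs, ?_⟩
  have hu' : M * Mᴴ = 1 := mul_eq_one_comm.1 hu
  calc M'ᴴ * padM ι α = M'ᴴ * (padM ι α * M * Mᴴ) := by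
        rw [Matrix.mul_assoc, hu', Matrix.mul_one]
    _ = (M'ᴴ * M') * (padM ι α * Mᴴ) := by rw [← eM]; simp only [Matrix.mul_assoc]
    _ = _ := by rw [hM.unitary, Matrix.one_mul]

theorem Impl.lift {d s : ℕ} {M : Op κ} (h : Impl S d s M) (w : κ ↪ ι) :
    Impl S d s (lift w M) := by
  obtain ⟨α, _, _, s', M', hM, hs, eM⟩ := h
  exact ⟨α, inferInstance, inferInstance, s', _,
    hM.lift (w.sumMap (Function.Embedding.refl α)), hs, lift_pad _ _ _ _ eM⟩

theorem Impl.par {K : Type} [Fintype K] [DecidableEq K] {κ : K → Type}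
    [∀ k, Fintype (κ k)] [∀ k, DecidableEq (κ k)] {d : ℕ}
    {s : K → ℕ} {M : ∀ k, Op (κ k)} (h : ∀ k, Impl S d (s k) (M k)) :
    Impl S d (∑ k, s k) (tens M) := by
  choose α i1 i2 s' M' hM hs eM using h
  refine ⟨Σ k, α k, inferInstance, inferInstance, _, _,
    (IsCirc.par hM).lift (Equiv.sigmaSumDistrib κ α).toEmbedding, ?_, ?_⟩
  · rw [Fintype.card_sigma, ← Finset.sum_add_distrib]
    exact Finset.sum_le_sum fun k _ => hs k
  · have h' : ∀ k y x, M' k y (pad (α k) x) =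
        if y ∘ Sum.inr = (fun _ => false) then M k (y ∘ Sum.inl) x else 0 := fun k y x => by
      rw [← padM_mul_apply, ← eM, mul_padM_apply]
    ext y x
    rw [mul_padM_apply, padM_mul_apply, lift_equiv_apply, tens]
    have e : ∀ k, (fun j => (pad (Σ k, α k) x ∘ Equiv.sigmaSumDistrib κ α) ⟨k, j⟩) =
        pad (α k) fun j => x ⟨k, j⟩ := by
      intro k; funext j; rcases j with j | j <;> rfl
    simp only [e, h', Finset.prod_ite_zero]
    congr 1
    refine propext ⟨fun h => funext fun ⟨k, j⟩ => congrFun (h k (Finset.mem_univ k)) j,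
      fun h k _ => funext fun j => congrFun h ⟨k, j⟩⟩

/-- Allows a construction to name its work qubits `κ` explicitly: once they are seen to start and
end at zero, they are absorbed into the ancillas. -/
theorem Impl.anc {d s : ℕ} {M : Op ι} {N : Op (ι ⊕ κ)} (h : Impl S d s N)
    (e : N * padM ι κ = padM ι κ * M) : Impl S d (Fintype.card κ + s) M := by
  obtain ⟨α, _, _, s', N', hN, hs, eN⟩ := h
  refine ⟨κ ⊕ α, inferInstance, inferInstance, s', _,
    hN.lift (Equiv.sumAssoc ι κ α).toEmbedding, ?_, ?_⟩
  · rw [Fintype.card_sum]; omega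
  · ext y x
    have e1 : pad (κ ⊕ α) x ∘ Equiv.sumAssoc ι κ α = pad α (pad κ x) := by
      funext j; rcases j with (j | j) | j <;> rfl
    rw [mul_padM_apply, lift_equiv_apply, e1, ← mul_padM_apply N', eN, padM_mul_apply,
      ← mul_padM_apply N, e, padM_mul_apply, padM_mul_apply]
    by_cases h1 : y ∘ Sum.inr = fun _ => false
    · rw [if_pos h1, if_pos, if_pos]
      · rfl
      · funext j; exact congrFun h1 (Sum.inl j)
      · funext j; exact congrFun h1 (Sum.inr j)
    · rw [if_neg h1]
      split_ifs with h2 h3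
      · exfalso
        refine h1 (funext fun j => ?_)
        rcases j with j | j
        · exact congrFun h3 j
        · exact congrFun h2 j
      · rfl
      · rfl

theorem Impl.gate {k : ℕ} {U : Matrix.unitaryGroup (Bits k) ℂ} (h : (⟨k, U⟩ : Gate) ∈ S) :
    Impl S 1 1 (U.1 : Op (Fin k)) := by
  refine IsCirc.impl (IsLayer.isCirc ⟨Unit, inferInstance, fun _ => ⟨k, U⟩,
    (Equiv.uniqueSigma fun _ : Unit => Fin k).toEmbedding, fun _ => h, by simp, ?_⟩)
  ext y x
  rw [lift_equiv_apply]
  simp only [tens, Finset.univ_unique, Finset.prod_singleton]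
  rfl

end

/-! ### Comparison with circuits on numbered qubits -/

theorem PlacedGate.matrix_eq_lift {N : ℕ} (g : PlacedGate N) :
    g.matrix = lift g.wires (g.gate.2.1 : Op (Fin g.gate.1)) := by
  ext y x
  simp only [PlacedGate.matrix, lift]
  congr 1

/-- By disjointness the remaining gates leave the qubits of the head gate alone, so in the product
only one intermediate string survives, the one equal to `x` on those qubits. The entry thus factors
over the gates, whatever their order. -/
theorem prod_placedGate_apply {N : ℕ} (l : List (PlacedGate N))
    (h : l.Pairwise fun g h => Disjoint (Set.range g.wires) (Set.range h.wires)) (y x : Bits N)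
    [Decidable (∀ i, (∀ g ∈ l, ∀ j, g.wires j ≠ i) → y i = x i)] :
    (l.map PlacedGate.matrix).prod y x =
      if ∀ i, (∀ g ∈ l, ∀ j, g.wires j ≠ i) → y i = x i then
        (l.map fun g => g.gate.2.1 (y ∘ g.wires) (x ∘ g.wires)).prod else 0 := by
  classical
  induction l generalizing y with
  | nil => simp [Matrix.one_apply, funext_iff]
  | cons g l ih =>
    obtain ⟨hg, hl⟩ := List.pairwise_cons.1 h
    have hcol : ((g :: l).map PlacedGate.matrix).prod y x =
        (lift g.wires (g.gate.2.1 : Op (Fin g.gate.1)) *ᵥ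
          fun z => (l.map PlacedGate.matrix).prod z x) y := by
      rw [List.map_cons, List.prod_cons, PlacedGate.matrix_eq_lift]
      rfl
    have hrest : ∀ u, ∀ g' ∈ l, Function.extend g.wires u y ∘ g'.wires = y ∘ g'.wires := by
      intro u g' hg'
      funext j
      refine extend_off _ _ _ _ fun k hk => ?_
      exact Set.disjoint_left.1 (hg g' hg') ⟨k, hk⟩ ⟨j, rfl⟩
    rw [hcol, lift_mulVec, Finset.sum_eq_single (x ∘ g.wires)]
    · rw [ih hl]
      have hiff : (∀ i, (∀ g' ∈ l, ∀ j, g'.wires j ≠ i) →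
          Function.extend g.wires (x ∘ g.wires) y i = x i) ↔
          ∀ i, (∀ g' ∈ g :: l, ∀ j, g'.wires j ≠ i) → y i = x i := by
        constructor
        · intro H i hi
          rw [← H i fun g' hg' => hi g' (List.mem_cons_of_mem _ hg'),
            extend_off _ _ _ _ (hi g List.mem_cons_self)]
        · intro H i hi
          by_cases hw : ∃ j, g.wires j = i
          · obtain ⟨j, rfl⟩ := hw
            exact congrFun (extend_comp g.wires (x ∘ g.wires) y) j
          · have hw' : ∀ j, g.wires j ≠ i := fun j hj => hw ⟨j, hj⟩
            rw [extend_off _ _ _ _ hw']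
            refine H i fun g' hg' => ?_
            rcases List.mem_cons.1 hg' with rfl | hg'
            · exact hw'
            · exact hi g' hg'
      have hmap : (l.map fun g' => g'.gate.2.1
          (Function.extend g.wires (x ∘ g.wires) y ∘ g'.wires) (x ∘ g'.wires)) =
          l.map fun g' => g'.gate.2.1 (y ∘ g'.wires) (x ∘ g'.wires) :=
        List.map_congr_left fun g' hg' => by rw [hrest _ g' hg']
      rw [hmap]
      simp only [hiff, mul_ite, mul_zero, List.map_cons, List.prod_cons]
    · intro u _ hu
      rw [ih hl, if_neg, mul_zero]
      intro H
      refine hu (funext fun j => ?_)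
      have := H (g.wires j) fun g' hg' k hk =>
        Set.disjoint_left.1 (hg g' hg') ⟨j, rfl⟩ ⟨k, hk⟩
      rw [g.wires.injective.extend_apply] at this
      exact this
    · simp

theorem Layer.isLayer {N : ℕ} {S : Set Gate} (l : Layer N) (h : ∀ g ∈ l.gates, g.gate ∈ S) :
    ∃ (G : Type) (_ : Fintype G) (g : G → Gate) (W : (Σ i, Fin (g i).1) ↪ Fin N),
      (∀ i, g i ∈ S) ∧ Fintype.card G = l.gates.length ∧
      l.matrix = lift W (tens fun i => (g i).2.1) := by
  classical
  have hd : ∀ i k : Fin l.gates.length, i ≠ k →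
      Disjoint (Set.range (l.gates.get i).wires) (Set.range (l.gates.get k).wires) := by
    intro i k hik
    rcases lt_or_gt_of_ne hik with hlt | hlt
    · exact List.pairwise_iff_get.1 l.disjoint i k hlt
    · exact (List.pairwise_iff_get.1 l.disjoint k i hlt).symm
  refine ⟨Fin l.gates.length, inferInstance, fun i => (l.gates.get i).gate,
    ⟨fun i => (l.gates.get i.1).wires i.2, ?_⟩, fun i => h _ (List.get_mem _ _), by simp, ?_⟩
  · rintro ⟨i, j⟩ ⟨k, m⟩ e
    by_cases hik : i = k
    · subst hik
      obtain rfl : j = m := (l.gates.get i).wires.injective e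
      rfl
    · exact absurd ⟨m, e.symm⟩ (Set.disjoint_left.1 (hd i k hik) ⟨j, rfl⟩)
  · ext y x
    rw [Layer.matrix, prod_placedGate_apply _ l.disjoint, lift]
    have hiff : (∀ i, (∀ g ∈ l.gates, ∀ j, g.wires j ≠ i) → y i = x i) ↔
        ∀ i, (∀ j : (Σ i : Fin l.gates.length, Fin (l.gates.get i).gate.1),
          (l.gates.get j.1).wires j.2 ≠ i) → y i = x i := by
      refine forall_congr' fun i => imp_congr_left ⟨fun H j => H _ (List.get_mem _ _) _, ?_⟩
      intro H g hg j
      obtain ⟨k, rfl⟩ := List.get_of_mem hg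
      exact H ⟨k, j⟩
    have hprod : (l.gates.map fun g => g.gate.2.1 (y ∘ g.wires) (x ∘ g.wires)).prod =
        ∏ i : Fin l.gates.length, (l.gates.get i).gate.2.1 (y ∘ (l.gates.get i).wires)
          (x ∘ (l.gates.get i).wires) := by
      rw [← List.prod_ofFn]
      congr 1
      conv_lhs => rw [← List.ofFn_get l.gates, List.map_ofFn]
      rfl
    rw [hprod]
    by_cases H : ∀ i, (∀ g ∈ l.gates, ∀ j, g.wires j ≠ i) → y i = x i
    · rw [if_pos H]
      exact (if_pos (hiff.1 H)).symm
    · rw [if_neg H]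
      exact (if_neg fun h' => H (hiff.2 h')).symm

theorem IsLayer.exists_layer {N : ℕ} {S : Set Gate} {s : ℕ} {M : Op (Fin N)} (h : IsLayer S s M) :
    ∃ l : Layer N, l.matrix = M ∧ l.gates.length ≤ s ∧ ∀ g ∈ l.gates, g.gate ∈ S := by
  classical
  obtain ⟨G, _, g, W, hg, hs, rfl⟩ := h
  let e := (Fintype.equivFin G).symm
  let P : Fin (Fintype.card G) → PlacedGate N := fun i =>
    ⟨g (e i), ⟨fun j => W ⟨e i, j⟩, fun j k hjk => by simpa using W.injective hjk⟩⟩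
  have hd : (List.ofFn P).Pairwise
      fun g h => Disjoint (Set.range g.wires) (Set.range h.wires) := by
    rw [List.pairwise_ofFn]
    intro i k hik
    rw [Set.disjoint_left]
    rintro _ ⟨j, rfl⟩ ⟨m, hm⟩
    have := congrArg Sigma.fst (W.injective hm)
    exact hik.ne' (e.injective this)
  refine ⟨⟨List.ofFn P, hd⟩, ?_, by simpa using hs, ?_⟩
  · ext y x
    rw [Layer.matrix, prod_placedGate_apply _ hd, QC.lift]
    have hiff : (∀ i, (∀ g ∈ List.ofFn P, ∀ j, g.wires j ≠ i) → y i = x i) ↔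
        ∀ i, (∀ j, W j ≠ i) → y i = x i := by
      refine forall_congr' fun i => imp_congr_left ⟨fun H => ?_, ?_⟩
      · rintro ⟨k, j⟩
        obtain ⟨k, rfl⟩ := e.surjective k
        exact H (P k) (by rw [List.mem_ofFn]; exact ⟨k, rfl⟩) j
      · intro H g hg j
        obtain ⟨k, rfl⟩ := List.mem_ofFn.1 hg
        exact H ⟨e k, j⟩
    have hprod : ((List.ofFn P).map fun g => g.gate.2.1 (y ∘ g.wires) (x ∘ g.wires)).prod =
        tens (fun i => ((g i).2.1 : Op (Fin (g i).1))) (y ∘ W) (x ∘ W) := by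
      rw [List.map_ofFn, List.prod_ofFn, tens]
      exact Fintype.prod_equiv e _ _ fun i => rfl
    rw [hprod]
    by_cases H : ∀ i, (∀ g ∈ List.ofFn P, ∀ j, g.wires j ≠ i) → y i = x i
    · rw [if_pos H, if_pos (hiff.1 H)]
    · rw [if_neg H, if_neg fun h' => H (hiff.2 h')]
  · intro g' hg'
    obtain ⟨k, rfl⟩ := List.mem_ofFn.1 hg'
    exact hg _

theorem IsCirc.exists_circuit {N : ℕ} {S : Set Gate} {d s : ℕ} {M : Op (Fin N)}
    (h : IsCirc S d s M) :
    ∃ C : Circuit N, C.matrix = M ∧ C.depth = d ∧ C.size ≤ s + N ∧ C.HasGateSet S := by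
  induction d generalizing s M with
  | zero =>
    obtain rfl : M = 1 := h
    exact ⟨⟨[]⟩, rfl, rfl, by simp [Circuit.size], by simp [Circuit.HasGateSet]⟩
  | succ d ih =>
    obtain ⟨s₁, s₂, A, B, h, hA, hB, rfl⟩ := h
    obtain ⟨C, rfl, hd, hs, hC⟩ := ih hB
    obtain ⟨l, rfl, hl, hg⟩ := hA.exists_layer
    refine ⟨⟨C.layers ++ [l]⟩, ?_, ?_, ?_, ?_⟩
    · simp [Circuit.matrix]
    · simpa [Circuit.depth] using hd
    · simp only [Circuit.size, List.map_append, List.sum_append, List.map_cons, List.map_nil,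
        List.sum_cons, List.sum_nil] at hs ⊢
      omega
    · intro l' hl' g hg'
      rcases List.mem_append.1 hl' with hl' | hl'
      · exact hC l' hl' g hg'
      · obtain rfl := List.mem_singleton.1 hl'
        exact hg g hg'

theorem polynomial_eval_mono (P : Polynomial ℕ) : Monotone fun n : ℕ => P.eval n := by
  intro a b h
  simp only [Polynomial.eval_eq_sum, Polynomial.sum]
  exact Finset.sum_le_sum fun i _ => Nat.mul_le_mul_left _ (Nat.pow_le_pow_left h i)

section simulation

variable {S T : Set Gate} {D : ℕ} {P : Polynomial ℕ}

theorem Layer.impl (hST : ∀ g ∈ S, Impl T D (P.eval g.1) (g.2.1 : Op (Fin g.1))) {N : ℕ}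
    (l : Layer N) (h : ∀ g ∈ l.gates, g.gate ∈ S) :
    Impl T D (l.gates.length * P.eval N) (l.matrix : Op (Fin N)) := by
  classical
  obtain ⟨G, _, g, W, hg, hs, e⟩ := l.isLayer h
  rw [e]
  refine ((Impl.par fun i => hST (g i) (hg i)).lift W).mono le_rfl ?_
  rw [← hs, ← Finset.card_univ, ← smul_eq_mul]
  -- A gate placed on `N` qubits has at most `N` wires, so each gate costs at most `P.eval N`.
  refine Finset.sum_le_card_nsmul _ _ _ fun i _ => polynomial_eval_mono P ?_
  simpa using Fintype.card_le_of_injective (fun j => W ⟨i, j⟩)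
    fun j k hjk => by simpa using W.injective hjk

theorem Circuit.impl (hST : ∀ g ∈ S, Impl T D (P.eval g.1) (g.2.1 : Op (Fin g.1))) {N : ℕ}
    (C : Circuit N) (h : C.HasGateSet S) :
    Impl T (C.depth * D) ((C.layers.map fun l => l.gates.length).sum * P.eval N)
      (C.matrix : Op (Fin N)) := by
  obtain ⟨L⟩ := C
  simp only [Circuit.depth, Circuit.matrix]
  induction L with
  | nil => simpa using Impl.one
  | cons l L ih =>
    have h1 := ih fun l' hl' => h l' (List.mem_cons_of_mem _ hl')
    have h2 := l.impl hST (h l List.mem_cons_self)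
    simp only [List.reverse_cons, List.map_append, List.prod_append, List.map_cons, List.map_nil,
      List.prod_cons, List.prod_nil, mul_one, List.length_cons, List.sum_cons]
    refine (h1.mul h2).mono (by rw [Nat.succ_mul]) (by rw [Nat.add_mul, Nat.add_comm])

end simulation

/-- Insert ancillas `Fin c` before the last qubit. -/
def insertAnc (n a c : ℕ) : Fin (n + a + 1) ⊕ Fin c → Fin (n + (a + c) + 1) :=
  Sum.elim (fun i => if h : i.1 < n + a then ⟨i, by omega⟩ else Fin.last _)
    fun j => ⟨n + a + j, by omega⟩

theorem insertAnc_bijective (n a c : ℕ) : Function.Bijective (insertAnc n a c) := by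
  rw [Fintype.bijective_iff_injective_and_card]
  refine ⟨?_, by simp; omega⟩
  rintro (i | i) (j | j) h
  · simp only [insertAnc, Sum.elim_inl] at h
    congr 1
    ext
    split_ifs at h <;> simp [Fin.ext_iff] at h <;> omega
  · simp only [insertAnc, Sum.elim_inl, Sum.elim_inr] at h
    split_ifs at h <;> simp [Fin.ext_iff] at h <;> omega
  · simp only [insertAnc, Sum.elim_inl, Sum.elim_inr] at h
    split_ifs at h <;> simp [Fin.ext_iff] at h <;> omega
  · simp only [insertAnc, Sum.elim_inr, Fin.ext_iff] at h
    congr 1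
    ext
    omega

theorem inputBits_insertAnc {n : ℕ} (x : Bits n) (a c : ℕ) :
    inputBits x (a + c) ∘ insertAnc n a c = pad (Fin c) (inputBits x a) := by
  have key : ∀ (b : ℕ) (i : Fin (n + b + 1)),
      inputBits x b i = if h : i.1 < n then x ⟨i, h⟩ else false := by
    intro b i
    refine Fin.lastCases ?_ (fun j => ?_) i
    · simp [inputBits]
    · refine Fin.addCases (fun k => ?_) (fun k => ?_) j
      · simp [inputBits]
      · rw [inputBits, Fin.snoc_castSucc, Fin.append_right]
        simp [constBits]
  funext i
  rcases i with i | i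
  · simp only [Function.comp, pad, Sum.elim_inl, key]
    by_cases h : i.1 < n + a
    · simp [insertAnc, h]
    · have : ¬ i.1 < n := by omega
      simp [insertAnc, h, this, Fin.last]
  · have : ¬ n + a + i.1 < n := by omega
    simp [Function.comp, pad, key, insertAnc, this]

/-- The new qubits are zero wherever the amplitude is nonzero, so padding matches the contributing
strings. The ancillas go before the output qubit, which stays last. -/
theorem probLast_insertAnc {n a c : ℕ} (e : Fin (n + a + 1) ⊕ Fin c ≃ Fin (n + (a + c) + 1))
    (he : ⇑e = insertAnc n a c) (φ : State (n + a + 1)) (ψ : State (n + (a + c) + 1))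
    (h : ∀ y, ψ y = if (y ∘ e) ∘ Sum.inr = (fun _ => false) then φ ((y ∘ e) ∘ Sum.inl) else 0)
    (b : Bool) : probLast ψ b = probLast φ b := by
  symm
  have hu : ∀ u : Bits (n + a + 1), (pad (Fin c) u ∘ e.symm) ∘ e = pad (Fin c) u := fun u => by
    funext i; simp
  refine Fintype.sum_of_injective (fun u => pad (Fin c) u ∘ e.symm) ?_ _ _ ?_ ?_
  · intro u v huv
    apply pad_injective (α := Fin c)
    rw [← hu u, ← hu v]
    exact congrArg (· ∘ e) huv
  · intro y hy
    have : ψ y = 0 := by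
      rw [h, if_neg]
      intro h0
      refine hy ⟨(y ∘ e) ∘ Sum.inl, ?_⟩
      have : y ∘ e = pad (Fin c) ((y ∘ e) ∘ Sum.inl) := (eq_pad_iff _ _).2 ⟨rfl, h0⟩
      change pad (Fin c) ((y ∘ e) ∘ Sum.inl) ∘ e.symm = y
      rw [← this]
      funext i; simp
    simp [this]
  · intro u
    have h1 : ψ (pad (Fin c) u ∘ e.symm) = φ u := by
      rw [h, hu]
      exact if_pos rfl
    have : e.symm (Fin.last (n + (a + c))) = Sum.inl (Fin.last (n + a)) := by
      rw [Equiv.symm_apply_eq, he]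
      simp [insertAnc]
    have h2 : (pad (Fin c) u ∘ e.symm) (Fin.last (n + (a + c))) = u (Fin.last (n + a)) := by
      rw [Function.comp, this]
      rfl
    rw [h1, h2]

/-- A gate set simulated by another one, with constant depth and polynomial size, decides no more
languages. -/
theorem constDepthPolySize_subset {S T : Set Gate} {D : ℕ} {P : Polynomial ℕ}
    (hST : ∀ g ∈ S, Impl T D (P.eval g.1) (g.2.1 : Op (Fin g.1))) (ε : ℝ) :
    constDepthPolySize S ε ⊆ constDepthPolySize T ε := by
  rintro L ⟨d, p, h⟩
  -- There are at most `p n` gates, each on at most `p n` qubits and hence of cost at most `P (p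
  -- n)`; the last summand pays for the original qubits.
  refine ⟨d * D, p * P.comp p + p, fun n => ?_⟩
  obtain ⟨a, C, hS, hd, hs, hC⟩ := h n
  have hgates : (C.layers.map fun l => l.gates.length).sum ≤ p.eval n :=
    (Nat.le_add_right _ _).trans hs
  have hN : n + a + 1 ≤ p.eval n := (Nat.le_add_left _ _).trans hs
  obtain ⟨α, i1, i2, t, M', hM, ht, eM⟩ := C.impl hST hS
  set c := Fintype.card α with hc
  let f := Fintype.equivFin α
  let e : Fin (n + a + 1) ⊕ Fin c ≃ Fin (n + (a + c) + 1) :=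
    Equiv.ofBijective _ (insertAnc_bijective n a c)
  let e' : Fin (n + a + 1) ⊕ α ≃ Fin (n + (a + c) + 1) := (Equiv.sumCongr (Equiv.refl _) f).trans e
  obtain ⟨C', hC', hd', hs', hg'⟩ := (hM.lift e'.toEmbedding).exists_circuit
  refine ⟨a + c, C', hg', ?_, ?_, fun x => ?_⟩
  · rw [hd']
    exact Nat.mul_le_mul_right _ hd
  · refine hs'.trans ?_
    rw [Polynomial.eval_add, Polynomial.eval_mul, Polynomial.eval_comp]
    have h2 : (C.layers.map fun l => l.gates.length).sum * P.eval (n + a + 1) ≤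
        p.eval n * P.eval (p.eval n) := Nat.mul_le_mul hgates (polynomial_eval_mono P hN)
    omega
  · refine (hC x).trans (le_of_eq ?_)
    symm
    refine probLast_insertAnc e rfl _ _ (fun y => ?_) _
    have hcol : ∀ {N : ℕ} (C : Circuit N) (x y : Bits N), C.run x y = C.matrix y x := fun C x y => by
      rw [Circuit.run, ket, Matrix.mulVec_single_one]; rfl
    have hin : inputBits x (a + c) ∘ e' = pad α (inputBits x a) := by
      funext i
      rcases i with i | i
      · exact congrFun (inputBits_insertAnc x a c) (Sum.inl i)
      · exact congrFun (inputBits_insertAnc x a c) (Sum.inr (f i))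
    rw [hcol, hcol, hC', lift_equiv_apply, hin, ← mul_padM_apply M', eM, padM_mul_apply]
    have hiff : (y ∘ e') ∘ Sum.inr = (fun _ => false) ↔
        (y ∘ e) ∘ Sum.inr = fun _ => false := by
      constructor
      · intro H
        funext j
        have := congrFun H (f.symm j)
        simpa [e'] using this
      · intro H
        funext j
        exact congrFun H (f j)
    simp only [hiff]
    rfl

/-! ### One-qubit gates -/

/-- The sign `(-1)^b`. -/
def sgn (b : Bool) : ℂ := if b then -1 else 1

theorem sgn_xor (a b : Bool) : sgn (xor a b) = sgn a * sgn b := by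
  cases a <;> cases b <;> simp [sgn]

theorem sgn_mul_self (a : Bool) : sgn a * sgn a = 1 := by cases a <;> simp [sgn]

theorem star_sgn (a : Bool) : star (sgn a) = sgn a := by cases a <;> simp [sgn]

/-- The Hadamard matrix. -/
noncomputable def hMat : Matrix Bool Bool ℂ := fun y x => ((1 / √2 : ℝ) : ℂ) * sgn (y && x)

/-- The bit flip. -/
def xMat : Matrix Bool Bool ℂ := fun y x => if y = !x then 1 else 0

theorem ofReal_inv_sqrt_two_sq : ((1 / √2 : ℝ) : ℂ) * ((1 / √2 : ℝ) : ℂ) = 1 / 2 := by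
  rw [← Complex.ofReal_mul, div_mul_div_comm, Real.mul_self_sqrt (by norm_num)]
  norm_num

theorem hMat_mul_self : hMat * hMat = 1 := by
  have h := ofReal_inv_sqrt_two_sq
  ext y x
  simp only [Matrix.mul_apply, Fintype.sum_bool, hMat, Matrix.one_apply]
  cases y <;> cases x <;> simp [sgn] at h ⊢ <;> linear_combination 2 * h

theorem hMat_conjTranspose : hMatᴴ = hMat := by
  ext y x
  simp only [Matrix.conjTranspose_apply, hMat, star_mul', star_sgn, Bool.and_comm x y]
  congr 1
  exact Complex.conj_ofReal _

theorem hMat_unitary : hMatᴴ * hMat = 1 := by rw [hMat_conjTranspose, hMat_mul_self]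

/-- The relation X H = H Z, read on matrix entries. -/
theorem hMat_xor (y b x : Bool) : hMat (xor y b) x = hMat y x * sgn (b && x) := by
  have : (xor y b && x) = xor (y && x) (b && x) := by cases y <;> cases b <;> cases x <;> rfl
  rw [hMat, this, sgn_xor, hMat, mul_assoc]

theorem xMat_unitary : xMatᴴ * xMat = 1 := by
  ext y x
  simp only [Matrix.mul_apply, Fintype.sum_bool, xMat, Matrix.one_apply,
    Matrix.conjTranspose_apply]
  cases y <;> cases x <;> simp

theorem loc_conjTranspose {ι : Type} [Fintype ι] (u : ι → Matrix Bool Bool ℂ) :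
    (loc u)ᴴ = loc fun i => (u i)ᴴ := by
  ext y x
  simp [loc, Matrix.conjTranspose_apply]

theorem loc_unitary {ι : Type} [Fintype ι] [DecidableEq ι] {u : ι → Matrix Bool Bool ℂ}
    (h : ∀ i, (u i)ᴴ * u i = 1) : (loc u)ᴴ * loc u = 1 := by
  rw [loc_conjTranspose, loc_mul, ← loc_one]
  congr 1
  exact funext h

theorem Impl.loc {S : Set Gate} (hS : oneQubit ⊆ S) {ι : Type} [Fintype ι] [DecidableEq ι]
    {u : ι → Matrix Bool Bool ℂ} (h : ∀ i, (u i)ᴴ * u i = 1) :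
    Impl S 1 (Fintype.card ι) (loc u) := by
  rw [loc_eq_lift_tens]
  refine Impl.lift ?_ _
  have key : ∀ i, Impl S 1 1 (fun y x => u i (y 0) (x 0) : Op (Fin 1)) := by
    intro i
    have e : (fun y x => u i (y 0) (x 0) : Op (Fin 1)) = QC.loc fun _ : Fin 1 => u i := by
      ext y x; simp [QC.loc]
    rw [e]
    exact Impl.gate (k := 1) (U := ⟨_, Matrix.mem_unitaryGroup_iff'.2 (loc_unitary fun _ => h i)⟩)
      (hS rfl)
  simpa using Impl.par key

theorem Impl.diagGate {S : Set Gate} {k : ℕ} {d : (Fin k → Bool) → ℂ}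
    (hS : ∀ U, (⟨k, U⟩ : Gate) ∈ S) (hd : ∀ x, star (d x) * d x = 1) :
    Impl S 1 1 (diagonal d : Op (Fin k)) := by
  have : (diagonal d : Op (Fin k)) ∈ Matrix.unitaryGroup (Bits k) ℂ := by
    rw [Matrix.mem_unitaryGroup_iff', Matrix.star_eq_conjTranspose, Matrix.diagonal_conjTranspose,
      Matrix.diagonal_mul_diagonal, ← Matrix.diagonal_one]
    congr 1
    funext x
    exact hd x
  exact Impl.gate (U := ⟨_, this⟩) (hS _)

/-! ### Product states -/

/-- The product state of `φ` and `χ`. -/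
def tp {ι κ : Type} (φ : (ι → Bool) → ℂ) (χ : (κ → Bool) → ℂ) : (ι ⊕ κ → Bool) → ℂ :=
  fun y => φ (y ∘ Sum.inl) * χ (y ∘ Sum.inr)

section tp

variable {ι κ : Type} [Fintype ι] [DecidableEq ι] [Fintype κ] [DecidableEq κ]

theorem lift_inr_tp (M : Op κ) (φ : (ι → Bool) → ℂ) (χ : (κ → Bool) → ℂ) :
    lift Function.Embedding.inr M *ᵥ tp φ χ = tp φ (M *ᵥ χ) := by
  funext y
  rw [lift_mulVec]
  have h : ∀ u : κ → Bool,
      Function.extend (Function.Embedding.inr : κ ↪ ι ⊕ κ) u y ∘ Sum.inl = y ∘ Sum.inl := fun u =>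
    funext fun i => extend_off (Function.Embedding.inr : κ ↪ ι ⊕ κ) u y (Sum.inl i)
      fun j hj => by cases hj
  have h' : ∀ u : κ → Bool,
      Function.extend (Function.Embedding.inr : κ ↪ ι ⊕ κ) u y ∘ Sum.inr = u := fun u =>
    extend_comp (Function.Embedding.inr : κ ↪ ι ⊕ κ) u y
  simp only [tp, h, h', Matrix.mulVec, dotProduct, Finset.mul_sum]
  refine Finset.sum_congr rfl fun u _ => ?_
  change M (y ∘ Sum.inr) u * _ = _
  ring

theorem lift_inl_tp (M : Op ι) (φ : (ι → Bool) → ℂ) (χ : (κ → Bool) → ℂ) :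
    lift Function.Embedding.inl M *ᵥ tp φ χ = tp (M *ᵥ φ) χ := by
  funext y
  rw [lift_mulVec]
  have h : ∀ u : ι → Bool,
      Function.extend (Function.Embedding.inl : ι ↪ ι ⊕ κ) u y ∘ Sum.inr = y ∘ Sum.inr := fun u =>
    funext fun i => extend_off (Function.Embedding.inl : ι ↪ ι ⊕ κ) u y (Sum.inr i)
      fun j hj => by cases hj
  have h' : ∀ u : ι → Bool,
      Function.extend (Function.Embedding.inl : ι ↪ ι ⊕ κ) u y ∘ Sum.inl = u := fun u =>
    extend_comp (Function.Embedding.inl : ι ↪ ι ⊕ κ) u y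
  simp only [tp, h, h', Matrix.mulVec, dotProduct, Finset.sum_mul]
  refine Finset.sum_congr rfl fun u _ => ?_
  change M (y ∘ Sum.inl) u * _ = _
  ring

theorem single_sumElim (x : ι → Bool) (z : κ → Bool) :
    (Pi.single (Sum.elim x z) 1 : (ι ⊕ κ → Bool) → ℂ) = tp (Pi.single x 1) (Pi.single z 1) := by
  funext y
  have : y = Sum.elim x z ↔ y ∘ Sum.inl = x ∧ y ∘ Sum.inr = z := by
    constructor
    · rintro rfl; exact ⟨rfl, rfl⟩
    · rintro ⟨rfl, rfl⟩; funext i; rcases i with i | i <;> rfl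
  simp only [tp, Pi.single_apply, this]
  by_cases h1 : y ∘ Sum.inl = x <;> by_cases h2 : y ∘ Sum.inr = z <;> simp [h1, h2]

theorem diagonal_tp_single (D : (ι ⊕ κ → Bool) → ℂ) (x : ι → Bool) (χ : (κ → Bool) → ℂ) :
    diagonal D *ᵥ tp (Pi.single x 1) χ =
      tp (Pi.single x 1) fun y => D (Sum.elim x y) * χ y := by
  funext y
  rw [Matrix.mulVec_diagonal]
  simp only [tp, Pi.single_apply]
  by_cases h : y ∘ Sum.inl = x
  · have : Sum.elim x (y ∘ Sum.inr) = y := by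
      rw [← h]; funext i; rcases i with i | i <;> rfl
    rw [if_pos h, this]; ring
  · rw [if_neg h]; ring

end tp

/-! ### Testing whether a diagonal operator fixes a state -/

/-- Let `ψ = W|0⟩` and let `D x` either fix `ψ` or map it to an orthogonal state. Then a
reflection about `ψ` turns the distinction into a phase. -/
theorem Impl.test {S : Set Gate} (hS : AdjClosed S) {ι κ : Type} [Fintype ι] [DecidableEq ι]
    [Fintype κ] [DecidableEq κ] {W : Op κ} {D : (ι ⊕ κ → Bool) → ℂ} {f g : (ι → Bool) → Bool}
    {dW sW dD sD dR sR : ℕ} (hW : Impl S dW sW W) (hD : Impl S dD sD (diagonal D))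
    (hR : Impl S dR sR (diagonal fun z : ι ⊕ κ → Bool =>
      if g (z ∘ Sum.inl) = true ∧ z ∘ Sum.inr = (fun _ => false) then (-1 : ℂ) else 1))
    (h1 : ∀ x, f x = true → ∀ y, D (Sum.elim x y) * W y (fun _ => false) = W y (fun _ => false))
    (h0 : ∀ x, f x = false →
      ∑ y, star (W y (fun _ => false)) * (D (Sum.elim x y) * W y (fun _ => false)) = 0) :
    Impl S (4 * dW + 2 * dD + dR) (Fintype.card κ + (4 * sW + 2 * sD + sR))
      (diagonal fun x => sgn (g x && f x)) := by
  have hDD : ∀ z, star (D z) * D z = 1 := fun z => by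
    have := congrFun (congrFun hD.unitary z) z
    simpa [Matrix.diagonal_conjTranspose, Matrix.diagonal_mul_diagonal] using this
  have hD' : Impl S dD sD (diagonal fun z => star (D z)) := by
    have := hD.adj hS
    rwa [Matrix.diagonal_conjTranspose] at this
  set z0 : κ → Bool := fun _ => false with hz0
  set R : (ι ⊕ κ → Bool) → ℂ := fun z =>
    if g (z ∘ Sum.inl) = true ∧ z ∘ Sum.inr = z0 then (-1 : ℂ) else 1 with hRdef
  let lW := QC.lift (Function.Embedding.inr : κ ↪ ι ⊕ κ) W
  let lW' := QC.lift (Function.Embedding.inr : κ ↪ ι ⊕ κ) Wᴴ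
  have hlW : Impl S dW sW lW := hW.lift _
  have hlW' : Impl S dW sW lW' := (hW.adj hS).lift _
  -- Read from the right: prepare ψ, apply `D`, return by `Wᴴ`, flip the sign of the zero string if
  -- `g` holds, then undo the first three operations. The middle part `W R Wᴴ` is the reflection
  -- about ψ.
  have hN := hlW'.mul (hD'.mul (hlW.mul (hR.mul (hlW'.mul (hD.mul hlW)))))
  refine (Impl.anc (hN.mono (d' := 4 * dW + 2 * dD + dR) (s' := 4 * sW + 2 * sD + sR) (by omega)
    (by omega)) ?_)
  set ψ : (κ → Bool) → ℂ := W *ᵥ Pi.single z0 1 with hψ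
  have hψy : ∀ y, ψ y = W y z0 := fun y => by rw [hψ, Matrix.mulVec_single_one]; rfl
  have hWψ : Wᴴ *ᵥ ψ = Pi.single z0 1 := by
    rw [hψ, Matrix.mulVec_mulVec, hW.unitary, Matrix.one_mulVec]
  have hWW : ∀ φ, W *ᵥ (Wᴴ *ᵥ φ) = φ := fun φ => by
    rw [Matrix.mulVec_mulVec, mul_eq_one_comm.1 hW.unitary, Matrix.one_mulVec]
  have key : ∀ x : ι → Bool, (lW' * (diagonal (fun z => star (D z)) * (lW * (diagonal R *
      (lW' * (diagonal D * lW)))))) *ᵥ Pi.single (pad κ x) 1 =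
      sgn (g x && f x) • Pi.single (pad κ x) 1 := by
    intro x
    simp only [← Matrix.mulVec_mulVec]
    rw [pad, single_sumElim]
    simp only [lW, lW', lift_inr_tp, diagonal_tp_single]
    change tp _ (Wᴴ *ᵥ fun y => star (D (Sum.elim x y)) * (W *ᵥ fun y => R (Sum.elim x y) *
      (Wᴴ *ᵥ fun y => D (Sum.elim x y) * ψ y) y) y) = _
    set χ : (κ → Bool) → ℂ := fun y => D (Sum.elim x y) * ψ y with hχ
    have hback : (fun y => star (D (Sum.elim x y)) * χ y) = ψ := funext fun y => by
      rw [hχ, ← mul_assoc, hDD, one_mul]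
    -- When `g x` holds, `R` is the identity minus twice the projection onto the zero string, and
    -- the coefficient `(Wᴴ *ᵥ χ) z0` is the inner product of ψ with χ = Dψ. It vanishes if `f x` is
    -- false and is 1 if `f x` is true.
    have hRχ : (fun y => R (Sum.elim x y) * (Wᴴ *ᵥ χ) y) =
        Wᴴ *ᵥ χ - (if g x then 2 * (Wᴴ *ᵥ χ) z0 else 0) • Pi.single z0 1 := by
      funext y
      simp only [hRdef, Sum.elim_comp_inl, Sum.elim_comp_inr, Pi.sub_apply, Pi.smul_apply,
        Pi.single_apply, smul_eq_mul]
      by_cases hg : g x = true <;> by_cases hy : y = z0 <;> simp [hg, hy]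
      ring
    rw [hRχ, Matrix.mulVec_sub, Matrix.mulVec_smul, hWW, ← hψ]
    have hz : (Wᴴ *ᵥ χ) z0 = ∑ y, star (W y z0) * (D (Sum.elim x y) * W y z0) := by
      simp only [Matrix.mulVec, dotProduct, Matrix.conjTranspose_apply, hχ, hψy]
    cases hf : f x with
    | false =>
      rw [hz, h0 x hf]
      have : (fun y => star (D (Sum.elim x y)) *
          (χ - (if g x = true then (2 : ℂ) * 0 else 0) • ψ) y) = ψ := by
        rw [mul_zero, ite_self, zero_smul, sub_zero, hback]
      refine (congrArg (fun v => tp (Pi.single x 1) (Wᴴ *ᵥ v)) this).trans ?_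
      simp only [hWψ, Bool.and_false]
      simp [sgn, hz0]
    | true =>
      have hχψ : χ = ψ := funext fun y => by
        simp only [hχ, hψy]
        exact h1 x hf y
      have hψ' : (fun y => star (D (Sum.elim x y)) * ψ y) = ψ := by
        rw [hχψ] at hback; exact hback
      rw [hχψ, hWψ, Pi.single_eq_same]
      have : (fun y => star (D (Sum.elim x y)) * (ψ - (if g x = true then (2 : ℂ) * 1 else 0) • ψ) y) =
          sgn (g x && true) • ψ := by
        funext y
        have := congrFun hψ' y
        simp only [Pi.sub_apply, Pi.smul_apply, smul_eq_mul, Bool.and_true, sgn] at this ⊢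
        by_cases hg : g x = true
        · simp only [hg, if_true]
          linear_combination -this
        · simp only [hg, Bool.false_eq_true, if_false]
          linear_combination this
      refine (congrArg (fun v => tp (Pi.single x 1) (Wᴴ *ᵥ v)) this).trans ?_
      simp only [Matrix.mulVec_smul, hWψ]
      funext y
      simp only [tp, Pi.smul_apply, smul_eq_mul]
      ring
  ext y x
  have := congrFun (key x) y
  rw [Matrix.mulVec_single_one] at this
  rw [mul_padM_apply]
  refine this.trans ?_
  rw [padM, Matrix.mul_diagonal, Pi.smul_apply, Pi.single_apply, smul_eq_mul, funM, mul_comm]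

/-! ### Permutations and phases -/

section phases

variable {ι κ : Type} [Fintype ι] [DecidableEq ι] [Fintype κ] [DecidableEq κ]

theorem funM_conj_diagonal {X : Type} [Fintype X] [DecidableEq X] {σ : X → X}
    (h : Function.Involutive σ) (d : X → ℂ) :
    funM σ * diagonal d * funM σ = diagonal (d ∘ σ) := by
  rw [Matrix.mul_assoc, diagonal_mul_funM, ← Matrix.mul_assoc, funM_mul_funM, h.comp_self,
    funM_id, Matrix.one_mul]

theorem lift_equiv_funM (e : κ ≃ ι) (f : (κ → Bool) → κ → Bool) :
    lift e.toEmbedding (funM f) = funM fun x => f (x ∘ e) ∘ e.symm := by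
  ext y x
  rw [lift_equiv_apply, funM, funM]
  congr 1
  refine propext ⟨fun h => funext fun i => ?_, fun h => funext fun j => ?_⟩
  · have := congrFun h (e.symm i)
    simpa using this
  · have := congrFun h (e j)
    simpa using this

/-- The phase `-1` at the string `z`. -/
noncomputable def ptPhase (z : ι → Bool) : (ι → Bool) → ℂ := fun x => if x = z then -1 else 1

/-- The phase `(-1)^{b f(x)}`. -/
def cPhase (f : (ι → Bool) → Bool) : (ι ⊕ Fin 1 → Bool) → ℂ :=
  fun x => sgn (x (Sum.inr 0) && f (x ∘ Sum.inl))

/-- The map `(x, b) ↦ (x, b ⊕ f x)`. -/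
def cXor (f : (ι → Bool) → Bool) (x : ι ⊕ Fin 1 → Bool) : ι ⊕ Fin 1 → Bool :=
  Sum.elim (x ∘ Sum.inl) fun _ => xor (x (Sum.inr 0)) (f (x ∘ Sum.inl))

theorem cXor_involutive (f : (ι → Bool) → Bool) : Function.Involutive (cXor f) := by
  intro x
  funext i
  rcases i with i | i
  · rfl
  · obtain rfl := Subsingleton.elim i 0
    simp [cXor]

/-- The parity of a string. -/
def par (x : ι → Bool) : Bool := decide (Odd (Finset.univ.filter fun i => x i = true).card)

theorem sgn_par (x : ι → Bool) : sgn (par x) = ∏ i, sgn (x i) := by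
  simp only [sgn, Finset.prod_ite, Finset.prod_const, one_pow, mul_one, par, decide_eq_true_eq]
  split_ifs with h
  · exact h.neg_one_pow.symm
  · exact (Nat.not_odd_iff_even.1 h).neg_one_pow.symm

theorem sgn_and_par (b : Bool) (x : ι → Bool) : sgn (b && par x) = ∏ i, sgn (b && x i) := by
  cases b
  · simp [sgn]
  · simpa using sgn_par x

/-- The fanout map, with the control last. -/
def fanMap (x : ι ⊕ Fin 1 → Bool) : ι ⊕ Fin 1 → Bool :=
  Sum.elim (fun i => xor (x (Sum.inl i)) (x (Sum.inr 0))) (x ∘ Sum.inr)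

theorem fanMap_involutive : Function.Involutive (fanMap : (ι ⊕ Fin 1 → Bool) → _) := by
  intro x
  funext i
  rcases i with i | i <;> simp [fanMap]

/-- Hadamard gates on the last qubit. -/
noncomputable def hLast : Op (ι ⊕ Fin 1) := loc (Sum.elim (fun _ => 1) fun _ => hMat)

/-- Hadamard gates on all qubits but the last. -/
noncomputable def hInit : Op (ι ⊕ Fin 1) := loc (Sum.elim (fun _ => hMat) fun _ => 1)

theorem hLast_mul_self : (hLast : Op (ι ⊕ Fin 1)) * hLast = 1 := by
  rw [hLast, loc_mul, ← loc_one]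
  congr 1
  funext i
  rcases i with i | i <;> simp [hMat_mul_self]

theorem hInit_mul_self : (hInit : Op (ι ⊕ Fin 1)) * hInit = 1 := by
  rw [hInit, loc_mul, ← loc_one]
  congr 1
  funext i
  rcases i with i | i <;> simp [hMat_mul_self]

/-- On the target qubit, H carries the sign Z^(f x) to the flip X^(f x). -/
theorem hLast_mul_cPhase (f : (ι → Bool) → Bool) :
    hLast * diagonal (cPhase f) = funM (cXor f) * hLast := by
  ext y x
  rw [Matrix.mul_diagonal, funM_mul_apply (cXor_involutive f)]
  simp only [hLast, loc, Fintype.prod_sum_type, Sum.elim_inl, Sum.elim_inr, Finset.univ_unique,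
    Finset.prod_singleton, Matrix.one_apply, Finset.prod_ite_zero, Finset.prod_const_one,
    Fin.default_eq_zero, cXor, Function.comp, hMat_xor, cPhase]
  by_cases h : ∀ i ∈ Finset.univ, y (Sum.inl i) = x (Sum.inl i)
  · have : y ∘ Sum.inl = x ∘ Sum.inl := funext fun i => h i (Finset.mem_univ i)
    simp only [if_pos h, this, Bool.and_comm]
    ring
  · simp only [if_neg h, zero_mul]

/-- The sign (-1)^(b·par x) is the product of the signs (-1)^(b xᵢ), and a Hadamard gate on each
data qubit turns these into the flips xᵢ ⊕ b. So parity and fanout differ by Hadamard gates only. -/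
theorem hInit_mul_cPhase_par :
    hInit * diagonal (cPhase (par : (ι → Bool) → Bool)) = funM fanMap * hInit := by
  ext y x
  rw [Matrix.mul_diagonal, funM_mul_apply fanMap_involutive]
  simp only [hInit, loc, Fintype.prod_sum_type, Sum.elim_inl, Sum.elim_inr, Finset.univ_unique,
    Finset.prod_singleton, Matrix.one_apply, Fin.default_eq_zero, fanMap, Function.comp, hMat_xor,
    cPhase, sgn_and_par, Finset.prod_mul_distrib]
  by_cases h : y (Sum.inr 0) = x (Sum.inr 0)
  · simp only [h, if_true]
    ring
  · simp only [if_neg h, mul_zero, zero_mul]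

theorem funM_cXor_eq (f : (ι → Bool) → Bool) :
    funM (cXor f) = hLast * diagonal (cPhase f) * hLast := by
  rw [hLast_mul_cPhase, Matrix.mul_assoc, hLast_mul_self, Matrix.mul_one]

theorem diagonal_cPhase_eq (f : (ι → Bool) → Bool) :
    diagonal (cPhase f) = hLast * funM (cXor f) * hLast := by
  rw [Matrix.mul_assoc, ← hLast_mul_cPhase, ← Matrix.mul_assoc, hLast_mul_self, Matrix.one_mul]

theorem funM_fanMap_eq :
    funM (fanMap : (ι ⊕ Fin 1 → Bool) → _) = hInit * diagonal (cPhase par) * hInit := by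
  rw [hInit_mul_cPhase_par, Matrix.mul_assoc, hInit_mul_self, Matrix.mul_one]

theorem diagonal_cPhase_par_eq :
    diagonal (cPhase (par : (ι → Bool) → Bool)) = hInit * funM fanMap * hInit := by
  rw [Matrix.mul_assoc, ← hInit_mul_cPhase_par, ← Matrix.mul_assoc, hInit_mul_self, Matrix.one_mul]

variable {S : Set Gate}

theorem Impl.hLast (hS : oneQubit ⊆ S) :
    Impl S 1 (Fintype.card ι + 1) (QC.hLast : Op (ι ⊕ Fin 1)) := by
  rw [QC.hLast]
  have := Impl.loc hS (u := (Sum.elim (fun _ => 1) fun _ => hMat : ι ⊕ Fin 1 → _)) ?_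
  · simpa using this
  · rintro (i | i) <;> simp [hMat_unitary]

theorem Impl.hInit (hS : oneQubit ⊆ S) :
    Impl S 1 (Fintype.card ι + 1) (QC.hInit : Op (ι ⊕ Fin 1)) := by
  rw [QC.hInit]
  have := Impl.loc hS (u := (Sum.elim (fun _ => hMat) fun _ => 1 : ι ⊕ Fin 1 → _)) ?_
  · simpa using this
  · rintro (i | i) <;> simp [hMat_unitary]

theorem loc_flip (z : ι → Bool) :
    loc (fun i => if z i then xMat else 1) = funM fun (x : ι → Bool) i => xor (x i) (z i) := by
  ext y x
  simp only [loc, funM, funext_iff]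
  have : ∀ i, (if z i = true then xMat else 1) (y i) (x i) =
      if y i = xor (x i) (z i) then (1 : ℂ) else 0 := fun i => by
    cases z i <;> simp [xMat, Matrix.one_apply]
  simp only [this, Finset.prod_ite_zero, Finset.prod_const_one, Finset.mem_univ, true_imp_iff]

theorem Impl.flip_conj (hS : oneQubit ⊆ S) {d s : ℕ} {D : (ι → Bool) → ℂ}
    (h : Impl S d s (diagonal D)) (z : ι → Bool) :
    Impl S (d + 2) (s + 2 * Fintype.card ι) (diagonal fun x => D fun i => xor (x i) (z i)) := by
  have hinv : Function.Involutive fun (x : ι → Bool) i => xor (x i) (z i) := fun x => by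
    funext i; simp
  have h1 := Impl.loc hS (u := fun i => if z i then xMat else 1) fun i => by
    by_cases hz : z i <;> simp [hz, xMat_unitary]
  rw [loc_flip] at h1
  have := (h1.mul h).mul h1
  rw [funM_conj_diagonal hinv] at this
  exact this.mono (by omega) (by omega)

theorem Impl.ptPhase_of_true (hS : oneQubit ⊆ S) {d s : ℕ}
    (h : Impl S d s (diagonal (ptPhase fun _ : ι => true))) (z : ι → Bool) :
    Impl S (d + 2) (s + 2 * Fintype.card ι) (diagonal (ptPhase z)) := by
  have := h.flip_conj hS fun i => !z i
  convert this using 3 with x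
  simp only [ptPhase]
  congr 1
  refine propext ⟨?_, fun h => funext fun i => ?_⟩
  · rintro rfl; funext i; simp
  · have := congrFun h i
    cases hx : x i <;> cases hz : z i <;> simp_all

theorem cPhase_forall {f : (ι → Bool) → Bool} (hf : ∀ x, f x = true ↔ ∀ i, x i = true) :
    cPhase f = ptPhase fun _ => true := by
  funext x
  have : x = (fun _ => true) ↔ x (Sum.inr 0) = true ∧ ∀ i, (x ∘ Sum.inl) i = true := by
    constructor
    · rintro rfl; simp
    · rintro ⟨h1, h2⟩
      funext i
      rcases i with i | i
      · exact h2 i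
      · obtain rfl := Subsingleton.elim i 0
        exact h1
  simp only [cPhase, ptPhase, sgn, this, Bool.and_eq_true, hf]

end phases

/-- Puts a point phase into the shape of the reflection required by `Impl.test`, with the last input
qubit as the control `g`. -/
theorem Impl.controlledReflection {S : Set Gate} {n d s : ℕ} {κ : Type} [Fintype κ]
    [DecidableEq κ] (h : Impl S d s (diagonal (ptPhase (Sum.elim (fun _ => true) fun _ => false :
      Fin 1 ⊕ κ → Bool)))) :
    Impl S d s (diagonal fun z : (Fin n ⊕ Fin 1) ⊕ κ → Bool =>
      if (z ∘ Sum.inl) (Sum.inr 0) = true ∧ z ∘ Sum.inr = (fun _ => false) then (-1 : ℂ)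
      else 1) := by
  have h := h.lift ((Function.Embedding.inr : Fin 1 ↪ Fin n ⊕ Fin 1).sumMap
    (Function.Embedding.refl κ))
  rw [lift_diagonal] at h
  convert h using 3 with z
  simp only [ptPhase]
  congr 1
  refine propext ⟨fun h => funext fun i => ?_, fun h => ⟨?_, funext fun i => ?_⟩⟩
  · rcases i with i | i
    · obtain rfl := Subsingleton.elim i 0
      exact h.1
    · exact congrFun h.2 i
  · exact congrFun h (Sum.inl 0)
  · exact congrFun h (Sum.inr i)

/-! ### The gates of the three gate sets -/

section gates

variable {S : Set Gate} {n : ℕ}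

theorem lift_oracleGate (f : Bits n → Bool) :
    lift (finSumFinEquiv (m := n) (n := 1)).symm.toEmbedding
      (permMatrix (oracleMap_involutive f).toPerm : Op (Fin (n + 1))) = funM (cXor f) := by
  refine (lift_equiv_funM (finSumFinEquiv (m := n) (n := 1)).symm (oracleMap f)).trans ?_
  congr 1
  funext x i
  have h : Fin.init (x ∘ (finSumFinEquiv (m := n) (n := 1)).symm) = x ∘ Sum.inl := by
    funext j
    exact congrArg x (finSumFinEquiv_symm_apply_castAdd j)
  have hl : (finSumFinEquiv (m := n) (n := 1)).symm (Fin.last n) = Sum.inr 0 :=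
    finSumFinEquiv_symm_apply_natAdd 0
  rcases i with i | i
  · change oracleMap f _ (Fin.castSucc i) = _
    rw [oracleMap, Fin.snoc_castSucc, h]
    rfl
  · obtain rfl := Subsingleton.elim i 0
    change oracleMap f _ (Fin.last n) = _
    rw [oracleMap, Fin.snoc_last, h, Function.comp, hl]
    rfl

theorem lift_symm_lift {ι κ : Type} [Fintype ι] [DecidableEq ι] [Fintype κ] [DecidableEq κ]
    (e : κ ≃ ι) (A : Op κ) : lift e.symm.toEmbedding (lift e.toEmbedding A) = A := by
  ext y x
  rw [lift_equiv_apply, lift_equiv_apply]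
  congr 1 <;> funext i <;> simp

theorem Impl.cPhase_of_oracleGate (hS : oneQubit ⊆ S) {f : Bits n → Bool} (h : oracleGate f ∈ S) :
    Impl S 3 (2 * n + 3) (diagonal (cPhase f)) := by
  have h1 : Impl S 1 1 (funM (cXor f)) := by
    rw [← lift_oracleGate]
    exact (Impl.gate h).lift _
  rw [diagonal_cPhase_eq]
  refine (((Impl.hLast hS).mul h1).mul (Impl.hLast hS)).mono le_rfl ?_
  simp only [Fintype.card_fin]
  omega

theorem Impl.oracleGate_of_cPhase (hS : oneQubit ⊆ S) {f : Bits n → Bool} {d s : ℕ}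
    (h : Impl S d s (diagonal (cPhase f))) :
    Impl S (d + 2) (s + 2 * n + 2) ((oracleGate f).2.1 : Op (Fin (n + 1))) := by
  have h1 : Impl S (d + 2) (s + 2 * n + 2) (funM (cXor f)) := by
    rw [funM_cXor_eq]
    refine (((Impl.hLast hS).mul h).mul (Impl.hLast hS)).mono (by omega) ?_
    simp only [Fintype.card_fin]
    omega
  rw [← lift_oracleGate] at h1
  have := h1.lift (finSumFinEquiv (m := n) (n := 1)).toEmbedding
  have e := lift_symm_lift (finSumFinEquiv (m := n) (n := 1)).symm
    (permMatrix (oracleMap_involutive f).toPerm : Op (Fin (n + 1)))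
  rw [Equiv.symm_symm] at e
  rwa [e] at this

/-- The qubits of a fanout gate, with the control last. -/
def fanEquiv (n : ℕ) : Fin (n + 1) ≃ Fin n ⊕ Fin 1 where
  toFun := Fin.cases (Sum.inr 0) Sum.inl
  invFun := Sum.elim Fin.succ fun _ => 0
  left_inv i := by refine Fin.cases ?_ (fun j => ?_) i <;> rfl
  right_inv i := by
    rcases i with i | i
    · rfl
    · obtain rfl := Subsingleton.elim i 0
      rfl

theorem lift_fanoutGate (n : ℕ) :
    lift (fanEquiv n).toEmbedding
      (permMatrix (fanoutMap_involutive n).toPerm : Op (Fin (n + 1))) = funM fanMap := by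
  refine (lift_equiv_funM (fanEquiv n) (fanoutMap n)).trans ?_
  congr 1
  funext x i
  rcases i with i | i
  · rfl
  · obtain rfl := Subsingleton.elim i 0
    rfl

theorem Impl.fanMap_of_fanoutGate (h : fanoutGate n ∈ S) :
    Impl S 1 1 (funM (fanMap : (Fin n ⊕ Fin 1 → Bool) → _)) := by
  rw [← lift_fanoutGate]
  exact (Impl.gate h).lift _

theorem Impl.fanoutGate_of_cPhase_par (hS : oneQubit ⊆ S) {d s : ℕ}
    (h : Impl S d s (diagonal (cPhase (QC.par : (Fin n → Bool) → Bool)))) :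
    Impl S (d + 2) (s + 2 * n + 2) ((fanoutGate n).2.1 : Op (Fin (n + 1))) := by
  have h1 : Impl S (d + 2) (s + 2 * n + 2) (funM (fanMap : (Fin n ⊕ Fin 1 → Bool) → _)) := by
    rw [funM_fanMap_eq]
    refine (((Impl.hInit hS).mul h).mul (Impl.hInit hS)).mono (by omega) ?_
    simp only [Fintype.card_fin]
    omega
  rw [← lift_fanoutGate] at h1
  have := h1.lift (fanEquiv n).symm.toEmbedding
  rwa [lift_symm_lift] at this

theorem adjClosed_oneQubit : AdjClosed oneQubit := fun _ _ h => h

theorem adjClosed_twoQubit : AdjClosed twoQubit := fun _ _ h => h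

theorem AdjClosed.union {S T : Set Gate} (hS : AdjClosed S) (hT : AdjClosed T) :
    AdjClosed (S ∪ T) := by
  rintro k U (h | h)
  · exact Or.inl (hS k U h)
  · exact Or.inr (hT k U h)

theorem star_permMatrix {k : ℕ} {σ : Bits k → Bits k} (h : Function.Involutive σ) :
    star (⟨permMatrix h.toPerm, permMatrix_mem _⟩ : Matrix.unitaryGroup (Bits k) ℂ) =
      ⟨permMatrix h.toPerm, permMatrix_mem _⟩ := by
  ext y x
  change star (permMatrix h.toPerm x y) = permMatrix h.toPerm y x
  simp only [permMatrix, Function.Involutive.coe_toPerm]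
  have : x = σ y ↔ y = σ x := by
    constructor <;> (rintro rfl; rw [h])
  simp only [this]
  by_cases hy : y = σ x <;> simp [hy]

theorem adjClosed_range {I : Type} (k : I → ℕ) (σ : ∀ i, Bits (k i) → Bits (k i))
    (h : ∀ i, Function.Involutive (σ i)) (p : I → Prop) :
    AdjClosed {g | ∃ i, p i ∧ g = permGate (h i).toPerm} := by
  rintro m U ⟨i, hp, hi⟩
  obtain rfl : m = k i := congrArg Sigma.fst hi
  obtain rfl := eq_of_heq (Sigma.mk.inj hi).2
  exact ⟨i, hp, by rw [star_permMatrix]; rfl⟩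

theorem adjClosed_QTC : AdjClosed QTC := by
  refine (adjClosed_oneQubit.union adjClosed_twoQubit).union ?_
  have := adjClosed_range (fun i : ℕ × ℕ => i.1 + 1) _
    (fun i => oracleMap_involutive (threshold i.1 i.2)) fun _ => True
  convert this using 2
  simp [thresholdGates, oracleGate]

theorem adjClosed_fanoutGates : AdjClosed fanoutGates :=
  adjClosed_range (fun n : ℕ => n + 1) _ (fun n => fanoutMap_involutive n) fun n => 1 ≤ n

theorem adjClosed_QNCwf : AdjClosed QNCwf :=
  (adjClosed_oneQubit.union adjClosed_twoQubit).union adjClosed_fanoutGates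

theorem oneQubit_subset_QTC : oneQubit ⊆ QTC := fun _ h => Or.inl (Or.inl h)

theorem oneQubit_subset_QNCwf : oneQubit ⊆ QNCwf := fun _ h => Or.inl (Or.inl h)

theorem oneQubit_subset_QACwf : oneQubit ⊆ QACwf := fun _ h => Or.inl (Or.inl h)

end gates

/-! ### Basic phases from threshold gates -/

theorem lift_inr_apply {ι κ : Type} [Fintype ι] [DecidableEq ι] (M : Op κ) (y x : ι ⊕ κ → Bool) :
    lift Function.Embedding.inr M y x =
      if y ∘ Sum.inl = x ∘ Sum.inl then M (y ∘ Sum.inr) (x ∘ Sum.inr) else 0 := by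
  classical
  rw [lift]
  have : (∀ i, (∀ j, (Function.Embedding.inr : κ ↪ ι ⊕ κ) j ≠ i) → y i = x i) ↔
      y ∘ Sum.inl = x ∘ Sum.inl := by
    constructor
    · intro h
      funext i
      exact h (Sum.inl i) fun j hj => by cases hj
    · rintro h (i | i) hi
      · exact congrFun h i
      · exact absurd rfl (hi i)
  simp only [this]
  rfl

theorem loc_elim_one {ι κ : Type} [Fintype ι] [DecidableEq ι] [Fintype κ] [DecidableEq κ]
    (u : ι → Matrix Bool Bool ℂ) :
    loc (Sum.elim u fun _ : κ => 1) = lift Function.Embedding.inl (loc u) := by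
  classical
  ext y x
  simp only [loc, Fintype.prod_sum_type, Sum.elim_inl, Sum.elim_inr, Matrix.one_apply,
    Finset.prod_ite_zero, Finset.prod_const_one, lift]
  have : (∀ i, (∀ j, (Function.Embedding.inl : ι ↪ ι ⊕ κ) j ≠ i) → y i = x i) ↔
      ∀ i ∈ Finset.univ, y (Sum.inr i) = x (Sum.inr i) := by
    constructor
    · intro h i _
      exact h (Sum.inr i) fun j hj => by cases hj
    · rintro h (i | i) hi
      · exact absurd rfl (hi i)
      · exact h i (Finset.mem_univ i)
  simp only [this, mul_ite, mul_one, mul_zero]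
  rfl

theorem threshold_mem_QTC (n k : ℕ) : oracleGate (threshold n k) ∈ QTC := Or.inr ⟨n, k, rfl⟩

theorem andFun_eq_threshold (n : ℕ) : andFun n = threshold n n := by
  funext x
  have h : weight x = n ↔ ∀ i, x i = true := by
    have := Finset.card_filter_eq_iff (s := (Finset.univ : Finset (Fin n)))
      (p := fun i => x i = true)
    simpa [weight] using this
  have h' : weight x ≤ n := by
    simpa [weight] using Finset.card_filter_le (Finset.univ : Finset (Fin n)) fun i => x i = true
  simp only [andFun, threshold, ← h]
  congr 1
  refine propext ⟨fun h => h.ge, fun h => le_antisymm h' h⟩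

/-- The sign version of an AND gate with n inputs treats its target like an input, so it is the
phase at the all-ones string of n + 1 qubits; this is why `ι` must be nonempty. Bit flips move the
point to `z`. -/
theorem Impl.ptPhase_QTC {ι : Type} [Fintype ι] [DecidableEq ι] [Nonempty ι] (z : ι → Bool) :
    Impl QTC 5 (4 * Fintype.card ι + 1) (diagonal (ptPhase z)) := by
  obtain ⟨n, hn⟩ : ∃ n, Fintype.card ι = n + 1 := ⟨_, (Nat.succ_pred_eq_of_pos Fintype.card_pos).symm⟩
  have e : Fin n ⊕ Fin 1 ≃ ι := Fintype.equivOfCardEq (by simp [hn])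
  have h := (Impl.cPhase_of_oracleGate oneQubit_subset_QTC (threshold_mem_QTC n n)).lift e.toEmbedding
  rw [← andFun_eq_threshold] at h
  have h2 : Impl QTC 3 (2 * n + 3) (diagonal (QC.ptPhase fun _ : ι => true)) := by
    convert h using 1
    rw [cPhase_forall (f := andFun n) fun x => decide_eq_true_iff, lift_diagonal]
    congr 1
    funext x
    simp only [QC.ptPhase]
    congr 1
    refine propext ⟨fun h => by rw [h]; rfl, fun h => funext fun i => ?_⟩
    have := congrFun h (e.symm i)
    simpa using this
  exact (h2.ptPhase_of_true oneQubit_subset_QTC z).mono le_rfl (by omega)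

/-- The events |x| ≥ k and |x| ≥ k + 1 differ exactly when |x| = k, so the product of the two
threshold signs is the desired sign. -/
theorem Impl.cPhase_weight_eq (n k : ℕ) :
    Impl QTC 6 (4 * n + 6) (diagonal (cPhase fun x : Fin n → Bool => decide (weight x = k))) := by
  have h := (Impl.cPhase_of_oracleGate oneQubit_subset_QTC (threshold_mem_QTC n k)).mul
    (Impl.cPhase_of_oracleGate oneQubit_subset_QTC (threshold_mem_QTC n (k + 1)))
  rw [Matrix.diagonal_mul_diagonal] at h
  refine (congrArg (fun d => Impl QTC 6 (4 * n + 6) (diagonal d)) (funext fun x => ?_)).mp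
    (h.mono (d' := 6) (s' := 4 * n + 6) (by omega) (by omega))
  simp only [cPhase, threshold]
  cases x (Sum.inr 0)
  · simp [sgn]
  · rcases lt_trichotomy (weight (x ∘ Sum.inl)) k with h | h | h
    · have h1 : ¬ k ≤ weight (x ∘ Sum.inl) := by omega
      have h2 : ¬ k + 1 ≤ weight (x ∘ Sum.inl) := by omega
      simp [h.ne, h1, h2, sgn]
    · simp [h, sgn]
    · have h1 : k ≤ weight (x ∘ Sum.inl) := by omega
      have h2 : k + 1 ≤ weight (x ∘ Sum.inl) := by omega
      simp [h.ne', h1, h2, sgn]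

/-! ### One step of exact amplitude amplification -/

/-- The initial weight 1/4 on the target strings means sin θ = 1/2, so 3θ = π/2 and one iteration
lands exactly on the target subspace. With `p` the target part of the initial column, the result is
`-2 p`, which has norm 1. -/
theorem Impl.grover {ι : Type} [Fintype ι] [DecidableEq ι] [Nonempty ι] {V : Op ι} {d s : ℕ}
    (hV : Impl QTC d s V) {a b : ι → Bool} (hab : a ≠ b)
    (h : ‖V a fun _ => false‖ ^ 2 + ‖V b fun _ => false‖ ^ 2 = 1 / 4) :
    ∃ U : Op ι, Impl QTC (3 * d + 15) (3 * s + 12 * Fintype.card ι + 3) U ∧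
      ∀ y, U y (fun _ => false) = if y = a ∨ y = b then -2 * V y (fun _ => false) else 0 := by
  set z : ι → Bool := fun _ => false with hz
  have hU := hV.mul ((Impl.ptPhase_QTC z).mul ((hV.adj adjClosed_QTC).mul
    ((Impl.ptPhase_QTC a).mul ((Impl.ptPhase_QTC b).mul hV))))
  refine ⟨_, hU.mono (by omega) (by omega), ?_⟩
  set v : (ι → Bool) → ℂ := fun y => V y z with hv
  have hcol : V *ᵥ Pi.single z 1 = v := by rw [Matrix.mulVec_single_one]; rfl
  set p : (ι → Bool) → ℂ := fun y => if y = a ∨ y = b then v y else 0 with hp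
  have hVv : Vᴴ *ᵥ v = Pi.single z 1 := by
    rw [← hcol, Matrix.mulVec_mulVec, hV.unitary, Matrix.one_mulVec]
  have h1 : diagonal (ptPhase a) *ᵥ (diagonal (ptPhase b) *ᵥ v) = v - (2 : ℂ) • p := by
    funext y
    simp only [Matrix.mulVec_diagonal, ptPhase, Pi.sub_apply, Pi.smul_apply, hp, smul_eq_mul]
    by_cases ha : y = a
    · have hb : ¬ a = b := hab
      subst ha
      simp [hb]; ring
    · by_cases hb : y = b
      · simp [hb, hab.symm]; ring
      · simp [ha, hb]
  -- This entry is the inner product of `v` and `p`, that is, the squared norm of `p`.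
  have hpz : (Vᴴ *ᵥ p) z = 1 / 4 := by
    have e : ∀ y, Vᴴ z y * p y = if y = a ∨ y = b then ((‖v y‖ ^ 2 : ℝ) : ℂ) else 0 := by
      intro y
      simp only [Matrix.conjTranspose_apply, hp, mul_ite, mul_zero]
      congr 1
      push_cast
      exact Complex.conj_mul' (v y)
    simp only [Matrix.mulVec, dotProduct, e]
    rw [← Finset.sum_filter]
    have : (Finset.univ.filter fun y => y = a ∨ y = b) = {a, b} := by ext; simp
    rw [this, Finset.sum_pair hab, ← Complex.ofReal_add, h]
    norm_num
  -- The vector is e_z - 2 Vᴴp, whose entry at `z` is 1 - 2/4 = 1/2. Changing its sign subtracts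
  -- exactly e_z, leaving -2 Vᴴp.
  have h2 : diagonal (ptPhase z) *ᵥ (Vᴴ *ᵥ (v - (2 : ℂ) • p)) = (-2 : ℂ) • (Vᴴ *ᵥ p) := by
    rw [Matrix.mulVec_sub, Matrix.mulVec_smul, hVv]
    funext y
    simp only [Matrix.mulVec_diagonal, ptPhase, Pi.sub_apply, Pi.smul_apply, smul_eq_mul,
      Pi.single_apply]
    by_cases hy : y = z
    · simp only [hy, if_true, hpz]; ring
    · simp only [hy, if_false]; ring
  intro y
  have e : ∀ (M : Op ι), M y z = (M *ᵥ Pi.single z 1) y := fun M => by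
    rw [Matrix.mulVec_single_one]; rfl
  refine (e _).trans ?_
  simp only [← Matrix.mulVec_mulVec]
  rw [hcol, h1, h2, Matrix.mulVec_smul, Matrix.mulVec_mulVec, mul_eq_one_comm.1 hV.unitary,
    Matrix.one_mulVec]
  simp only [Pi.smul_apply, smul_eq_mul, hp, mul_ite, mul_zero, hv]

/-! ### A state supported on two strings -/

/-- The rotation with first column `(p, q)`. -/
noncomputable def rotMat (p q : ℝ) : Matrix Bool Bool ℂ := fun y x =>
  if x then (if y then (p : ℂ) else -(q : ℂ)) else if y then (q : ℂ) else (p : ℂ)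

theorem rotMat_unitary {p q : ℝ} (h : p ^ 2 + q ^ 2 = 1) : (rotMat p q)ᴴ * rotMat p q = 1 := by
  have h' : (p : ℂ) ^ 2 + (q : ℂ) ^ 2 = 1 := by exact_mod_cast h
  ext y x
  simp only [Matrix.mul_apply, Fintype.sum_bool, rotMat, Matrix.one_apply,
    Matrix.conjTranspose_apply]
  cases y <;> cases x <;> simp <;> first | linear_combination h' | ring

theorem card_weight_eq (n k : ℕ) :
    (Finset.univ.filter fun u : Fin n → Bool => weight u = k).card = n.choose k := by
  rw [← Finset.card_fin n, ← Finset.card_powersetCard, Finset.card_fin]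
  refine Finset.card_bij' (fun u _ => Finset.univ.filter fun i => u i = true)
    (fun s _ i => decide (i ∈ s)) ?_ ?_ ?_ ?_
  · intro u hu
    rw [Finset.mem_powersetCard]
    exact ⟨Finset.subset_univ _, (Finset.mem_filter.1 hu).2⟩
  · intro s hs
    rw [Finset.mem_filter]
    refine ⟨Finset.mem_univ _, ?_⟩
    simpa [weight] using (Finset.mem_powersetCard.1 hs).2
  · intro u _
    funext i; simp
  · intro s _
    ext i; simp

theorem prod_sgn_eq_pow {n : ℕ} (u : Fin n → Bool) : ∏ i, sgn (u i) = (-1) ^ weight u := by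
  simp [sgn, Finset.prod_ite, weight]

/-- The unmodified character sum vanishes because n ≥ 1; reversing the sign of each of the strings
of weight `k` contributes -2(-1)^k apiece. -/
theorem sum_prod_sgn_weight {n : ℕ} (hn : 1 ≤ n) (k : ℕ) :
    ∑ u : Fin n → Bool, (∏ i, sgn (u i)) * sgn (decide (weight u = k)) =
      -2 * (-1) ^ k * (n.choose k : ℂ) := by
  have h0 : ∑ u : Fin n → Bool, ∏ i, sgn (u i) = 0 := by
    have := Finset.prod_univ_sum (fun _ : Fin n => (Finset.univ : Finset Bool)) fun _ b => sgn b
    rw [Fintype.piFinset_univ] at this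
    rw [← this, Finset.prod_eq_zero (Finset.mem_univ (⟨0, hn⟩ : Fin n))]
    simp [sgn]
  have h1 : ∀ u : Fin n → Bool, (∏ i, sgn (u i)) * sgn (decide (weight u = k)) =
      (∏ i, sgn (u i)) + if weight u = k then -2 * (-1) ^ k else 0 := by
    intro u
    by_cases h : weight u = k
    · rw [prod_sgn_eq_pow, h]; simp [sgn]; ring
    · simp [h, sgn]
  simp only [h1, Finset.sum_add_distrib, h0, zero_add]
  rw [← Finset.sum_filter, Finset.sum_const, card_weight_eq, nsmul_eq_mul]
  ring

/-- The first rotation points in the direction of (a, b), and `q₀` supplies the length. Taking the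
length at most 1 is what makes `q₁` real. -/
theorem exists_rotations {a b : ℝ} (ha : 0 < a) (h : a ^ 2 + b ^ 2 ≤ 1) :
    ∃ p₀ p₁ q₀ q₁ : ℝ, p₀ ^ 2 + p₁ ^ 2 = 1 ∧ q₀ ^ 2 + q₁ ^ 2 = 1 ∧ p₀ * q₀ = a ∧ p₁ * q₀ = b := by
  have hpos : 0 < a ^ 2 + b ^ 2 := by positivity
  have hq : √(a ^ 2 + b ^ 2) ≠ 0 := (Real.sqrt_pos.2 hpos).ne'
  refine ⟨a / √(a ^ 2 + b ^ 2), b / √(a ^ 2 + b ^ 2), √(a ^ 2 + b ^ 2), √(1 - (a ^ 2 + b ^ 2)),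
    ?_, ?_, by field_simp, by field_simp⟩
  · rw [div_pow, div_pow, Real.sq_sqrt hpos.le, ← add_div, div_self hpos.ne']
  · rw [Real.sq_sqrt hpos.le, Real.sq_sqrt (by linarith)]
    ring

/-- The qubits of a row: `n` data qubits, a control qubit and a qubit for adjusting amplitudes. -/
abbrev Row (n : ℕ) : Type := (Fin n ⊕ Fin 1) ⊕ Fin 1

/-- The all-ones string on the data and control qubits. -/
def Row.ones (n : ℕ) : Row n → Bool := Sum.elim (fun _ => true) fun _ => false

/-- With the control at 0 the two layers of Hadamard gates cancel and the data return to 0ⁿ. With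
the control at 1, the amplitude at 1ⁿ is the alternating sum of `sum_prod_sgn_weight` divided by 2ⁿ.
The last qubit of the row contributes the common factor `q₀`. -/
theorem Impl.weakCat {n : ℕ} (hn : 1 ≤ n) (k : ℕ) {p₀ p₁ q₀ q₁ : ℝ} (hp : p₀ ^ 2 + p₁ ^ 2 = 1)
    (hq : q₀ ^ 2 + q₁ ^ 2 = 1) :
    ∃ V : Op (Row n), Impl QTC 10 (7 * n + 10) V ∧
      V (fun _ => false) (fun _ => false) = p₀ * q₀ ∧
      V (Row.ones n) (fun _ => false) = -2 * (-1) ^ k * (n.choose k : ℂ) / 2 ^ n * (p₁ * q₀) := by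
  let u : Fin n ⊕ Fin 1 → Matrix Bool Bool ℂ := Sum.elim (fun _ => hMat) fun _ => rotMat p₀ p₁
  let D : (Fin n ⊕ Fin 1 → Bool) → ℂ := cPhase fun x : Fin n → Bool => decide (weight x = k)
  let V₁ : Op (Fin n ⊕ Fin 1) := QC.hInit * (diagonal D * QC.loc u)
  let V₂ : Op (Fin 1) := QC.loc fun _ => rotMat q₀ q₁
  have hV₁ : Impl QTC 8 (6 * n + 8) V₁ := by
    have := (Impl.hInit (ι := Fin n) oneQubit_subset_QTC).mul
      ((Impl.cPhase_weight_eq n k).mul (Impl.loc oneQubit_subset_QTC (u := u) ?_))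
    · refine this.mono le_rfl ?_
      simp only [Fintype.card_sum, Fintype.card_fin]
      omega
    · rintro (i | i)
      · exact hMat_unitary
      · exact rotMat_unitary hp
  have hV₂ : Impl QTC 1 1 V₂ := Impl.loc oneQubit_subset_QTC fun _ => rotMat_unitary hq
  have hV : Impl QTC 10 (7 * n + 10) (QC.lift Function.Embedding.inl V₁ *
      QC.lift Function.Embedding.inr V₂ : Op (Row n)) :=
    ((hV₁.lift Function.Embedding.inl).mul (hV₂.lift Function.Embedding.inr)).mono
      (by omega) (by omega)
  have hval : ∀ y : Row n → Bool, (QC.lift Function.Embedding.inl V₁ *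
      QC.lift Function.Embedding.inr V₂ : Op (Row n)) y (fun _ => false) =
      V₁ (y ∘ Sum.inl) (fun _ => false) * V₂ (y ∘ Sum.inr) fun _ => false := by
    intro y
    have e0 : (fun _ => false : Row n → Bool) = Sum.elim (fun _ => false) fun _ => false := by
      funext i; rcases i with i | i <;> rfl
    have e : ∀ M : Op (Row n), M y (fun _ => false) = (M *ᵥ Pi.single (fun _ => false) 1) y :=
      fun M => by rw [Matrix.mulVec_single_one]; rfl
    refine (e _).trans ?_
    rw [← Matrix.mulVec_mulVec, e0, single_sumElim, lift_inr_tp, lift_inl_tp]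
    simp only [tp, Matrix.mulVec_single_one]
    rfl
  have hs := ofReal_inv_sqrt_two_sq
  set s : ℂ := ((1 / √2 : ℝ) : ℂ) with hsdef
  have hV₁val : ∀ y : Fin n ⊕ Fin 1 → Bool, V₁ y (fun _ => false) =
      ∑ w : Fin n → Bool, (∏ i, hMat (y (Sum.inl i)) (w i)) *
        (sgn (y (Sum.inr 0) && decide (weight w = k)) *
          (s ^ n * rotMat p₀ p₁ (y (Sum.inr 0)) false)) := by
    intro y
    have e1 : V₁ y (fun _ => false) =
        (QC.hInit *ᵥ fun z => (diagonal D * QC.loc u) z fun _ => false) y := rfl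
    rw [e1, QC.hInit, loc_elim_one, lift_mulVec]
    refine Finset.sum_congr rfl fun w _ => ?_
    have h1 : Function.extend (Function.Embedding.inl : Fin n ↪ Fin n ⊕ Fin 1) w y ∘ Sum.inl = w :=
      extend_comp (Function.Embedding.inl : Fin n ↪ Fin n ⊕ Fin 1) w y
    have h2 : Function.extend (Function.Embedding.inl : Fin n ↪ Fin n ⊕ Fin 1) w y (Sum.inr 0) =
        y (Sum.inr 0) := extend_off _ w y (Sum.inr 0) fun j hj => by cases hj
    have h3 : ∀ i, Function.extend (Function.Embedding.inl : Fin n ↪ Fin n ⊕ Fin 1) w y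
        (Sum.inl i) = w i := fun i => congrFun h1 i
    rw [Matrix.diagonal_mul]
    simp only [D, cPhase, h1, h2, h3, QC.loc, Fintype.prod_sum_type, u, Sum.elim_inl, Sum.elim_inr,
      Finset.univ_unique, Finset.prod_singleton, Fin.default_eq_zero, hMat, Bool.and_false]
    simp only [sgn, Bool.false_eq_true, if_false, mul_one, Finset.prod_const, Finset.card_univ,
      Fintype.card_fin]
    rfl
  have hV₂val : V₂ (fun _ => false) (fun _ => false) = q₀ := by
    simp [V₂, QC.loc, rotMat]
  have hsn : s ^ n * s ^ n * 2 ^ n = 1 := by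
    rw [← mul_pow, ← mul_pow, hs]; norm_num
  have hsn' : s ^ n * s ^ n = 1 / 2 ^ n := by
    rw [eq_div_iff (pow_ne_zero _ two_ne_zero), hsn]
  refine ⟨_, hV, ?_, ?_⟩
  · rw [hval]
    change V₁ (fun _ => false) _ * V₂ (fun _ => false) _ = _
    rw [hV₂val, hV₁val]
    simp only [hMat, Bool.false_and, sgn, Bool.false_eq_true, if_false, mul_one, one_mul,
      Finset.prod_const, Finset.card_univ, Fintype.card_fin, rotMat, Finset.sum_const,
      nsmul_eq_mul, Fintype.card_pi, Fintype.card_bool, Nat.cast_pow, Nat.cast_ofNat, ← hsdef]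
    linear_combination (p₀ : ℂ) * q₀ * hsn
  · rw [hval]
    change V₁ (fun _ => true) _ * V₂ (fun _ => false) _ = _
    rw [hV₂val, hV₁val]
    simp only [hMat, Bool.true_and, rotMat, Bool.false_eq_true, if_false, if_true, ← hsdef,
      Finset.prod_mul_distrib, Finset.prod_const, Finset.card_univ, Fintype.card_fin]
    have e : ∀ w : Fin n → Bool, s ^ n * (∏ i, sgn (w i)) *
        (sgn (decide (weight w = k)) * (s ^ n * (p₁ : ℂ))) =
        (s ^ n * s ^ n * p₁) * ((∏ i, sgn (w i)) * sgn (decide (weight w = k))) :=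
      fun w => by ring
    simp only [e]
    rw [← Finset.mul_sum, sum_prod_sgn_weight hn, hsn']
    ring

theorem two_pow_le_mul_choose (n : ℕ) : 2 ^ n ≤ (n + 1) * n.choose (n / 2) := by
  rw [← Nat.sum_range_choose, ← Finset.card_range (n + 1), ← smul_eq_mul, Finset.card_range]
  have := Finset.sum_le_card_nsmul (Finset.range (n + 1)) n.choose (n.choose (n / 2))
    fun k _ => Nat.choose_le_middle k n
  simpa using this

/-- With k = n/2 the amplitude β at 1ⁿ available from `Impl.weakCat` satisfies β² ≥ 4/(n+1)², since
the middle binomial coefficient is at least 2ⁿ/(n+1). The hypothesis on `B` then gives B² ≤ 3β²,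
which leaves room to tune the two amplitudes to A/2 and B/2, of total weight 1/4, for `Impl.grover`.
-/
theorem Impl.catRow {n : ℕ} (hn : 1 ≤ n) {A B : ℝ} (hA : 0 < A) (hAB : A ^ 2 + B ^ 2 = 1)
    (hB : B ^ 2 * (n + 1) ^ 2 ≤ 12) :
    ∃ U : Op (Row n), Impl QTC 45 (33 * n + 57) U ∧
      U (fun _ => false) (fun _ => false) = -A ∧
      ∀ y, y ≠ (fun _ => false) → y ≠ Row.ones n → U y (fun _ => false) = 0 := by
  set β : ℝ := -2 * (-1) ^ (n / 2) * (n.choose (n / 2) : ℝ) / 2 ^ n with hβ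
  have hβ2 : β ^ 2 = 4 * ((n.choose (n / 2) : ℝ) / 2 ^ n) ^ 2 := by
    rw [hβ]
    have : ((-1 : ℝ) ^ (n / 2)) ^ 2 = 1 := by rw [← pow_mul, mul_comm, pow_mul]; simp
    calc _ = 4 * ((-1 : ℝ) ^ (n / 2)) ^ 2 * ((n.choose (n / 2) : ℝ) / 2 ^ n) ^ 2 := by ring
      _ = _ := by rw [this]; ring
  have hc : 1 ≤ (n + 1) * ((n.choose (n / 2) : ℝ) / 2 ^ n) := by
    rw [← mul_div_assoc, le_div_iff₀ (by positivity), one_mul]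
    exact_mod_cast two_pow_le_mul_choose n
  have hβ4 : 4 ≤ (n + 1) ^ 2 * β ^ 2 := by
    rw [hβ2]
    nlinarith
  have hβ0 : β ≠ 0 := by
    intro h
    rw [h] at hβ4
    norm_num at hβ4
  have hβpos : 0 < β ^ 2 := by positivity
  have hBβ : B ^ 2 ≤ 3 * β ^ 2 := by
    have h1 : (0 : ℝ) < (n + 1) ^ 2 := by positivity
    nlinarith
  -- The rotations exist because (A/2)² ≤ 1/4 and (B/(2β))² ≤ 3/4; multiplying the second amplitude
  -- by β gives B/2.
  obtain ⟨p₀, p₁, q₀, q₁, hp, hq, h0, h1⟩ := exists_rotations (a := A / 2) (b := B / (2 * β))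
    (by positivity) (by
      have : (B / (2 * β)) ^ 2 ≤ 3 / 4 := by
        rw [div_pow, div_le_iff₀ (by positivity)]
        nlinarith
      nlinarith [sq_nonneg B])
  obtain ⟨V, hV, hV0, hV1⟩ := Impl.weakCat hn (n / 2) hp hq
  have hV0' : V (fun _ => false) (fun _ => false) = ((A / 2 : ℝ) : ℂ) := by
    rw [hV0, ← h0]; push_cast; ring
  have hV1' : V (Row.ones n) (fun _ => false) = ((B / 2 : ℝ) : ℂ) := by
    have : B / 2 = β * (p₁ * q₀) := by rw [h1]; field_simp
    rw [hV1, this, hβ]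
    push_cast
    ring
  have hne : (fun _ => false : Row n → Bool) ≠ Row.ones n := fun h => by
    have := congrFun h (Sum.inl (Sum.inr 0))
    simp [Row.ones] at this
  obtain ⟨U, hU, hUy⟩ := Impl.grover hV hne (by
    rw [hV0', hV1', Complex.norm_real, Complex.norm_real, Real.norm_eq_abs, Real.norm_eq_abs,
      sq_abs, sq_abs]
    linear_combination hAB / 4)
  refine ⟨U, hU.mono le_rfl ?_, ?_, fun y h0 h1 => ?_⟩
  · simp only [Fintype.card_sum, Fintype.card_fin]
    omega
  · rw [hUy, if_pos (Or.inl rfl), hV0']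
    push_cast
    ring
  · rw [hUy, if_neg (by simp [h0, h1])]

/-! ### Nekomata from threshold gates -/

/-- `A ^ (2 m) = 1/2` has a solution with `1 - A² ≤ 1/m`. -/
theorem exists_amplitude {m : ℕ} (hm : 1 ≤ m) :
    ∃ A B : ℝ, 0 < A ∧ A ^ 2 + B ^ 2 = 1 ∧ B ^ 2 * m ≤ 1 ∧ (A ^ 2) ^ m = 1 / 2 := by
  have hm0 : (0 : ℝ) < m := by exact_mod_cast hm
  set q : ℝ := (1 / 2 : ℝ) ^ (1 / m : ℝ) with hq
  have hqpos : 0 < q := by positivity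
  have hqm : q ^ m = 1 / 2 := by
    rw [hq, ← Real.rpow_natCast, ← Real.rpow_mul (by norm_num), one_div_mul_cancel hm0.ne',
      Real.rpow_one]
  have hq1 : q ≤ 1 := Real.rpow_le_one (by norm_num) (by norm_num) (by positivity)
  refine ⟨√q, √(1 - q), Real.sqrt_pos.2 hqpos, ?_, ?_, ?_⟩
  · rw [Real.sq_sqrt hqpos.le, Real.sq_sqrt (by linarith)]; ring
  · rw [Real.sq_sqrt (by linarith)]
    -- Bernoulli applied to 1/q: 2 = q^(-m) ≥ 1 + m(1/q - 1), so m(1 - q) ≤ m(1/q - 1) ≤ 1.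
    have h1 := one_add_mul_le_pow (a := q⁻¹ - 1) (by
      have : 0 < q⁻¹ := by positivity
      linarith) m
    rw [add_sub_cancel, inv_pow, hqm] at h1
    have h2 : (q⁻¹ - 1) * q = 1 - q := by field_simp
    have h3 : 0 ≤ q⁻¹ - 1 := by
      have := one_le_inv_iff₀.2 ⟨hqpos, hq1⟩
      linarith
    nlinarith [mul_nonneg hm0.le h3]
  · rw [Real.sq_sqrt hqpos.le, hqm]

/-- Row data qubits and their targets. -/
abbrev Cats (n m : ℕ) : Type := Fin n ⊕ Σ _ : Fin m, Row n

/-- The targets are flipped by the disjunctions of the columns. -/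
def orMap (n m : ℕ) (x : Cats n m → Bool) : Cats n m → Bool :=
  Sum.elim (fun i => xor (x (Sum.inl i))
    (threshold m 1 fun r => x (Sum.inr ⟨r, Sum.inl (Sum.inl i)⟩))) (x ∘ Sum.inr)

theorem orMap_involutive (n m : ℕ) : Function.Involutive (orMap n m) := by
  intro x
  funext i
  rcases i with i | i <;> simp [orMap]

theorem threshold_one (m : ℕ) (x : Bits m) : threshold m 1 x = true ↔ ∃ r, x r = true := by
  simp [threshold, weight, Nat.one_le_iff_ne_zero, Finset.filter_eq_empty_iff]

/-- A disjunction is the threshold of weight 1, and distinct columns use disjoint qubits, so a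
single layer suffices. -/
theorem Impl.funM_orMap (n m : ℕ) : Impl QTC 1 n (funM (orMap n m)) := by
  have h1 : Impl QTC 1 1 (funM (cXor (threshold m 1))) := by
    rw [← lift_oracleGate]
    exact (Impl.gate (threshold_mem_QTC m 1)).lift _
  let w : (Σ _ : Fin n, Fin m ⊕ Fin 1) ↪ Cats n m :=
    ⟨fun i => Sum.elim (fun r => Sum.inr ⟨r, Sum.inl (Sum.inl i.1)⟩) (fun _ => Sum.inl i.1) i.2, by
      rintro ⟨i, r | r⟩ ⟨j, s | s⟩ h
      · simp only [Sum.elim_inl, Sum.inr.injEq, Sigma.mk.injEq, heq_eq_eq, Sum.inl.injEq] at h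
        rw [h.1, h.2]
      · simp at h
      · simp at h
      · simp only [Sum.elim_inr, Sum.inl.injEq] at h
        obtain rfl := Subsingleton.elim r s
        rw [h]⟩
  have h2 := (Impl.par fun _ : Fin n => h1).lift w
  rw [tens_funM, lift_funM] at h2
  convert h2.mono (s' := n) le_rfl (by simp) using 2
  funext x i
  have hw1 : ∀ i r, w ⟨i, Sum.inl r⟩ = Sum.inr ⟨r, Sum.inl (Sum.inl i)⟩ := fun _ _ => rfl
  have hw2 : ∀ i r, w ⟨i, Sum.inr r⟩ = Sum.inl i := fun _ _ => rfl
  rcases i with i | ⟨r, (i | i) | i⟩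
  · rw [← hw2 i 0, w.injective.extend_apply]
    rfl
  · rw [← hw1 i r, w.injective.extend_apply]
    rfl
  · rw [extend_off]
    · rfl
    · rintro ⟨j, s | s⟩ hj <;> simp [hw1, hw2] at hj
  · rw [extend_off]
    · rfl
    · rintro ⟨j, s | s⟩ hj <;> simp [hw1, hw2] at hj

/-- In the support each row is zero or all ones on its data. Either every row is zero, with
probability (A²)^m = 1/2, or one row of ones makes every column OR equal to 1. The choice m = (n+1)²
makes B² ≤ 1/m small enough for `Impl.catRow`. -/
theorem Impl.nekomata {n : ℕ} (hn : 1 ≤ n) :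
    ∃ m, m = (n + 1) ^ 2 ∧ ∃ W : Op (Cats n m), Impl QTC 46 (m * (33 * n + 57) + n) W ∧
      (∀ y, W y (fun _ => false) ≠ 0 → y = (fun _ => false) ∨ ∀ i, y (Sum.inl i) = true) ∧
      ‖W (fun _ => false) fun _ => false‖ ^ 2 = 1 / 2 := by
  obtain ⟨m, hm⟩ : ∃ m, m = (n + 1) ^ 2 := ⟨_, rfl⟩
  refine ⟨m, hm, ?_⟩
  obtain ⟨A, B, hA, hAB, hB, hAm⟩ := exists_amplitude (m := m) (hm ▸ Nat.one_le_pow _ _ (by omega))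
  obtain ⟨U, hU, hU0, hU1⟩ := Impl.catRow hn hA hAB (by
    have : ((m : ℕ) : ℝ) = ((n : ℝ) + 1) ^ 2 := by rw [hm]; push_cast; ring
    rw [this] at hB
    linarith)
  have hW := (Impl.funM_orMap n m).mul ((Impl.par fun _ : Fin m => hU).lift
    (Function.Embedding.inr : _ ↪ Cats n m))
  have hval : ∀ y, (funM (orMap n m) * QC.lift (Function.Embedding.inr : _ ↪ Cats n m)
      (tens fun _ : Fin m => U)) y (fun _ => false) =
      if (fun i => orMap n m y (Sum.inl i)) = (fun _ => false) then
        ∏ r, U (fun j => y (Sum.inr ⟨r, j⟩)) (fun _ => false) else 0 := by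
    intro y
    refine (funM_mul_apply (orMap_involutive n m) _ _ _).trans ?_
    refine (lift_inr_apply _ _ _).trans ?_
    rfl
  refine ⟨_, hW.mono (by omega) ?_, fun y hy => ?_, ?_⟩
  · simp only [Finset.sum_const, Finset.card_univ, Fintype.card_fin, smul_eq_mul]
    omega
  · have hy' := hval y ▸ hy
    have hor : (fun i => orMap n m y (Sum.inl i)) = fun _ => false := by
      by_contra h
      rw [if_neg h] at hy'
      exact hy' rfl
    rw [if_pos hor, Finset.prod_ne_zero_iff] at hy'
    have hrow : ∀ r, (fun j => y (Sum.inr ⟨r, j⟩)) = (fun _ => false) ∨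
        (fun j => y (Sum.inr ⟨r, j⟩)) = Row.ones n := by
      intro r
      by_contra h
      push Not at h
      exact hy' r (Finset.mem_univ r) (hU1 _ h.1 h.2)
    have hi : ∀ i, y (Sum.inl i) =
        threshold m 1 fun r => y (Sum.inr ⟨r, Sum.inl (Sum.inl i)⟩) := by
      intro i
      have := congrFun hor i
      simpa [orMap] using this
    by_cases hall : ∀ r, (fun j => y (Sum.inr ⟨r, j⟩)) = fun _ => false
    · left
      funext k
      rcases k with i | ⟨r, j⟩
      · rw [hi, ← Bool.not_eq_true, threshold_one]
        rintro ⟨r, hr⟩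
        have := congrFun (hall r) (Sum.inl (Sum.inl i))
        simp [this] at hr
      · exact congrFun (hall r) j
    · right
      push Not at hall
      obtain ⟨r, hr⟩ := hall
      intro i
      rw [hi, threshold_one]
      exact ⟨r, congrFun ((hrow r).resolve_left hr) (Sum.inl (Sum.inl i))⟩
  · have hor : (fun i => orMap n m (fun _ => false) (Sum.inl i)) = fun _ => false := by
      funext i
      rw [← Bool.not_eq_true]
      simp only [orMap, Sum.elim_inl, Bool.false_xor, threshold_one]
      simp
    have e := (hval fun _ => false).trans (if_pos hor)
    refine (congrArg (fun z : ℂ => ‖z‖ ^ 2) e).trans ?_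
    simp only [hU0, Finset.prod_const, Finset.card_univ, Fintype.card_fin, norm_pow, norm_neg,
      Complex.norm_real, Real.norm_eq_abs]
    rw [← pow_mul, mul_comm, pow_mul, sq_abs, hAm]

/-! ### Parity and fanout from threshold gates -/

theorem sum_norm_sq_col {ι : Type} [Fintype ι] [DecidableEq ι] {W : Op ι} (h : Wᴴ * W = 1)
    (x : ι → Bool) : ∑ y, ((‖W y x‖ ^ 2 : ℝ) : ℂ) = 1 := by
  have := congrFun (congrFun h x) x
  rw [Matrix.mul_apply, Matrix.one_apply_eq] at this
  rw [← this]
  refine Finset.sum_congr rfl fun y _ => ?_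
  rw [Matrix.conjTranspose_apply]
  push_cast
  exact (Complex.conj_mul' (W y x)).symm

/-- `D` acts on the nekomata as 1 on the zero branch and as (-1)^|x| on the branch of ones. Since
the branches have equal weight, the state is fixed for even |x| and sent to an orthogonal one for
odd |x|, so `Impl.test` applies. -/
theorem Impl.cPhase_par_QTC {n : ℕ} (hn : 1 ≤ n) :
    Impl QTC 193 (1000 * (n + 1) ^ 3) (diagonal (cPhase (QC.par : (Fin n → Bool) → Bool))) := by
  obtain ⟨m, hm, W, hW, hsupp, hhalf⟩ := Impl.nekomata hn
  let I := Fin n ⊕ Fin 1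
  let D : (I ⊕ Cats n m → Bool) → ℂ := fun z =>
    ∏ i : Fin n, sgn (z (Sum.inl (Sum.inl i)) && z (Sum.inr (Sum.inl i)))
  have hD : Impl QTC 1 n (diagonal D) := by
    have hcz : Impl QTC 1 1 (diagonal fun x : Fin 2 → Bool => sgn (x 0 && x 1)) :=
      Impl.diagGate (fun U => Or.inl (Or.inr rfl)) fun x => by rw [star_sgn, sgn_mul_self]
    let w : (Σ _ : Fin n, Fin 2) ↪ I ⊕ Cats n m :=
      ⟨fun i => if i.2 = 0 then Sum.inl (Sum.inl i.1) else Sum.inr (Sum.inl i.1), by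
        rintro ⟨i, r⟩ ⟨j, s⟩ h
        fin_cases r <;> fin_cases s <;> simp at h ⊢
        · exact Sum.inl_injective h
        · exact h⟩
    have h2 := (Impl.par fun _ : Fin n => hcz).lift w
    rw [tens_diagonal, lift_diagonal] at h2
    refine Impl.mono (M := diagonal D) ?_ le_rfl (s := ∑ _ : Fin n, 1) (by simp)
    exact h2
  have hR : Impl QTC 5 (4 * (1 + Fintype.card (Cats n m)) + 1)
      (diagonal fun z : I ⊕ Cats n m → Bool =>
        if (z ∘ Sum.inl) (Sum.inr 0) = true ∧ z ∘ Sum.inr = (fun _ => false) then (-1 : ℂ)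
        else 1) := by
    have h := Impl.ptPhase_QTC (Sum.elim (fun _ => true) fun _ => false : Fin 1 ⊕ Cats n m → Bool)
    refine h.controlledReflection.mono le_rfl ?_
    rw [Fintype.card_sum, Fintype.card_fin]
  have hsum := sum_norm_sq_col hW.unitary fun _ => false
  have ht := Impl.test adjClosed_QTC (f := fun x : I → Bool => !QC.par (x ∘ Sum.inl))
    (g := fun x => x (Sum.inr 0)) hW hD hR
    (by
      intro x hx y
      by_cases hy : W y (fun _ => false) = 0
      · rw [hy, mul_zero]
      · have : D (Sum.elim x y) = 1 := by
          rcases hsupp y hy with rfl | hy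
          · simp [D, sgn]
          · simp only [D, Sum.elim_inl, Sum.elim_inr, hy, Bool.and_true]
            have := sgn_par (x ∘ Sum.inl)
            simp only [Function.comp] at this
            refine this.symm.trans ?_
            have : QC.par (x ∘ Sum.inl) = false := by simpa using hx
            refine (congrArg sgn this).trans ?_
            simp [sgn]
        rw [this, one_mul])
    (by
      intro x hx
      have hpar : QC.par (x ∘ Sum.inl) = true := by simpa using hx
      -- For odd |x| every string of the support except zero gets the sign -1. The zero string has
      -- weight 1/2 = 1 - 1/2, so it too fits the uniform expression, whose sum is 1 - 1 = 0.
      have e : ∀ y, star (W y fun _ => false) * (D (Sum.elim x y) * W y fun _ => false) =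
          (if y = (fun _ => false) then 1 else 0) -
            ((‖W y fun _ => false‖ ^ 2 : ℝ) : ℂ) := by
        intro y
        have hn : star (W y fun _ => false) * (D (Sum.elim x y) * W y fun _ => false) =
            D (Sum.elim x y) * ((‖W y fun _ => false‖ ^ 2 : ℝ) : ℂ) := by
          push_cast
          rw [← Complex.conj_mul']
          change (starRingEnd ℂ) _ * _ = _
          ring
        rw [hn]
        by_cases hy : y = fun _ => false
        · subst hy
          have : D (Sum.elim x fun _ => false) = 1 := by simp [D, sgn]
          rw [this, hhalf, if_pos rfl]
          norm_num
        · rw [if_neg hy]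
          by_cases hy0 : W y (fun _ => false) = 0
          · simp [hy0]
          · have h1 := (hsupp y hy0).resolve_left hy
            have : D (Sum.elim x y) = -1 := by
              simp only [D, Sum.elim_inl, Sum.elim_inr, h1, Bool.and_true]
              have := sgn_par (x ∘ Sum.inl)
              rw [hpar] at this
              exact this.symm.trans (by simp [sgn])
            rw [this]; ring
      simp only [e, Finset.sum_sub_distrib, hsum]
      simp)
  -- The test marks even parity, the case of the fixed state; a Z gate on the control changes this
  -- to odd parity.
  have hZ : Impl QTC 1 1 (diagonal fun x : I → Bool => sgn (x (Sum.inr 0))) := by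
    have h : Impl QTC 1 1 (diagonal fun x : Fin 1 → Bool => sgn (x 0)) :=
      Impl.diagGate (fun U => Or.inl (Or.inl rfl)) fun x => by rw [star_sgn, sgn_mul_self]
    have := h.lift (Function.Embedding.inr : Fin 1 ↪ I)
    rwa [lift_diagonal] at this
  have hall := hZ.mul ht
  rw [Matrix.diagonal_mul_diagonal] at hall
  refine (congrArg (fun d => Impl QTC 193 (1000 * (n + 1) ^ 3) (diagonal d))
    (funext fun x => ?_)).mp (hall.mono (d' := 193) (s' := 1000 * (n + 1) ^ 3) (by norm_num) ?_)
  · simp only [cPhase]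
    cases x (Sum.inr 0) <;> cases QC.par (x ∘ Sum.inl) <;> simp [sgn]
  · simp only [Fintype.card_sum, Fintype.card_sigma, Fintype.card_fin, Finset.sum_const,
      Finset.card_univ, smul_eq_mul, hm]
    clear * -
    have h1 := Nat.zero_le (n ^ 3)
    have h2 := Nat.zero_le (n ^ 2)
    have h3 := Nat.zero_le n
    ring_nf
    linarith

theorem Impl.fanoutGate_QTC {n : ℕ} (hn : 1 ≤ n) :
    Impl QTC 195 (1002 * (n + 1) ^ 3) ((fanoutGate n).2.1 : Op (Fin (n + 1))) :=
  (Impl.fanoutGate_of_cPhase_par oneQubit_subset_QTC (Impl.cPhase_par_QTC hn)).mono le_rfl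
    (by nlinarith [sq_nonneg n, Nat.zero_le (n ^ 3)])

/-- `QAC_wf` circuits are simulated by `QTC` circuits. -/
theorem impl_QAC_of_QTC : ∀ g ∈ QACwf,
    Impl QTC 195 ((1002 * Polynomial.X ^ 3 + 1 : Polynomial ℕ).eval g.1) (g.2.1 : Op (Fin g.1)) := by
  rintro ⟨k, U⟩ ((h | ⟨n, hn, h⟩) | ⟨n, hn, h⟩)
  · exact (Impl.gate (oneQubit_subset_QTC h)).mono (by norm_num) (by simp)
  · rw [h]
    have : oracleGate (andFun n) ∈ QTC := by
      rw [andFun_eq_threshold]; exact threshold_mem_QTC n n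
    exact (Impl.gate this).mono (by norm_num) (by simp)
  · rw [h]
    refine (Impl.fanoutGate_QTC hn).mono le_rfl ?_
    simp [fanoutGate, permGate]

/-! ### Commuting diagonal operators in parallel, using fanout -/

section copies

variable {S : Set Gate} {ι : Type} [Fintype ι] [DecidableEq ι]

/-- The first register is added to all the other ones. -/
def copyMap (ι : Type) (R : ℕ) (x : ι ⊕ (Σ _ : Fin R, ι) → Bool) : ι ⊕ (Σ _ : Fin R, ι) → Bool :=
  Sum.elim (x ∘ Sum.inl) fun i => xor (x (Sum.inr i)) (x (Sum.inl i.2))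

theorem copyMap_involutive (R : ℕ) : Function.Involutive (copyMap ι R) := by
  intro x
  funext i
  rcases i with i | i <;> simp [copyMap]

theorem Impl.funM_copyMap {R : ℕ} (hR : 1 ≤ R) (hS : fanoutGates ⊆ S) :
    Impl S 1 (Fintype.card ι) (funM (copyMap ι R)) := by
  have h1 : Impl S 1 1 (funM (fanMap : (Fin R ⊕ Fin 1 → Bool) → _)) :=
    Impl.fanMap_of_fanoutGate (hS ⟨R, hR, rfl⟩)
  let w : (Σ _ : ι, Fin R ⊕ Fin 1) ↪ ι ⊕ (Σ _ : Fin R, ι) :=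
    ⟨fun i => Sum.elim (fun r => Sum.inr ⟨r, i.1⟩) (fun _ => Sum.inl i.1) i.2, by
      rintro ⟨i, r | r⟩ ⟨j, s | s⟩ h
      · simp only [Sum.elim_inl, Sum.inr.injEq, Sigma.mk.injEq, heq_eq_eq] at h
        rw [h.1, h.2]
      · simp at h
      · simp at h
      · simp only [Sum.elim_inr, Sum.inl.injEq] at h
        obtain rfl := Subsingleton.elim r s
        rw [h]⟩
  have h2 := (Impl.par fun _ : ι => h1).lift w
  rw [tens_funM, lift_funM] at h2
  convert h2.mono (s' := Fintype.card ι) le_rfl (by simp) using 2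
  funext x i
  have hw1 : ∀ i r, w ⟨i, Sum.inl r⟩ = Sum.inr ⟨r, i⟩ := fun _ _ => rfl
  have hw2 : ∀ i r, w ⟨i, Sum.inr r⟩ = Sum.inl i := fun _ _ => rfl
  rcases i with i | ⟨r, i⟩
  · rw [← hw2 i 0, w.injective.extend_apply]
    rfl
  · rw [← hw1 i r, w.injective.extend_apply]
    rfl

/-- Copy the basis string into `R` registers by fanout, apply `D r` to the `r`-th copy, all at once,
and uncopy. Diagonal operators leave the copies intact, so the uncopying cleans them and the phases
multiply. -/
theorem Impl.prod_diagonal_fin (hS : fanoutGates ⊆ S) {R d s : ℕ} {D : Fin R → (ι → Bool) → ℂ}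
    (h : ∀ r, Impl S d s (diagonal (D r))) :
    Impl S (d + 2) (R * Fintype.card ι + 2 * Fintype.card ι + R * s)
      (diagonal fun x => ∏ r, D r x) := by
  -- Fanout gates need at least one target, so the empty product is treated apart.
  rcases Nat.eq_zero_or_pos R with rfl | hR
  · simpa using (Impl.one (S := S) (ι := ι)).mono (d' := d + 2) (s' := 2 * Fintype.card ι)
      (by omega) (by omega)
  · have hK := Impl.funM_copyMap (ι := ι) hR hS
    have hD := (Impl.par h).lift (Function.Embedding.inr : _ ↪ ι ⊕ (Σ _ : Fin R, ι))
    rw [tens_diagonal, lift_diagonal] at hD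
    have hKDK := (hK.mul hD).mul hK
    rw [funM_conj_diagonal (copyMap_involutive R)] at hKDK
    have h := hKDK.anc (diagonal_mul_funM _ _)
    refine (congrArg (fun d' => Impl S (d + 2) _ (diagonal d')) (funext fun x => ?_)).mp
      (h.mono (d' := d + 2) (by omega) ?_)
    · simp only [Function.comp, copyMap, pad, Sum.elim_inr, Sum.elim_inl, Bool.false_xor]
      rfl
    · simp only [Fintype.card_sigma, Finset.sum_const, Finset.card_univ, Fintype.card_fin,
        smul_eq_mul]
      omega

theorem Impl.prod_diagonal (hS : fanoutGates ⊆ S) {R : Type} [Fintype R] {d s : ℕ}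
    {D : R → (ι → Bool) → ℂ} (h : ∀ r, Impl S d s (diagonal (D r))) :
    Impl S (d + 2) (Fintype.card R * Fintype.card ι + 2 * Fintype.card ι + Fintype.card R * s)
      (diagonal fun x => ∏ r, D r x) := by
  have := Impl.prod_diagonal_fin hS fun r => h ((Fintype.equivFin R).symm r)
  convert this using 3 with x
  exact (Equiv.prod_comp (Fintype.equivFin R).symm fun r => D r x).symm

end copies

/-! ### Phases at a point, from parities -/

theorem fanoutGates_subset_QNCwf : fanoutGates ⊆ QNCwf := fun _ h => Or.inr h

/-- Compute the parity into an ancilla by fanout between Hadamard gates, apply the one-qubit phase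
`u` there, and uncompute. -/
theorem Impl.parPhase_QNC {n : ℕ} (hn : 1 ≤ n) {u : ℂ} (hu : star u * u = 1) :
    Impl QNCwf 11 (8 * n + 12)
      (diagonal fun x : Fin n → Bool => if QC.par x = true then u else 1) := by
  have h1 : Impl QNCwf 5 (4 * n + 5) (funM (cXor (QC.par : (Fin n → Bool) → Bool))) := by
    rw [funM_cXor_eq, diagonal_cPhase_par_eq]
    have hI := Impl.hInit (ι := Fin n) oneQubit_subset_QNCwf
    have hL := Impl.hLast (ι := Fin n) oneQubit_subset_QNCwf
    have hf : Impl QNCwf 1 1 (funM (fanMap : (Fin n ⊕ Fin 1 → Bool) → _)) :=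
      Impl.fanMap_of_fanoutGate (fanoutGates_subset_QNCwf ⟨n, hn, rfl⟩)
    refine ((hL.mul ((hI.mul hf).mul hI)).mul hL).mono (by omega) ?_
    rw [Fintype.card_fin]
    omega
  have h2 : Impl QNCwf 1 1 (diagonal fun x : Fin 1 → Bool => if x 0 = true then u else 1) :=
    Impl.diagGate (fun U => oneQubit_subset_QNCwf rfl) fun x => by
      by_cases h : x 0 = true <;> simp [h]
      exact hu
  have h3 := h2.lift (Function.Embedding.inr : Fin 1 ↪ Fin n ⊕ Fin 1)
  rw [lift_diagonal] at h3
  have h4 := (h1.mul h3).mul h1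
  rw [funM_conj_diagonal (cXor_involutive _)] at h4
  refine (congrArg (fun d => Impl QNCwf 11 (8 * n + 12) (diagonal d)) (funext fun x => ?_)).mp
    (h4.anc (diagonal_mul_funM _ _) |>.mono (d' := 11) (s' := 8 * n + 12) (by omega) ?_)
  · simp [cXor, pad]
  · rw [Fintype.card_fin]
    omega

-- The quantity (1 - ∏ sgn)/2 is the parity of the bits in `s` as a number 0 or 1, so this is a
-- parity phase with u = e^(iθ).
open Complex in
theorem Impl.setPhase_QNC {ι : Type} [Fintype ι] [DecidableEq ι] (s : Finset ι) (θ : ℝ) :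
    Impl QNCwf 11 (8 * Fintype.card ι + 12)
      (diagonal fun x : ι → Bool => cexp (θ * I * ((1 - ∏ i ∈ s, sgn (x i)) / 2))) := by
  rcases s.eq_empty_or_nonempty with rfl | hs
  · simpa using (Impl.one (S := QNCwf) (ι := ι)).mono (d' := 11)
      (s' := 8 * Fintype.card ι + 12) (by omega) (by omega)
  · have hu : star (cexp (θ * I)) * cexp (θ * I) = 1 := by
      change (starRingEnd ℂ) _ * _ = _
      rw [Complex.conj_mul', Complex.norm_exp_ofReal_mul_I]
      simp
    have h := (Impl.parPhase_QNC (n := s.card) hs.card_pos hu).lift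
      (s.equivFin.symm.toEmbedding.trans (Function.Embedding.subtype _))
    rw [lift_diagonal] at h
    refine (congrArg (fun d => Impl QNCwf 11 (8 * Fintype.card ι + 12) (diagonal d))
      (funext fun x => ?_)).mp (h.mono le_rfl (by
        have := Finset.card_le_univ s
        omega))
    have e : ∏ i ∈ s, sgn (x i) = sgn (QC.par (x ∘
        (s.equivFin.symm.toEmbedding.trans (Function.Embedding.subtype _)))) := by
      rw [sgn_par, ← Finset.prod_coe_sort]
      exact (Equiv.prod_comp s.equivFin.symm fun i => sgn (x i)).symm
    rw [e]
    generalize QC.par (x ∘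
      (s.equivFin.symm.toEmbedding.trans (Function.Embedding.subtype fun i => i ∈ s))) = b
    cases b <;> simp [sgn]

theorem sum_powerset_sgn {ι : Type} [Fintype ι] [DecidableEq ι] (x : ι → Bool) :
    ∑ s : Finset ι, (-1 : ℂ) ^ s.card * ∏ i ∈ s, sgn (x i) = ∏ i, (1 - sgn (x i)) := by
  have := Finset.prod_add (fun i => -sgn (x i)) (fun _ => 1) Finset.univ
  simp only [Finset.prod_const_one, mul_one, Finset.prod_neg, Finset.powerset_univ] at this
  rw [← this]
  exact Finset.prod_congr rfl fun i _ => by ring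

-- The indicator of the all-ones string is the combination 2^(-r) Σ_s (-1)^|s| ∏_{i∈s} sgn(xᵢ) of
-- parity characters, so π times it is a sum of angles depending on one parity each, and these
-- phases are applied in parallel. The size is exponential in the number of qubits, which is
-- harmless for logarithmically many.
open Complex in
theorem Impl.ptPhase_QNC {ι : Type} [Fintype ι] [DecidableEq ι] [Nonempty ι] (z : ι → Bool) :
    Impl QNCwf 15 (2 ^ Fintype.card ι * (9 * Fintype.card ι + 12) + 4 * Fintype.card ι)
      (diagonal (QC.ptPhase z)) := by
  set r := Fintype.card ι with hr
  have h := Impl.prod_diagonal (ι := ι) fanoutGates_subset_QNCwf fun s : Finset ι =>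
    -- The angles come from replacing each character by its difference from its value at zero. The
    -- resulting correction is the indicator at the zero string, which vanishes as `ι` is nonempty.
    Impl.setPhase_QNC s (-(Real.pi * 2 / 2 ^ r * (-1) ^ s.card))
  have h2 : Impl QNCwf 13 (2 ^ r * (9 * r + 12) + 2 * r)
      (diagonal (QC.ptPhase fun _ : ι => true)) := by
    refine (congrArg (fun d => Impl QNCwf 13 (2 ^ r * (9 * r + 12) + 2 * r) (diagonal d))
      (funext fun x => ?_)).mp (h.mono le_rfl ?_)
    · rw [← Complex.exp_sum]
      have e : ∑ s : Finset ι, (((-(Real.pi * 2 / 2 ^ r * (-1) ^ s.card) : ℝ) : ℂ) * I *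
          ((1 - ∏ i ∈ s, sgn (x i)) / 2)) =
          Real.pi * I / 2 ^ r * (∏ i, (1 - sgn (x i)) - ∏ _i : ι, (1 - sgn false)) := by
        rw [← sum_powerset_sgn x, ← sum_powerset_sgn (ι := ι) fun _ => false, ← Finset.sum_sub_distrib,
          Finset.mul_sum]
        refine Finset.sum_congr rfl fun s _ => ?_
        push_cast
        simp only [sgn, Bool.false_eq_true, if_false, Finset.prod_const_one]
        ring
      rw [e]
      have e2 : ∏ i : ι, (1 - sgn false) = 0 := by
        simp [sgn]
      rw [e2, QC.ptPhase]
      by_cases hx : x = fun _ => true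
      · have : ∏ i, (1 - sgn (x i)) = 2 ^ r := by
          rw [hx]; simp [sgn, hr]; norm_num
        rw [if_pos hx, this, sub_zero, div_mul_cancel₀ _ (pow_ne_zero _ two_ne_zero),
          Complex.exp_pi_mul_I]
      · obtain ⟨i, hi⟩ := Function.ne_iff.1 hx
        have : ∏ i, (1 - sgn (x i)) = 0 :=
          Finset.prod_eq_zero (Finset.mem_univ i) (by simp [sgn] at hi ⊢; simp [hi])
        rw [if_neg hx, this]
        simp
    · rw [Fintype.card_finset, ← hr]
      linarith
  exact (h2.ptPhase_of_true oneQubit_subset_QNCwf z).mono le_rfl (by omega)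

/-! ### Threshold gates from fanout gates -/

theorem cast_weight {n : ℕ} (x : Bits n) :
    (weight x : ℂ) = ∑ i, if x i = true then (1 : ℂ) else 0 := by
  rw [weight, Finset.sum_boole]

open Complex in
/-- The rotation of the `l`-th test qubit. -/
theorem exists_rotation_eq_neg_one {t : ℤ} (ht : t ≠ 0) {L : ℕ} (hL : t.natAbs < 2 ^ L) :
    ∃ l : Fin L, cexp (2 * Real.pi * I * t / 2 ^ (l.1 + 1)) = -1 := by
  -- The qubit to choose is the 2-adic valuation `k` of `t`: dividing by 2^(k+1) leaves an odd
  -- multiple of 1/2, hence an odd multiple of πi in the exponent.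
  obtain ⟨k, m, hm, hk⟩ := Nat.exists_eq_two_pow_mul_odd (Int.natAbs_ne_zero.2 ht)
  have hkL : k < L := by
    rw [← Nat.pow_lt_pow_iff_right (a := 2) (by norm_num)]
    refine lt_of_le_of_lt ?_ hL
    rw [hk]
    exact Nat.le_mul_of_pos_right _ hm.pos
  have hodd : ∃ c : ℤ, t = 2 ^ k * (2 * c + 1) := by
    obtain ⟨c, hc⟩ := hm
    rcases Int.natAbs_eq t with h | h
    · exact ⟨c, by rw [h, hk, hc]; push_cast; ring⟩
    · exact ⟨-c - 1, by rw [h, hk, hc]; push_cast; ring⟩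
  obtain ⟨c, rfl⟩ := hodd
  refine ⟨⟨k, hkL⟩, ?_⟩
  have : 2 * Real.pi * I * ((2 ^ k * (2 * c + 1) : ℤ) : ℂ) / 2 ^ (k + 1) =
      Real.pi * I + c * (2 * Real.pi * I) := by
    push_cast
    have : (2 : ℂ) ^ k ≠ 0 := pow_ne_zero _ two_ne_zero
    field_simp
    ring
  rw [this, Complex.exp_add, Complex.exp_int_mul_two_pi_mul_I, Complex.exp_pi_mul_I, mul_one]

open Complex in
/-- The rotation of the test qubits `Fin L` by multiples of `|x| - j`. -/
noncomputable def weightPhase (n L j : ℕ) (z : (Fin n ⊕ Fin 1) ⊕ Fin L → Bool) : ℂ :=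
  ∏ l : Fin L, if z (Sum.inr l) = true then
    cexp (2 * Real.pi * I * ((weight (z ∘ Sum.inl ∘ Sum.inl) : ℤ) - j : ℤ) / 2 ^ (l.1 + 1)) else 1

open Complex in
theorem star_exp_mul_exp (θ : ℝ) : star (cexp (θ * I)) * cexp (θ * I) = 1 := by
  change (starRingEnd ℂ) _ * _ = _
  rw [Complex.conj_mul', Complex.norm_exp_ofReal_mul_I]
  simp

-- The exponent is additive in the bits of `x`: each pair (data bit, test qubit) contributes a
-- two-qubit phase, and the shift by `-j` is a one-qubit phase on each test qubit, indexed by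
-- `none`. All are diagonal and run in parallel.
open Complex in
theorem Impl.weightPhase (n L j : ℕ) :
    Impl QNCwf 3 (((n + 1) * L + 2) * (n + 1 + L) + (n + 1) * L)
      (diagonal (QC.weightPhase n L j)) := by
  let D : Option (Fin n) × Fin L → ((Fin n ⊕ Fin 1) ⊕ Fin L → Bool) → ℂ := fun p z =>
    match p with
    | (none, l) => if z (Sum.inr l) = true then
        cexp (((-(2 * Real.pi * j / 2 ^ (l.1 + 1)) : ℝ) : ℂ) * I) else 1
    | (some i, l) => if z (Sum.inl (Sum.inl i)) = true ∧ z (Sum.inr l) = true then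
        cexp (((2 * Real.pi / 2 ^ (l.1 + 1) : ℝ) : ℂ) * I) else 1
  have hD : ∀ p, Impl QNCwf 1 1 (diagonal (D p)) := by
    rintro ⟨_ | i, l⟩
    · have h : Impl QNCwf 1 1 (diagonal fun x : Fin 1 → Bool => if x 0 = true then
          cexp (((-(2 * Real.pi * j / 2 ^ (l.1 + 1)) : ℝ) : ℂ) * I) else 1) :=
        Impl.diagGate (fun U => oneQubit_subset_QNCwf rfl) fun x => by
          split_ifs
          · exact star_exp_mul_exp _
          · simp
      have := h.lift (⟨fun _ => Sum.inr l, fun _ _ _ => Subsingleton.elim _ _⟩ :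
        Fin 1 ↪ (Fin n ⊕ Fin 1) ⊕ Fin L)
      rw [lift_diagonal] at this
      exact this
    · have h : Impl QNCwf 1 1 (diagonal fun x : Fin 2 → Bool => if x 0 = true ∧ x 1 = true then
          cexp (((2 * Real.pi / 2 ^ (l.1 + 1) : ℝ) : ℂ) * I) else 1) :=
        Impl.diagGate (fun U => Or.inl (Or.inr rfl)) fun x => by
          split_ifs
          · exact star_exp_mul_exp _
          · simp
      have := h.lift (⟨fun k => if k = 0 then Sum.inl (Sum.inl i) else Sum.inr l, fun a b h => by
          fin_cases a <;> fin_cases b <;> simp at h ⊢⟩ : Fin 2 ↪ (Fin n ⊕ Fin 1) ⊕ Fin L)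
      rw [lift_diagonal] at this
      exact this
  have h := Impl.prod_diagonal fanoutGates_subset_QNCwf hD
  have hs : Fintype.card (Option (Fin n) × Fin L) * Fintype.card ((Fin n ⊕ Fin 1) ⊕ Fin L) +
      2 * Fintype.card ((Fin n ⊕ Fin 1) ⊕ Fin L) + Fintype.card (Option (Fin n) × Fin L) * 1 =
      ((n + 1) * L + 2) * (n + 1 + L) + (n + 1) * L := by
    simp only [Fintype.card_prod, Fintype.card_option, Fintype.card_sum, Fintype.card_fin]
    ring
  rw [hs] at h
  refine (congrArg (fun d => Impl QNCwf 3 _ (diagonal d)) (funext fun z => ?_)).mp h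
  rw [Fintype.prod_prod_type_right, QC.weightPhase]
  refine Finset.prod_congr rfl fun l _ => ?_
  rw [Fintype.prod_option]
  by_cases hl : z (Sum.inr l) = true
  · have e : ∀ i : Fin n, D (some i, l) z =
        cexp (if z (Sum.inl (Sum.inl i)) = true then
          ((2 * Real.pi / 2 ^ (l.1 + 1) : ℝ) : ℂ) * I else 0) := fun i => by
      by_cases hi : z (Sum.inl (Sum.inl i)) = true <;> simp [D, hl, hi]
    simp only [e, ← Complex.exp_sum]
    simp only [D, hl, if_true]
    rw [← Complex.exp_add]
    congr 1
    have hw := cast_weight (z ∘ Sum.inl ∘ Sum.inl)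
    push_cast
    rw [hw, sub_eq_add_neg, add_comm, mul_add, add_div, Finset.mul_sum, Finset.sum_div]
    congr 1
    · refine Finset.sum_congr rfl fun i _ => ?_
      simp only [Function.comp]
      split_ifs
      · ring
      · simp
    · ring
  · simp [D, hl]

/-- Apply `Impl.test` to the uniform state of `L` qubits. If |x| = j all rotations are trivial.
Otherwise 0 < ||x| - j| < 2^L, so some qubit acquires the relative phase -1 and its factor 1 + (-1)
kills the inner product. -/
theorem Impl.cPhase_weight_QNC {n j L : ℕ} (hj : j ≤ n) (hL : n < 2 ^ L) :
    Impl QNCwf 25 (5 * L + 2 * (((n + 1) * L + 2) * (n + 1 + L) + (n + 1) * L) +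
      (2 ^ (L + 1) * (9 * L + 21) + 4 * L + 4))
      (diagonal (cPhase fun x : Fin n → Bool => decide (weight x = j))) := by
  have hW : Impl QNCwf 1 L (QC.loc fun _ : Fin L => hMat) := by
    simpa using Impl.loc oneQubit_subset_QNCwf (u := fun _ : Fin L => hMat) fun _ => hMat_unitary
  have hR := Impl.ptPhase_QNC (Sum.elim (fun _ => true) fun _ => false : Fin 1 ⊕ Fin L → Bool)
    |>.controlledReflection (n := n)
  have hWy : ∀ y, QC.loc (fun _ : Fin L => hMat) y (fun _ => false) =
      ((1 / √2 : ℝ) : ℂ) ^ L := fun y => by simp [QC.loc, hMat, sgn]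
  have h := Impl.test adjClosed_QNCwf hW (Impl.weightPhase n L j) (g := fun x => x (Sum.inr 0))
    (f := fun x => decide (weight (x ∘ Sum.inl) = j)) hR ?_ ?_
  · refine h.mono le_rfl ?_
    simp only [Fintype.card_sum, Fintype.card_fin]
    rw [Nat.add_comm 1 L]
    ring_nf
    omega
  · intro x hx y
    have hx' : weight (x ∘ Sum.inl) = j := by simpa using hx
    have e : (Sum.elim x y ∘ Sum.inl ∘ Sum.inl : Fin n → Bool) = x ∘ Sum.inl := rfl
    simp [QC.weightPhase, e, hx']
  · intro x hx
    have hx' : weight (x ∘ Sum.inl) ≠ j := by simpa using hx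
    have e : ∀ y : Fin L → Bool,
        (Sum.elim x y ∘ Sum.inl ∘ Sum.inl : Fin n → Bool) = x ∘ Sum.inl := fun _ => rfl
    have hwn : weight (x ∘ Sum.inl : Fin n → Bool) ≤ n := by
      simpa [weight] using Finset.card_filter_le (Finset.univ : Finset (Fin n))
        fun i => (x ∘ Sum.inl) i = true
    simp only [hWy, ← mul_assoc]
    rw [← Finset.sum_mul, ← Finset.mul_sum]
    have : ∑ y : Fin L → Bool, QC.weightPhase n L j (Sum.elim x y) = 0 := by
      simp only [QC.weightPhase, Sum.elim_inr, e]
      obtain ⟨l, hl⟩ := exists_rotation_eq_neg_one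
        (t := ((weight (x ∘ Sum.inl : Fin n → Bool) : ℤ) - j)) (by omega) (L := L) (by omega)
      have := Finset.prod_univ_sum (fun _ : Fin L => (Finset.univ : Finset Bool)) fun l b =>
        if b = true then Complex.exp (2 * Real.pi * Complex.I *
          ((weight (x ∘ Sum.inl : Fin n → Bool) : ℤ) - j : ℤ) / 2 ^ (l.1 + 1)) else 1
      rw [Fintype.piFinset_univ] at this
      rw [← this]
      refine Finset.prod_eq_zero (Finset.mem_univ l) ?_
      rw [Fintype.sum_bool, if_pos rfl, hl]
      simp
    rw [this]; ring

/-- The event |x| ≥ k is the disjoint union of the events |x| = j for k ≤ j ≤ n. In the product of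
their phases only the factor j = |x| can differ from 1. -/
theorem Impl.cPhase_threshold_QNC (n k : ℕ) :
    Impl QNCwf 27 (153 * (n + 1) ^ 4) (diagonal (cPhase (threshold n k))) := by
  set X := n + 1 with hX
  obtain ⟨L, hL, hL1, hL2⟩ : ∃ L, n < 2 ^ L ∧ 2 ^ L ≤ 2 * X ∧ L ≤ X := by
    -- This `L` is large enough to separate weights up to `n`, while 2^L ≤ 2(n + 1) keeps the
    -- exponential size of the reflection linear in `n` up to the factor `L`.
    refine ⟨Nat.log 2 n + 1, Nat.lt_pow_succ_log_self (by norm_num) n, ?_, ?_⟩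
    · rcases Nat.eq_zero_or_pos n with rfl | h
      · simp [hX]
      · have := Nat.pow_log_le_self 2 h.ne'
        rw [pow_succ]
        omega
    · have := Nat.log_le_self 2 n
      omega
  have hj : ∀ j : Fin X, Impl QNCwf 25 (150 * X ^ 3) (diagonal fun x : Fin n ⊕ Fin 1 → Bool =>
      if k ≤ j then cPhase (fun x : Fin n → Bool => decide (weight x = j)) x else 1) := by
    intro j
    by_cases hk : k ≤ j
    · simp only [if_pos hk]
      refine (Impl.cPhase_weight_QNC (by omega) hL).mono le_rfl ?_
      have h1 : 5 * L + 2 * ((X * L + 2) * (X + L) + X * L) +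
          (2 ^ (L + 1) * (9 * L + 21) + 4 * L + 4) ≤
          5 * X + 2 * ((X * X + 2) * (X + X) + X * X) +
          (2 * X * 2 * (9 * X + 21) + 4 * X + 4) := by
        rw [pow_succ]
        gcongr
      refine h1.trans ?_
      have hX1 : 1 ≤ X := by omega
      have h2 : X ≤ X ^ 3 := by simpa using Nat.pow_le_pow_right hX1 (show 1 ≤ 3 by norm_num)
      have h3 : X ^ 2 ≤ X ^ 3 := Nat.pow_le_pow_right hX1 (by norm_num)
      have h4 : 1 ≤ X ^ 3 := Nat.one_le_pow _ _ hX1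
      clear_value X
      ring_nf
      linarith
    · simp only [if_neg hk]
      have := (Impl.one (S := QNCwf) (ι := Fin n ⊕ Fin 1)).mono (d' := 25) (s' := 150 * X ^ 3)
        (by omega) (by omega)
      rwa [← Matrix.diagonal_one] at this
  refine (congrArg (fun d => Impl QNCwf 27 (153 * X ^ 4) (diagonal d)) (funext fun x => ?_)).mp
    ((Impl.prod_diagonal fanoutGates_subset_QNCwf hj).mono le_rfl ?_)
  · have hw : weight (x ∘ Sum.inl : Fin n → Bool) < X := by
      have : weight (x ∘ Sum.inl : Fin n → Bool) ≤ n := by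
        simpa [weight] using Finset.card_filter_le (Finset.univ : Finset (Fin n))
          fun i => (x ∘ Sum.inl) i = true
      omega
    rw [Finset.prod_eq_single (⟨_, hw⟩ : Fin X)]
    · by_cases hk : k ≤ weight (x ∘ Sum.inl : Fin n → Bool) <;>
        simp [cPhase, threshold, hk, sgn]
    · intro j _ hj
      have : weight (x ∘ Sum.inl : Fin n → Bool) ≠ j := fun h => hj (Fin.ext h.symm)
      simp [cPhase, this, sgn]
    · simp
  · have hX1 : 1 ≤ X := by omega
    have h2 : X ≤ X ^ 4 := by simpa using Nat.pow_le_pow_right hX1 (show 1 ≤ 4 by norm_num)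
    have h3 : X ^ 2 ≤ X ^ 4 := Nat.pow_le_pow_right hX1 (by norm_num)
    simp only [Fintype.card_sum, Fintype.card_fin, ← hX]
    clear_value X
    ring_nf
    linarith

/-- `QTC` circuits are simulated by `QNC_wf` circuits. -/
theorem impl_QTC_of_QNC : ∀ g ∈ QTC, Impl QNCwf 29
    ((155 * Polynomial.X ^ 4 + 1 : Polynomial ℕ).eval g.1) (g.2.1 : Op (Fin g.1)) := by
  rintro ⟨m, U⟩ ((h | h) | ⟨n, k, h⟩)
  · exact (Impl.gate (Or.inl (Or.inl h))).mono (by norm_num) (by simp)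
  · exact (Impl.gate (Or.inl (Or.inr h))).mono (by norm_num) (by simp)
  · rw [h]
    refine (Impl.oracleGate_of_cPhase oneQubit_subset_QNCwf
      (Impl.cPhase_threshold_QNC n k)).mono le_rfl ?_
    have h2 : n + 1 ≤ (n + 1) ^ 4 := by
      simpa using Nat.pow_le_pow_right (Nat.succ_pos n) (show 1 ≤ 4 by norm_num)
    simp [oracleGate, permGate]
    omega

/-! ### Unitary `2 × 2` matrices -/

/-- The matrix of a Givens rotation. -/
noncomputable def givens (a b : ℂ) (r : ℝ) : Matrix Bool Bool ℂ := fun y x =>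
  (r : ℂ)⁻¹ * if y then (if x then a else -b) else if x then star b else star a

/-- Rotates the vector (a, b) to (r, 0) with r its norm; the real nonnegative `r` lets a unit column
end up with entry exactly 1. For the zero vector the identity serves. -/
theorem exists_givens (a b : ℂ) : ∃ (W : Matrix Bool Bool ℂ) (r : ℝ), Wᴴ * W = 1 ∧ 0 ≤ r ∧
    W true false * a + W true true * b = 0 ∧ W false false * a + W false true * b = r ∧
    (r = 0 → a = 0 ∧ b = 0) := by
  by_cases h : a = 0 ∧ b = 0
  · exact ⟨1, 0, by simp, le_rfl, by simp [h.1, h.2], by simp [h.1, h.2], fun _ => h⟩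
  have hpos : 0 < ‖a‖ ^ 2 + ‖b‖ ^ 2 := by
    rcases not_and_or.1 h with h | h
    · have := norm_pos_iff.2 h; positivity
    · have := norm_pos_iff.2 h; positivity
  set r := √(‖a‖ ^ 2 + ‖b‖ ^ 2) with hr
  have hr0 : 0 < r := Real.sqrt_pos.2 hpos
  have hrc : (r : ℂ) ≠ 0 := by exact_mod_cast hr0.ne'
  have hr2 : (r : ℂ) ^ 2 = star a * a + star b * b := by
    change _ = (starRingEnd ℂ) a * a + (starRingEnd ℂ) b * b
    rw [Complex.conj_mul', Complex.conj_mul']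
    have := Real.sq_sqrt hpos.le
    rw [← hr] at this
    exact_mod_cast this
  refine ⟨givens a b r, r, ?_, hr0.le, ?_, ?_, fun h => absurd h hr0.ne'⟩
  · have hs : star ((r : ℂ)⁻¹) = (r : ℂ)⁻¹ := by
      change (starRingEnd ℂ) _ = _
      rw [map_inv₀, Complex.conj_ofReal]
    have hi : (r : ℂ)⁻¹ * (r : ℂ)⁻¹ * (star a * a + star b * b) = 1 := by
      rw [← hr2]; field_simp
    ext y x
    rw [Matrix.mul_apply, Fintype.sum_bool]
    simp only [givens, Matrix.conjTranspose_apply, star_mul', hs, Matrix.one_apply]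
    cases y <;> cases x <;>
      simp only [if_true, reduceCtorEq, if_false, star_star, star_neg] <;>
      first | linear_combination hi | ring
  · simp [givens]; ring
  · simp only [givens, Bool.false_eq_true, if_false, if_true]
    have : (r : ℂ)⁻¹ * (r : ℂ) ^ 2 = r := by field_simp
    rw [hr2] at this
    linear_combination this

/-- A Givens rotation sends an eigenvector to a multiple of the first basis vector, so the conjugate
`B` is upper triangular. Being unitary as well, it is diagonal. -/
theorem exists_diagonalization {W : Matrix Bool Bool ℂ} (hW : Wᴴ * W = 1) :
    ∃ (Q : Matrix Bool Bool ℂ) (d : Bool → ℂ), Qᴴ * Q = 1 ∧ (∀ b, star (d b) * d b = 1) ∧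
      W = Qᴴ * diagonal d * Q := by
  obtain ⟨μ, hμ⟩ := Module.End.exists_eigenvalue (Matrix.toLin' W)
  obtain ⟨v, hv⟩ := hμ.exists_hasEigenvector
  have hWv : W *ᵥ v = μ • v := by
    have := hv.apply_eq_smul
    rwa [Matrix.toLin'_apply] at this
  obtain ⟨Q, r, hQ, hr, h1, h2, h3⟩ := exists_givens (v false) (v true)
  have hr0 : (r : ℂ) ≠ 0 := by
    intro h
    obtain ⟨hf, ht⟩ := h3 (by exact_mod_cast h)
    refine hv.2 (funext fun b => ?_)
    cases b
    · exact hf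
    · exact ht
  have hQQ : Q * Qᴴ = 1 := mul_eq_one_comm.1 hQ
  set B := Q * W * Qᴴ with hB
  have hBu : Bᴴ * B = 1 := by
    rw [hB, Matrix.conjTranspose_mul, Matrix.conjTranspose_mul, Matrix.conjTranspose_conjTranspose]
    calc Q * (Wᴴ * Qᴴ) * (Q * W * Qᴴ) = Q * Wᴴ * (Qᴴ * Q) * W * Qᴴ := by
          simp only [Matrix.mul_assoc]
      _ = Q * (Wᴴ * W) * Qᴴ := by rw [hQ]; simp only [Matrix.mul_one, Matrix.mul_assoc]
      _ = 1 := by rw [hW, Matrix.mul_one, hQQ]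
  have hQv : Q *ᵥ v = fun b => if b then 0 else (r : ℂ) := by
    funext b
    simp only [Matrix.mulVec, dotProduct, Fintype.sum_bool]
    cases b
    · simp only [Bool.false_eq_true, if_false]
      rw [add_comm, h2]
    · simp only [if_true]
      rw [add_comm, h1]
  have hBv : B *ᵥ (Q *ᵥ v) = μ • (Q *ᵥ v) := by
    rw [hB, ← Matrix.mulVec_mulVec, Matrix.mulVec_mulVec v, hQ, Matrix.one_mulVec,
      ← Matrix.mulVec_mulVec, hWv, Matrix.mulVec_smul]
  have hBtf : B true false = 0 := by
    rw [hQv] at hBv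
    have := congrFun hBv true
    simp only [Matrix.mulVec, dotProduct, Fintype.sum_bool, Pi.smul_apply, smul_eq_mul] at this
    simpa [hr0] using this
  have e1 := congrFun (congrFun hBu false) false
  have e2 := congrFun (congrFun hBu false) true
  have e3 := congrFun (congrFun hBu true) true
  simp only [Matrix.mul_apply, Fintype.sum_bool, Matrix.conjTranspose_apply, hBtf, mul_zero,
    Matrix.one_apply_eq, zero_add, star_zero, zero_mul] at e1 e2 e3
  rw [Matrix.one_apply_ne (by decide)] at e2
  have hne : star (B false false) ≠ 0 := left_ne_zero_of_mul_eq_one e1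
  have hBft : B false true = 0 := (mul_eq_zero.1 e2).resolve_left hne
  refine ⟨Q, fun b => B b b, hQ, ?_, ?_⟩
  · rintro (_ | _)
    · exact e1
    · simpa [hBft] using e3
  · have hd : diagonal (fun b => B b b) = B := by
      ext y x
      cases y <;> cases x <;> simp [hBtf, hBft]
    rw [hd, hB]
    calc W = (Qᴴ * Q) * W * (Qᴴ * Q) := by rw [hQ]; simp
      _ = _ := by simp only [Matrix.mul_assoc]

/-! ### Two-qubit gates from `CNOT` and one-qubit gates -/

/-- Operators on two bits. -/
abbrev Op₂ : Type := Matrix (Bool × Bool) (Bool × Bool) ℂ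

/-- A matrix on two bits as an operator on two qubits. -/
def twoOp (M : Op₂) : Op (Fin 2) := fun y x => M (y 0, y 1) (x 0, x 1)

theorem twoOp_mul (A B : Op₂) : twoOp (A * B) = twoOp A * twoOp B := by
  ext y x
  simp only [twoOp, Matrix.mul_apply]
  exact (Fintype.sum_equiv (finTwoArrowEquiv Bool) _ _ fun z => rfl).symm

/-- Multiplexed one-qubit operators, controlled by the first qubit. -/
def muxFst (W : Bool → Matrix Bool Bool ℂ) : Op₂ :=
  fun y x => if y.1 = x.1 then W x.1 y.2 x.2 else 0

/-- Multiplexed one-qubit operators, controlled by the second qubit. -/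
def muxSnd (W : Bool → Matrix Bool Bool ℂ) : Op₂ :=
  fun y x => if y.2 = x.2 then W x.2 y.1 x.1 else 0

theorem muxFst_mul_apply (W : Bool → Matrix Bool Bool ℂ) (A : Op₂) (a b : Bool) (j : Bool × Bool) :
    (muxFst W * A) (a, b) j = W a b false * A (a, false) j + W a b true * A (a, true) j := by
  cases a <;> simp [Matrix.mul_apply, Fintype.sum_prod_type, muxFst, add_comm]

theorem muxSnd_mul_apply (W : Bool → Matrix Bool Bool ℂ) (A : Op₂) (a b : Bool) (j : Bool × Bool) :
    (muxSnd W * A) (a, b) j = W b a false * A (false, b) j + W b a true * A (true, b) j := by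
  cases b <;> simp [Matrix.mul_apply, Fintype.sum_prod_type, muxSnd, add_comm]

theorem conjTranspose_muxFst (W : Bool → Matrix Bool Bool ℂ) :
    (muxFst W)ᴴ = muxFst fun b => (W b)ᴴ := by
  ext ⟨a, b⟩ ⟨c, d⟩
  cases a <;> cases c <;> simp [muxFst, Matrix.conjTranspose_apply]

theorem conjTranspose_muxSnd (W : Bool → Matrix Bool Bool ℂ) :
    (muxSnd W)ᴴ = muxSnd fun b => (W b)ᴴ := by
  ext ⟨a, b⟩ ⟨c, d⟩
  cases b <;> cases d <;> simp [muxSnd, Matrix.conjTranspose_apply]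

theorem muxFst_unitary {W : Bool → Matrix Bool Bool ℂ} (h : ∀ b, (W b)ᴴ * W b = 1) :
    (muxFst W)ᴴ * muxFst W = 1 := by
  rw [conjTranspose_muxFst]
  ext ⟨a, b⟩ ⟨c, d⟩
  have := congrFun (congrFun (h a) b) d
  rw [Matrix.mul_apply, Fintype.sum_bool, Matrix.one_apply] at this
  rw [muxFst_mul_apply]
  by_cases hac : a = c
  · subst hac
    simp only [muxFst, if_true]
    rw [add_comm, this, Matrix.one_apply]
    simp
  · simp [muxFst, hac]

theorem muxSnd_unitary {W : Bool → Matrix Bool Bool ℂ} (h : ∀ b, (W b)ᴴ * W b = 1) :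
    (muxSnd W)ᴴ * muxSnd W = 1 := by
  rw [conjTranspose_muxSnd]
  ext ⟨a, b⟩ ⟨c, d⟩
  have := congrFun (congrFun (h b) a) c
  rw [Matrix.mul_apply, Fintype.sum_bool, Matrix.one_apply] at this
  rw [muxSnd_mul_apply]
  by_cases hbd : b = d
  · subst hbd
    simp only [muxSnd, if_true]
    rw [add_comm, this, Matrix.one_apply]
    simp
  · simp [muxSnd, hbd]

theorem cnot_mem_QACwf : oracleGate (andFun 1) ∈ QACwf := Or.inl (Or.inr ⟨1, le_rfl, rfl⟩)

theorem Impl.locTwo {u v : Matrix Bool Bool ℂ} (hu : uᴴ * u = 1) (hv : vᴴ * v = 1) :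
    Impl QACwf 1 2 (QC.loc ![u, v]) := by
  simpa using Impl.loc oneQubit_subset_QACwf (u := ![u, v]) fun i => by
    fin_cases i
    · exact hu
    · exact hv

theorem loc_diagonal {ι : Type} [Fintype ι] [DecidableEq ι] (d : ι → Bool → ℂ) :
    loc (fun i => diagonal (d i)) = diagonal fun x => ∏ i, d i (x i) := by
  ext y x
  by_cases h : y = x
  · subst h; simp [loc]
  · rw [diagonal_apply_ne _ h, loc]
    obtain ⟨i, hi⟩ := Function.ne_iff.1 h
    exact Finset.prod_eq_zero (Finset.mem_univ i) (diagonal_apply_ne _ hi)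

theorem diagonal_unitary {d : Bool → ℂ} (h : ∀ b, star (d b) * d b = 1) :
    (diagonal d)ᴴ * diagonal d = 1 := by
  rw [Matrix.diagonal_conjTranspose, Matrix.diagonal_mul_diagonal, ← Matrix.diagonal_one]
  congr 1
  funext b
  exact h b

/-- Two-qubit phases. -/
theorem Impl.diagonal_two {d : Bool → Bool → ℂ} (hd : ∀ a b, star (d a b) * d a b = 1) :
    Impl QACwf 4 6 (diagonal fun x : Fin 2 → Bool => d (x 0) (x 1)) := by
  have hne : ∀ a b, d a b ≠ 0 := fun a b => right_ne_zero_of_mul_eq_one (hd a b)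
  have hnorm : ∀ {z : ℂ}, star z * z = 1 ↔ ‖z‖ = 1 := fun {z} => by
    change (starRingEnd ℂ) z * z = 1 ↔ _
    rw [Complex.conj_mul']
    constructor
    · intro h
      have : ‖z‖ ^ 2 = 1 := by exact_mod_cast h
      exact (pow_eq_one_iff_of_nonneg (norm_nonneg z) two_ne_zero).1 this
    · intro h; simp [h]
  -- The aim is d(a, b) = p(a) q(b) s(a ⊕ b), where s is applied between two CNOTs. With s(1) = r,
  -- matching three entries determines p and q, and the entry (1, 1) then forces this value of r².
  obtain ⟨r, hr⟩ := IsAlgClosed.exists_pow_nat_eq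
    (d false true * d true false / (d true true * d false false)) (n := 2) (by norm_num)
  have hrn : ‖r‖ = 1 := by
    have := congrArg norm hr
    simp only [norm_pow, norm_div, norm_mul, hnorm.1 (hd _ _), mul_one, div_one] at this
    exact (pow_eq_one_iff_of_nonneg (norm_nonneg r) two_ne_zero).1 this
  have hr0 : r ≠ 0 := fun h => by simp [h] at hrn
  have hr2 : d true true * d false false * r ^ 2 = d false true * d true false := by
    rw [hr]
    field_simp [hne]
  let p : Bool → ℂ := fun a => if a then d true false / (d false false * r) else 1
  let q : Bool → ℂ := fun b => if b then d false true / r else d false false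
  let s : Bool → ℂ := fun c => if c then r else 1
  have hp : ∀ b, star (p b) * p b = 1 := fun b => hnorm.2 (by
    cases b <;> simp [p, hnorm.1 (hd _ _), hrn])
  have hq : ∀ b, star (q b) * q b = 1 := fun b => hnorm.2 (by
    cases b <;> simp [q, hnorm.1 (hd _ _), hrn])
  have hs : ∀ b, star (s b) * s b = 1 := fun b => hnorm.2 (by
    cases b <;> simp [s, hrn])
  have hc : Impl QACwf 1 1 (funM (oracleMap (andFun 1))) := Impl.gate cnot_mem_QACwf
  have h1 := Impl.locTwo (diagonal_unitary hp) (diagonal_unitary hq)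
  have h2 := Impl.locTwo (u := diagonal fun _ => 1) (diagonal_unitary fun _ => by simp)
    (diagonal_unitary hs)
  have e1 : (![diagonal p, diagonal q] : Fin 2 → Matrix Bool Bool ℂ) =
      fun i => diagonal (![p, q] i) := by
    funext i; fin_cases i <;> rfl
  have e2 : (![diagonal fun _ => 1, diagonal s] : Fin 2 → Matrix Bool Bool ℂ) =
      fun i => diagonal (![fun _ => 1, s] i) := by
    funext i; fin_cases i <;> rfl
  rw [e1, loc_diagonal] at h1
  rw [e2, loc_diagonal] at h2
  have h3 := (hc.mul h2).mul hc
  rw [funM_conj_diagonal (oracleMap_involutive _)] at h3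
  have h4 := h1.mul h3
  rw [Matrix.diagonal_mul_diagonal] at h4
  refine (congrArg (fun d => Impl QACwf 4 6 (diagonal d)) (funext fun x => ?_)).mp
    (h4.mono (d' := 4) (s' := 6) (by norm_num) (by norm_num))
  have o0 : oracleMap (andFun 1) x 0 = x 0 := by
    rw [oracleMap, ← Fin.castSucc_zero, Fin.snoc_castSucc]
    rfl
  have o1 : oracleMap (andFun 1) x 1 = xor (x 1) (x 0) := by
    rw [oracleMap, show (1 : Fin 2) = Fin.last 1 from rfl, Fin.snoc_last]
    congr 1
    simp only [andFun, Fin.forall_fin_one, Bool.decide_eq_true]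
    rfl
  simp only [Function.comp, Fin.prod_univ_two, o1, Matrix.cons_val_zero, Matrix.cons_val_one]
  have hA := hne false false
  have hB := hne true true
  cases x 0 <;> cases x 1 <;> simp [p, q, s]
  · field_simp
  · field_simp
  · field_simp
    linear_combination -hr2

/-- Diagonalize W₀ᴴW₁ = QᴴdQ. Then W₀ = (W₀Qᴴ)·1·Q and W₁ = (W₀Qᴴ)·d·Q, so the multiplexer is a
two-qubit diagonal gate between gates on the second qubit. -/
theorem Impl.muxFst {W : Bool → Matrix Bool Bool ℂ} (h : ∀ b, (W b)ᴴ * W b = 1) :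
    Impl QACwf 6 10 (twoOp (QC.muxFst W)) := by
  have h0 : W false * (W false)ᴴ = 1 := mul_eq_one_comm.1 (h false)
  have hu : ((W false)ᴴ * W true)ᴴ * ((W false)ᴴ * W true) = 1 := by
    rw [Matrix.conjTranspose_mul, Matrix.conjTranspose_conjTranspose, Matrix.mul_assoc,
      ← Matrix.mul_assoc (W false), h0, Matrix.one_mul, h true]
  obtain ⟨Q, d, hQ, hd, e⟩ := exists_diagonalization hu
  have hQ' : Q * Qᴴ = 1 := mul_eq_one_comm.1 hQ
  have hL : (W false * Qᴴ)ᴴ * (W false * Qᴴ) = 1 := by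
    rw [Matrix.conjTranspose_mul, Matrix.conjTranspose_conjTranspose, Matrix.mul_assoc,
      ← Matrix.mul_assoc _ (W false), h false, Matrix.one_mul, hQ']
  have hW1 : W true = W false * Qᴴ * diagonal d * Q := by
    rw [Matrix.mul_assoc (W false * Qᴴ), Matrix.mul_assoc (W false), ← Matrix.mul_assoc Qᴴ, ← e,
      ← Matrix.mul_assoc, h0, Matrix.one_mul]
  have hW0 : W false = W false * Qᴴ * diagonal (fun _ => 1) * Q := by
    rw [Matrix.diagonal_one, Matrix.mul_one, Matrix.mul_assoc, hQ, Matrix.mul_one]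
  let D : Bool → Bool → ℂ := fun a b => if a then d b else 1
  have hD : ∀ a b, star (D a b) * D a b = 1 := by
    rintro (_ | _) b
    · simp [D]
    · exact hd b
  have hI := ((Impl.locTwo (u := 1) (by simp) hL).mul (Impl.diagonal_two hD)).mul
    (Impl.locTwo (u := 1) (by simp) hQ)
  have hent : ∀ a, W a = W false * Qᴴ * diagonal (D a) * Q := by
    rintro (_ | _)
    · exact hW0
    · exact hW1
  convert hI.mono (d' := 6) (s' := 10) (by norm_num) (by norm_num) using 1
  ext y x
  set L := W false * Qᴴ with hLdef
  rw [twoOp, QC.muxFst, Matrix.mul_apply]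
  simp only [Matrix.mul_diagonal, QC.loc, Fin.prod_univ_two, Matrix.cons_val_zero,
    Matrix.cons_val_one]
  rw [← Equiv.sum_comp (finTwoArrowEquiv Bool).symm, Fintype.sum_prod_type]
  simp only [finTwoArrowEquiv_symm_apply, Matrix.cons_val_zero, Matrix.cons_val_one,
    Fintype.sum_bool, Matrix.one_apply]
  have e2 := congrFun (congrFun (hent (x 0)) (y 1)) (x 1)
  rw [Matrix.mul_apply, Fintype.sum_bool, Matrix.mul_diagonal, Matrix.mul_diagonal] at e2
  rw [e2]
  cases y 0 <;> cases x 0 <;> simp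

theorem Impl.muxSnd {W : Bool → Matrix Bool Bool ℂ} (h : ∀ b, (W b)ᴴ * W b = 1) :
    Impl QACwf 6 10 (twoOp (QC.muxSnd W)) := by
  have := (Impl.muxFst h).lift (Equiv.swap (0 : Fin 2) 1).toEmbedding
  convert this using 1
  ext y x
  rw [lift_equiv_apply]
  simp [twoOp, QC.muxFst, QC.muxSnd]

/-! ### Elimination of the columns of a unitary `4 × 4` matrix -/

/-- `A` is a product of `k` multiplexers. -/
def MuxProd (k : ℕ) (A : Op₂) : Prop := Impl QACwf (6 * k) (10 * k) (twoOp A)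

theorem MuxProd.of_mul {k : ℕ} {M A : Op₂} (hM : Mᴴ * M = 1)
    (hI : Impl QACwf 6 10 (twoOp Mᴴ)) (h : MuxProd k (M * A)) : MuxProd (k + 1) A := by
  have e : A = Mᴴ * (M * A) := by rw [← Matrix.mul_assoc, hM, Matrix.one_mul]
  rw [MuxProd, e, twoOp_mul]
  exact (hI.mul h).mono (by omega) (by omega)

theorem conjTranspose_unitary {W : Matrix Bool Bool ℂ} (h : Wᴴ * W = 1) : Wᴴᴴ * Wᴴ = 1 := by
  rw [Matrix.conjTranspose_conjTranspose]
  exact mul_eq_one_comm.1 h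

theorem MuxProd.of_muxFst {k : ℕ} {W : Bool → Matrix Bool Bool ℂ} {A : Op₂}
    (hW : ∀ b, (W b)ᴴ * W b = 1) (h : MuxProd k (muxFst W * A)) : MuxProd (k + 1) A :=
  h.of_mul (muxFst_unitary hW) (by
    rw [conjTranspose_muxFst]
    exact Impl.muxFst fun b => conjTranspose_unitary (hW b))

theorem MuxProd.of_muxSnd {k : ℕ} {W : Bool → Matrix Bool Bool ℂ} {A : Op₂}
    (hW : ∀ b, (W b)ᴴ * W b = 1) (h : MuxProd k (muxSnd W * A)) : MuxProd (k + 1) A :=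
  h.of_mul (muxSnd_unitary hW) (by
    rw [conjTranspose_muxSnd]
    exact Impl.muxSnd fun b => conjTranspose_unitary (hW b))

theorem mul_unitary {M A : Op₂} (hM : Mᴴ * M = 1) (hA : Aᴴ * A = 1) : (M * A)ᴴ * (M * A) = 1 := by
  rw [Matrix.conjTranspose_mul, Matrix.mul_assoc, ← Matrix.mul_assoc Mᴴ, hM, Matrix.one_mul, hA]

theorem col_norm {A : Op₂} (hA : Aᴴ * A = 1) (j : Bool × Bool) :
    ‖A (false, false) j‖ ^ 2 + ‖A (false, true) j‖ ^ 2 + ‖A (true, false) j‖ ^ 2 +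
      ‖A (true, true) j‖ ^ 2 = 1 := by
  have := congrFun (congrFun hA j) j
  rw [Matrix.mul_apply, Matrix.one_apply_eq] at this
  simp only [Matrix.conjTranspose_apply, Fintype.sum_prod_type, Fintype.sum_bool] at this
  have e : ∀ z : ℂ, star z * z = ((‖z‖ ^ 2 : ℝ) : ℂ) := fun z => by
    push_cast; exact Complex.conj_mul' z
  simp only [e] at this
  norm_cast at this
  linarith

/-- A unit column forces the corresponding row to be a unit row. -/
theorem row_eq_zero {A : Op₂} (hA : Aᴴ * A = 1) {i j : Bool × Bool}
    (h : ∀ k, A k i = if k = i then 1 else 0) (hij : j ≠ i) : A i j = 0 := by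
  have := congrFun (congrFun hA i) j
  rw [Matrix.mul_apply, Matrix.one_apply_ne hij.symm] at this
  rw [← this, Finset.sum_eq_single i]
  · rw [Matrix.conjTranspose_apply, h i, if_pos rfl, star_one, one_mul]
  · intro k _ hk
    rw [Matrix.conjTranspose_apply, h k, if_neg hk, star_zero, zero_mul]
  · simp

theorem ofReal_eq_one {r : ℝ} (hr : 0 ≤ r) (h : ‖(r : ℂ)‖ ^ 2 = 1) : (r : ℂ) = 1 := by
  rw [Complex.norm_real, Real.norm_of_nonneg hr] at h
  have : r = 1 := by nlinarith
  exact_mod_cast this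

/-- By unitarity the first two rows are unit rows too, so what remains is a 2 × 2 unitary on the
block where the first bit is 1, and that is a multiplexer. -/
theorem muxProd_of_two_cols {A : Op₂} (hA : Aᴴ * A = 1)
    (h0 : ∀ k, A k (false, false) = if k = (false, false) then 1 else 0)
    (h1 : ∀ k, A k (false, true) = if k = (false, true) then 1 else 0) : MuxProd 1 A := by
  let T : Matrix Bool Bool ℂ := fun b c => A (true, b) (true, c)
  let W : Bool → Matrix Bool Bool ℂ := fun a => if a then T else 1
  have e : A = muxFst W := by
    ext ⟨a, b⟩ ⟨c, d⟩
    cases c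
    · cases d
      · rw [h0]; cases a <;> cases b <;> simp [QC.muxFst, W, T]
      · rw [h1]; cases a <;> cases b <;> simp [QC.muxFst, W, T]
    · cases a
      · cases b
        · rw [row_eq_zero hA h0 (by simp)]; simp [QC.muxFst]
        · rw [row_eq_zero hA h1 (by simp)]; simp [QC.muxFst]
      · simp [QC.muxFst, W, T]
  rw [MuxProd, e]
  refine Impl.muxFst ?_
  rintro (_ | _)
  · simp [W]
  · ext b c
    have := congrFun (congrFun hA (true, b)) (true, c)
    simp only [Matrix.mul_apply, Matrix.conjTranspose_apply, Fintype.sum_prod_type,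
      Fintype.sum_bool, Matrix.one_apply] at this
    rw [row_eq_zero hA h0 (j := (true, c)) (by simp), row_eq_zero hA h1 (j := (true, c)) (by simp)]
      at this
    change (Tᴴ * T) b c = _
    rw [Matrix.mul_apply, Fintype.sum_bool, Matrix.conjTranspose_apply, Matrix.conjTranspose_apply]
    simpa [T, Matrix.one_apply] using this

/-- The second column lives on the two strings with second bit 1, so a rotation of the first qubit
controlled by that bit makes it a unit vector. The first column lies in the other block and is
untouched. -/
theorem muxProd_of_col_of_zero {A : Op₂} (hA : Aᴴ * A = 1)
    (h0 : ∀ k, A k (false, false) = if k = (false, false) then 1 else 0)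
    (h1 : A (true, false) (false, true) = 0) : MuxProd 2 A := by
  obtain ⟨V, r, hV, hr, k1, k2, -⟩ := exists_givens (A (false, true) (false, true))
    (A (true, true) (false, true))
  let W : Bool → Matrix Bool Bool ℂ := fun b => if b then V else 1
  have hW : ∀ b, (W b)ᴴ * W b = 1 := by
    rintro (_ | _)
    · simp [W]
    · exact hV
  have hu := mul_unitary (muxSnd_unitary hW) hA
  have hff : A (false, false) (false, true) = 0 := row_eq_zero hA h0 (by simp)
  refine MuxProd.of_muxSnd hW (muxProd_of_two_cols hu ?_ ?_)
  · rintro ⟨a, b⟩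
    rw [muxSnd_mul_apply, h0, h0]
    cases a <;> cases b <;> simp [W]
  · have z1 : (muxSnd W * A) (false, false) (false, true) = 0 := by
      rw [muxSnd_mul_apply, hff, h1]; simp
    have z2 : (muxSnd W * A) (true, false) (false, true) = 0 := by
      rw [muxSnd_mul_apply, hff, h1]; simp
    have z3 : (muxSnd W * A) (true, true) (false, true) = 0 := by
      rw [muxSnd_mul_apply]; exact k1
    have z4 : (muxSnd W * A) (false, true) (false, true) = r := by
      rw [muxSnd_mul_apply]; exact k2
    have := col_norm hu (false, true)
    rw [z1, z2, z3, z4] at this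
    have hr1 := ofReal_eq_one hr (by simpa using this)
    rintro ⟨a, b⟩
    cases a <;> cases b
    · rw [z1]; simp
    · rw [z4, hr1]; simp
    · rw [z2]; simp
    · rw [z3]; simp

theorem muxProd_of_col {A : Op₂} (hA : Aᴴ * A = 1)
    (h0 : ∀ k, A k (false, false) = if k = (false, false) then 1 else 0) : MuxProd 3 A := by
  obtain ⟨V, r, hV, hr, k1, k2, -⟩ := exists_givens (A (true, false) (false, true))
    (A (true, true) (false, true))
  -- The Givens rotation clears the entry at (1, 1); the flip moves the zero to (1, 0), where the
  -- next reduction needs it.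
  let W : Bool → Matrix Bool Bool ℂ := fun b => if b then xMat * V else 1
  have hW : ∀ b, (W b)ᴴ * W b = 1 := by
    rintro (_ | _)
    · simp [W]
    · change (xMat * V)ᴴ * (xMat * V) = 1
      rw [Matrix.conjTranspose_mul, Matrix.mul_assoc, ← Matrix.mul_assoc xMatᴴ, xMat_unitary,
        Matrix.one_mul, hV]
  have hu := mul_unitary (muxFst_unitary hW) hA
  refine MuxProd.of_muxFst hW (muxProd_of_col_of_zero hu ?_ ?_)
  · rintro ⟨a, b⟩
    rw [muxFst_mul_apply, h0, h0]
    cases a <;> cases b <;> simp [W]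
  · rw [muxFst_mul_apply]
    simpa [W, Matrix.mul_apply, xMat] using k1

theorem muxProd_of_zeros {A : Op₂} (hA : Aᴴ * A = 1) (h1 : A (false, true) (false, false) = 0)
    (h2 : A (true, true) (false, false) = 0) : MuxProd 4 A := by
  obtain ⟨V, r, hV, hr, k1, k2, -⟩ := exists_givens (A (false, false) (false, false))
    (A (true, false) (false, false))
  let W : Bool → Matrix Bool Bool ℂ := fun b => if b then 1 else V
  have hW : ∀ b, (W b)ᴴ * W b = 1 := by
    rintro (_ | _)
    · exact hV
    · simp [W]
  have hu := mul_unitary (muxSnd_unitary hW) hA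
  refine MuxProd.of_muxSnd hW (muxProd_of_col hu ?_)
  have z1 : (muxSnd W * A) (false, true) (false, false) = 0 := by
    rw [muxSnd_mul_apply, h1, h2]; simp
  have z2 : (muxSnd W * A) (true, true) (false, false) = 0 := by
    rw [muxSnd_mul_apply, h1, h2]; simp
  have z3 : (muxSnd W * A) (true, false) (false, false) = 0 := by
    rw [muxSnd_mul_apply]; exact k1
  have z4 : (muxSnd W * A) (false, false) (false, false) = r := by
    rw [muxSnd_mul_apply]; exact k2
  have := col_norm hu (false, false)
  rw [z1, z2, z3, z4] at this
  have hr1 := ofReal_eq_one hr (by simpa using this)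
  rintro ⟨a, b⟩
  cases a <;> cases b
  · rw [z4, hr1]; simp
  · rw [z1]; simp
  · rw [z3]; simp
  · rw [z2]; simp

/-- For each value of the first bit, a rotation of the second qubit clears the entry of the first
column with second bit 1. The column is then supported where the second bit is 0, and the next
multiplexer finishes it. -/
theorem muxProd_of_unitary {A : Op₂} (hA : Aᴴ * A = 1) : MuxProd 5 A := by
  obtain ⟨V, r, hV, hr, k1, k2, -⟩ := exists_givens (A (false, false) (false, false))
    (A (false, true) (false, false))
  obtain ⟨V', r', hV', hr', k1', k2', -⟩ := exists_givens (A (true, false) (false, false))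
    (A (true, true) (false, false))
  let W : Bool → Matrix Bool Bool ℂ := fun b => if b then V' else V
  have hW : ∀ b, (W b)ᴴ * W b = 1 := by
    rintro (_ | _)
    · exact hV
    · exact hV'
  refine MuxProd.of_muxFst hW (muxProd_of_zeros (mul_unitary (muxFst_unitary hW) hA) ?_ ?_)
  · rw [muxFst_mul_apply]; exact k1
  · rw [muxFst_mul_apply]; exact k1'

theorem Impl.twoQubit_QAC (U : Matrix.unitaryGroup (Bits 2) ℂ) :
    Impl QACwf 30 50 (U.1 : Op (Fin 2)) := by
  let A : Op₂ := fun y x => U.1 ![y.1, y.2] ![x.1, x.2]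
  have e2 : ∀ x : Fin 2 → Bool, ![x 0, x 1] = x := fun x => by
    funext i; fin_cases i <;> rfl
  have hA : Aᴴ * A = 1 := by
    ext y x
    have := congrFun (congrFun (Matrix.UnitaryGroup.star_mul_self U) ![y.1, y.2]) ![x.1, x.2]
    rw [Matrix.mul_apply, ← Equiv.sum_comp (finTwoArrowEquiv Bool).symm] at this
    rw [Matrix.mul_apply]
    refine this.trans ?_
    simp only [Matrix.one_apply]
    congr 1
    refine propext ⟨fun h => Prod.ext (congrFun h 0) (congrFun h 1), fun h => by rw [h]⟩
  have e : (U.1 : Op (Fin 2)) = twoOp A := by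
    ext y x
    simp only [twoOp, A, e2]
  rw [e]
  exact muxProd_of_unitary hA

/-- `QNC_wf` circuits are simulated by `QAC_wf` circuits. -/
theorem impl_QNC_of_QAC : ∀ g ∈ QNCwf, Impl QACwf 30
    ((50 : Polynomial ℕ).eval g.1) (g.2.1 : Op (Fin g.1)) := by
  rintro ⟨m, U⟩ ((h | h) | h)
  · exact (Impl.gate (Or.inl (Or.inl h))).mono (by norm_num) (by simp)
  · obtain rfl : m = 2 := h
    simpa using Impl.twoQubit_QAC U
  · exact (Impl.gate (Or.inr h)).mono (by norm_num) (by simp)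

/-! ### Parity -/

theorem count_ofFn_eq {n : ℕ} (x : Bits n) :
    (List.ofFn x).count true = (Finset.univ.filter fun i => x i = true).card := by
  induction n with
  | zero => simp
  | succ n ih =>
    rw [List.ofFn_succ, List.count_cons, ih, Fin.card_filter_univ_succ]
    cases x 0 <;> simp

theorem slice_parity (n : ℕ) : slice parity n = par := by
  funext x
  rw [slice, par, ← count_ofFn_eq]
  congr

theorem inputBits_zero {n : ℕ} (x : Bits n) :
    inputBits x 0 = (Fin.snoc x false : Bits (n + 1)) := by
  have : (Fin.append x (constBits 0 false) : Bits (n + 0)) = x := by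
    funext i
    exact Fin.append_left x (constBits 0 false) i
  rw [inputBits, this]

theorem probLast_permMatrix {N : ℕ} (σ : Equiv.Perm (Bits (N + 1))) (x : Bits (N + 1)) :
    probLast ((permMatrix σ).mulVec (ket x)) (σ x (Fin.last N)) = 1 := by
  rw [probLast, ket, Matrix.mulVec_single_one, Finset.sum_eq_single (σ x)]
  · simp [permMatrix]
  · intro y _ hy
    simp [permMatrix, hy]
  · simp

/-- Over an auxiliary gate set containing the parity oracle a single gate decides parity exactly, so
only this gate has to be simulated. -/
theorem parity_mem_constDepthPolySize :
    parity ∈ constDepthPolySize {g | ∃ n : ℕ, g = oracleGate (par : Bits n → Bool)} 0 := by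
  refine ⟨1, Polynomial.X + 2, fun n => ⟨0,
    ⟨[⟨[⟨oracleGate (par : Bits n → Bool), Function.Embedding.refl _⟩],
      List.pairwise_singleton _ _⟩]⟩, ?_, le_rfl, ?_, fun x => ?_⟩⟩
  · intro l hl g hg
    obtain rfl := List.mem_singleton.1 hl
    obtain rfl := List.mem_singleton.1 hg
    exact ⟨n, rfl⟩
  · simp [Circuit.size]
    omega
  · have hM : Circuit.matrix (N := n + 0 + 1) ⟨[⟨[⟨oracleGate (par : Bits n → Bool),
        Function.Embedding.refl _⟩], List.pairwise_singleton _ _⟩]⟩ =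
        permMatrix (oracleMap_involutive (par : Bits n → Bool)).toPerm := by
      simp only [Circuit.matrix, List.reverse_singleton, List.map_singleton, List.prod_singleton,
        Layer.matrix]
      ext y x
      exact if_pos fun i hi => absurd rfl (hi i)
    rw [Circuit.run, hM, slice_parity, inputBits_zero, sub_zero]
    have := probLast_permMatrix (oracleMap_involutive (par : Bits n → Bool)).toPerm
      (Fin.snoc x false : Bits (n + 1))
    rw [Function.Involutive.coe_toPerm, oracleMap, Fin.snoc_last, Fin.snoc_last, Fin.init_snoc,
      Bool.false_xor] at this
    exact this.ge

theorem impl_QNC_parity : ∀ g ∈ {g | ∃ n : ℕ, g = oracleGate (par : Bits n → Bool)},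
    Impl QNCwf 5 ((4 * Polynomial.X + 1 : Polynomial ℕ).eval g.1) (g.2.1 : Op (Fin g.1)) := by
  rintro _ ⟨n, rfl⟩
  have he : (4 * Polynomial.X + 1 : Polynomial ℕ).eval (oracleGate (par : Bits n → Bool)).1 =
      4 * (n + 1) + 1 := by
    simp [oracleGate, permGate]
  rw [he]
  rcases Nat.eq_zero_or_pos n with rfl | hn
  · exact (Impl.gate (S := QNCwf) (Or.inl (Or.inl rfl))).mono (by norm_num) (by norm_num)
  · have h1 : Impl QNCwf 1 1 (funM (fanMap : (Fin n ⊕ Fin 1 → Bool) → _)) :=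
      Impl.fanMap_of_fanoutGate (Or.inr ⟨n, hn, rfl⟩)
    have h2 := Impl.hInit (ι := Fin n) oneQubit_subset_QNCwf
    have h3 := (h2.mul h1).mul h2
    rw [← diagonal_cPhase_par_eq] at h3
    refine (Impl.oracleGate_of_cPhase oneQubit_subset_QNCwf h3).mono le_rfl ?_
    simp only [Fintype.card_fin]
    omega

/-! ### Preparation of nekomata -/

theorem sum_norm_sq_col_real {ι : Type} [Fintype ι] [DecidableEq ι] {W : Op ι} (h : Wᴴ * W = 1)
    (x : ι → Bool) : ∑ y, ‖W y x‖ ^ 2 = 1 := by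
  exact_mod_cast sum_norm_sq_col h x

/-- Passage from labelled to numbered qubits: `ρ` becomes the side register of the nekomata and the
implementation's ancillas become the clean ones. The data already come first, so no reordering is
needed. -/
theorem Impl.exists_prepares {S : Set Gate} {n d s : ℕ} {ρ : Type} [Fintype ρ] [DecidableEq ρ]
    {W : Op (Fin n ⊕ ρ)} (h : Impl S d s W) {φ₀ φ₁ : (ρ → Bool) → ℂ}
    (h0 : ∑ u, ‖φ₀ u‖ ^ 2 = 1) (h1 : ∑ u, ‖φ₁ u‖ ^ 2 = 1)
    (hW : ∀ y, W y (fun _ => false) = ((1 / √2 : ℝ) : ℂ) *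
        ((if y ∘ Sum.inl = (fun _ => false) then 1 else 0) * φ₀ (y ∘ Sum.inr)) +
      ((1 / √2 : ℝ) : ℂ) *
        ((if y ∘ Sum.inl = (fun _ => true) then 1 else 0) * φ₁ (y ∘ Sum.inr))) :
    ∃ (m a : ℕ) (C : Circuit (n + m + a)) (ψ : State (n + m)), C.HasGateSet S ∧ C.depth ≤ d ∧
      C.size ≤ s + n + Fintype.card ρ ∧ IsNekomata ψ ∧ Prepares C ψ := by
  have hu := h.unitary
  obtain ⟨α, _, _, t, M', hM, ht, eM⟩ := h
  let eρ := Fintype.equivFin ρ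
  let eα := Fintype.equivFin α
  let e₀ : Fin n ⊕ ρ ≃ Fin (n + Fintype.card ρ) :=
    (Equiv.sumCongr (Equiv.refl _) eρ).trans finSumFinEquiv
  let e : (Fin n ⊕ ρ) ⊕ α ≃ Fin (n + Fintype.card ρ + Fintype.card α) :=
    (Equiv.sumCongr e₀ eα).trans finSumFinEquiv
  obtain ⟨C, hC, hd, hs, hg⟩ := (hM.lift e.toEmbedding).exists_circuit
  refine ⟨Fintype.card ρ, Fintype.card α, C, fun y => W (y ∘ e₀) fun _ => false, hg, hd.le,
    by omega, ⟨?_, Equiv.refl _, fun u => φ₀ (u ∘ eρ), fun u => φ₁ (u ∘ eρ), ?_, ?_, ?_⟩, ?_⟩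
  · rw [IsNormalized, ← sum_norm_sq_col_real hu fun _ => false]
    exact (Equiv.arrowCongr e₀ (Equiv.refl Bool)).symm.sum_comp
      fun z => ‖W z fun _ => false‖ ^ 2
  · rw [IsNormalized, ← h0]
    exact (Equiv.arrowCongr eρ (Equiv.refl Bool)).symm.sum_comp fun z => ‖φ₀ z‖ ^ 2
  · rw [IsNormalized, ← h1]
    exact (Equiv.arrowCongr eρ (Equiv.refl Bool)).symm.sum_comp fun z => ‖φ₁ z‖ ^ 2
  · funext y
    refine (hW _).trans ?_
    simp only [Pi.add_apply, Pi.smul_apply, smul_eq_mul, tensor, ket, Pi.single_apply]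
    rfl
  · funext y
    have hcol : C.run (constBits _ false) y = C.matrix y (constBits _ false) := by
      rw [Circuit.run, ket, Matrix.mulVec_single_one]; rfl
    have hin : constBits (n + Fintype.card ρ + Fintype.card α) false ∘ e =
        pad α fun _ => false := by
      funext i
      rcases i with i | i <;> rfl
    rw [hcol, hC, lift_equiv_apply, hin, ← mul_padM_apply M', eM, padM_mul_apply]
    have hiff : (y ∘ e) ∘ Sum.inr = (fun _ => false) ↔
        (fun j => y (Fin.natAdd (n + Fintype.card ρ) j)) = constBits (Fintype.card α) false := by
      constructor
      · intro H
        funext j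
        have := congrFun H (eα.symm j)
        simpa [e, constBits] using this
      · intro H
        funext j
        exact congrFun H (eα j)
    simp only [hiff, tensor, ket, Pi.single_apply, mul_ite, mul_one, mul_zero]
    rfl

/-- The side states are √2 times the first column of `W` restricted to the two data values. They are
normalized because the 0ⁿ part has weight 1/2, carried by the zero string alone, and the 1ⁿ part has
the rest. -/
theorem exists_nekomata {n : ℕ} (hn : 1 ≤ n) :
    ∃ (m a : ℕ) (C : Circuit (n + m + a)) (ψ : State (n + m)), C.HasGateSet QTC ∧ C.depth ≤ 46 ∧
      C.size ≤ (n + 1) ^ 2 * (33 * n + 57) + n + n + (n + 1) ^ 2 * (n + 2) ∧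
      IsNekomata ψ ∧ Prepares C ψ := by
  obtain ⟨m, rfl, W, hW, hsupp, hhalf⟩ := Impl.nekomata hn
  have hu := hW.unitary
  have hr : ((1 / √2 : ℝ) : ℂ) * ((√2 : ℝ) : ℂ) = 1 := by
    rw [← Complex.ofReal_mul, one_div, inv_mul_cancel₀ (by positivity), Complex.ofReal_one]
  have h2 : ∀ z : ℂ, ‖((√2 : ℝ) : ℂ) * z‖ ^ 2 = 2 * ‖z‖ ^ 2 := fun z => by
    rw [norm_mul, mul_pow, Complex.norm_real, Real.norm_eq_abs, sq_abs,
      Real.sq_sqrt zero_le_two]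
  have hne : (fun _ : Fin n => false) ≠ fun _ => true := fun h => by
    simpa using congrFun h ⟨0, hn⟩
  have hz : ∀ (x : Fin n → Bool) (u : (Σ _ : Fin ((n + 1) ^ 2), Row n) → Bool),
      x ≠ (fun _ => true) → Sum.elim x u ≠ (fun _ => false) →
      W (Sum.elim x u) (fun _ => false) = 0 := fun x u hx hxu => by
    by_contra h
    rcases hsupp _ h with h | h
    · exact hxu h
    · exact hx (funext h)
  have h0 : ∑ u, ‖W (Sum.elim (fun _ => false) u) fun _ => false‖ ^ 2 = 1 / 2 := by
    rw [Finset.sum_eq_single (fun _ => false)]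
    · rw [← hhalf]
      congr 3
      funext i
      rcases i with i | i <;> rfl
    · intro u _ hu
      rw [hz _ u hne fun h => hu (funext fun i => congrFun h (Sum.inr i))]
      simp
    · simp
  have h1 : ∑ u, ‖W (Sum.elim (fun _ => true) u) fun _ => false‖ ^ 2 = 1 / 2 := by
    have htot := sum_norm_sq_col_real hu fun _ => false
    rw [← (Equiv.sumArrowEquivProdArrow _ _ Bool).symm.sum_comp, Fintype.sum_prod_type,
      Finset.sum_eq_add (fun _ => false) (fun _ => true) hne] at htot
    · change ∑ u, ‖W (Sum.elim (fun _ => false) u) fun _ => false‖ ^ 2 +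
        ∑ u, ‖W (Sum.elim (fun _ => true) u) fun _ => false‖ ^ 2 = 1 at htot
      linarith
    · rintro x - ⟨hx0, hx1⟩
      refine Finset.sum_eq_zero fun u _ => ?_
      change ‖W (Sum.elim x u) _‖ ^ 2 = 0
      rw [hz x u hx1 fun h => hx0 (funext fun i => congrFun h (Sum.inl i))]
      simp
    · simp
    · simp
  obtain ⟨m, a, C, ψ, hg, hd, hs, hψ, hC⟩ := hW.exists_prepares
    (φ₀ := fun u => ((√2 : ℝ) : ℂ) * W (Sum.elim (fun _ => false) u) fun _ => false)
    (φ₁ := fun u => ((√2 : ℝ) : ℂ) * W (Sum.elim (fun _ => true) u) fun _ => false)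
    (by simp only [h2]; rw [← Finset.mul_sum, h0]; norm_num)
    (by simp only [h2]; rw [← Finset.mul_sum, h1]; norm_num) fun y => by
      obtain ⟨x, u, rfl⟩ : ∃ x u, y = Sum.elim x u :=
        ⟨y ∘ Sum.inl, y ∘ Sum.inr, (Sum.elim_comp_inl_inr y).symm⟩
      simp only [Sum.elim_comp_inl, Sum.elim_comp_inr]
      by_cases hx0 : x = fun _ => false
      · subst hx0
        simp only [hne, if_true, if_false]
        linear_combination (-W (Sum.elim (fun _ => false) u) fun _ => false) * hr
      · by_cases hx1 : x = fun _ => true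
        · subst hx1
          simp only [hx0, if_true, if_false]
          linear_combination (-W (Sum.elim (fun _ => true) u) fun _ => false) * hr
        · simp only [hx0, hx1, if_false]
          rw [hz x u hx1 fun h => hx0 (funext fun i => congrFun h (Sum.inl i))]
          ring
  refine ⟨m, a, C, ψ, hg, hd, hs.trans_eq ?_, hψ, hC⟩
  simp

/-- For n = 0 the strings 0ⁿ and 1ⁿ coincide, so the side states must make up a unit vector by
themselves: one qubit in the state H|0⟩, with side states |0⟩ and |1⟩. -/
theorem exists_nekomata_zero :
    ∃ (m a : ℕ) (C : Circuit (0 + m + a)) (ψ : State (0 + m)), C.HasGateSet QTC ∧ C.depth ≤ 1 ∧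
      C.size ≤ 2 ∧ IsNekomata ψ ∧ Prepares C ψ := by
  have h := Impl.loc oneQubit_subset_QTC (u := fun _ : Fin 0 ⊕ Fin 1 => hMat)
    fun _ => hMat_unitary
  have hs : ∀ z : Fin 1 → Bool,
      ∑ u, ‖(Pi.single z 1 : (Fin 1 → Bool) → ℂ) u‖ ^ 2 = 1 := fun z => by
    rw [Finset.sum_eq_single z] <;> simp +contextual
  obtain ⟨m, a, C, ψ, hg, hd, hs, hψ, hC⟩ := h.exists_prepares
    (hs fun _ => false) (hs fun _ => true) fun y => by
      rw [if_pos (Subsingleton.elim _ _), if_pos (Subsingleton.elim _ _)]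
      have hy : ∀ b, y ∘ Sum.inr = (fun _ : Fin 1 => b) ↔ y (Sum.inr 0) = b := fun b =>
        ⟨fun h => congrFun h 0, fun h => funext fun i => by rw [Subsingleton.elim i 0]; exact h⟩
      simp only [QC.loc, Fintype.prod_sum_type, Finset.univ_eq_empty, Finset.prod_empty,
        Finset.univ_unique, Finset.prod_singleton, Fin.default_eq_zero, Pi.single_apply, hy, hMat]
      cases y (Sum.inr 0) <;> simp [sgn]
  exact ⟨m, a, C, ψ, hg, hd, hs.trans (by simp), hψ, hC⟩

end QC

theorem corollary1p4 :
    (∃ (d : ℕ) (p : Polynomial ℕ), ∀ n : ℕ,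
      ∃ (m a : ℕ) (C : QC.Circuit (n + m + a)) (ψ : QC.State (n + m)),
        C.HasGateSet QC.QTC ∧ C.depth ≤ d ∧ C.size ≤ p.eval n ∧
        QC.IsNekomata ψ ∧ QC.Prepares C ψ) ∧
    QC.BQTC0 = QC.BQNCwf0 ∧ QC.BQNCwf0 = QC.BQACwf0 ∧
    QC.EQTC0 = QC.EQNCwf0 ∧ QC.EQNCwf0 = QC.EQACwf0 ∧
    QC.parity ∈ QC.EQTC0 := by
  -- Three inclusions in a cycle, each valid for every error, give both chains of equalities.
  have h1 := QC.constDepthPolySize_subset QC.impl_QTC_of_QNC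
  have h2 := QC.constDepthPolySize_subset QC.impl_QNC_of_QAC
  have h3 := QC.constDepthPolySize_subset QC.impl_QAC_of_QTC
  refine ⟨⟨46, (Polynomial.X + 1) ^ 2 * (33 * Polynomial.X + 57) + Polynomial.X + Polynomial.X +
    (Polynomial.X + 1) ^ 2 * (Polynomial.X + 2), fun n => ?_⟩,
    (h1 _).antisymm ((h2 _).trans (h3 _)), (h2 _).antisymm ((h3 _).trans (h1 _)),
    (h1 _).antisymm ((h2 _).trans (h3 _)), (h2 _).antisymm ((h3 _).trans (h1 _)), ?_⟩
  · rcases Nat.eq_zero_or_pos n with rfl | hn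
    · obtain ⟨m, a, C, ψ, hg, hd, hs, hψ, hC⟩ := QC.exists_nekomata_zero
      exact ⟨m, a, C, ψ, hg, hd.trans (by norm_num), hs.trans (by simp), hψ, hC⟩
    · obtain ⟨m, a, C, ψ, hg, hd, hs, hψ, hC⟩ := QC.exists_nekomata hn
      exact ⟨m, a, C, ψ, hg, hd, hs.trans (by simp), hψ, hC⟩
  · exact h3 _ (h2 _ (QC.constDepthPolySize_subset QC.impl_QNC_parity _
      QC.parity_mem_constDepthPolySize))
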